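/- **Setting.** Let $V$ be a complex vector space with a symmetric bilinear form $x\cdot y$ (space-time), and $\mathfrak g$ a finite-dimensional complex Lie algebra with an invariant symmetric form $\mathrm{tr}(s\,r)$ that has an orthonormal basis $t^a$; put $f^{abc}=\mathrm{tr}([t^a,t^b]t^c)$. There are $n$ particles at distinct points $\sigma_1,\dots,\sigma_n\in\mathbb C$ with momenta $k_i\in V$; the set $g$ of labels indexes the gluons, with $t_i\in\mathfrak g$, and its complement $h$ the gravitons, with polarizations $\epsilon_i\in V$. Write $\sigma_{ij}=\sigma_i-\sigma_j$ and $P(\sigma_i)=\sum_{j\ne i}k_j/\sigma_{ij}$. The worldsheet system $S_{YM,\Psi}$ consists of free fermions $\Psi^\mu,\rho^a$ (mutually anticommuting) with $\Psi^\mu(\sigma)\Psi^\nu(0)\sim\eta^{\mu\nu}/\sigma$, $\rho^a(\sigma)\rho^b(0)\sim\delta^{ab}/\sigma$, an independent current algebra $j^a(\sigma)j^b(0)\sim\frac12 f^{acd}f^{bcd}/\sigma^2+f^{abc}j^c(0)/\sigma$ (so that $-\frac12f^{abc}\rho^b\rho^c+j^a$ has level zero), and the ghosts, with $\langle\prod_{i\in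 F}\delta(\gamma(\sigma_i))\rangle=1/\sigma_{pq}$ if $F=\{p<q\}$ and $0$ if $|F|\neq2$. The vertex operators are $$u_t=\delta(\gamma)\,t\cdot\rho,\quad u_\epsilon=\delta(\gamma)\,\epsilon\cdot\Psi,\quad v_t=k\cdot\Psi\,t\cdot\rho+t^a\bigl(-\tfrac12f^{abc}\rho^b\rho^c+j^a\bigr),\quad v_\epsilon=\epsilon\cdot P+k\cdot\Psi\,\epsilon\cdot\Psi .$$ For a set $F$ of labels, $\langle F\rangle$ is the genus-zero correlator (Wick contraction of the fermions, operator product recursion for $j$, times the ghost correlator) of the fixed operators $u_i$, $i\in F$, and the integrated ones $v_i$, $i\notin F$, the factors being in increasing order of labels. **Notation.** For $T\subseteq g$ with $|T|\ge2$, smallest label $p$ and largest label $q$, $$\mathcal C(T)=\sum_{(c_1,\dots,c_r)}\frac{\mathrm{tr}\bigl(t_p[t_{c_1},[\dots,[t_{c_r},t_q]\dots]]\bigr)}{\sigma_{pc_1}\sigma_{c_1c_2}\cdots\sigma_{c_rq}\,\sigma_{qp}},\qquad \mathcal K(i,j|T)=\sigma_{ji}\,\mathcal C(T),$$ summed over the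 orderings of $T\setminus\{p,q\}$. Let $A_{ij}=k_i\cdot k_j/\sigma_{ij}$, $B_{ij}=\epsilon_i\cdot\epsilon_j/\sigma_{ij}$, $C_{ij}=\epsilon_i\cdot k_j/\sigma_{ij}$ for $i\ne j$, $A_{ii}=B_{ii}=0$, $C_{ii}=-\epsilon_i\cdot P(\sigma_i)$. For $h'\subseteq h$ and pairs $(c_i,d_i)$ let $M(h';c;d)$ be the skew matrix $\begin{pmatrix}A&-C^T\\C&B\end{pmatrix}$ whose $A$-rows are $h',c_1,\dots,c_m,d_1,\dots,d_m$ (in this order) and whose $B$-rows are $h$. For a partition $\mathcal T=\{T_1,\dots,T_m\}$ of $g$ with all $|T_i|\ge2$, let $\Pi$ be the Cachazo–He–Yuan matrix: its rows are $a\in h$, $i=1,\dots,m$, $i'=1',\dots,m'$, and then the $B$-rows $a\in h$, where row and column $i$ are the sums over $c\in T_i$ of the rows and columns $c$ of $A$ and $C$, and $i'$ the same sums with weights $\sigma_c$. Let $\Pi_{x,y}$ be $\Pi$ without the rows and columns $x,y$, and in exponents let $a$ be the place $1,\dots,|h|$ of a graviton in increasing order. Put $s_{\mathcal T}=(-1)^{m(m+1)/2+|h|(|h|-1)/2}$.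 **Theorem.** 1. If $\langle F\rangle\neq0$, then $|F|=2$: there are exactly two fixed operators. Suppose now $|F|=2$, $k_i^2=0$ for all $i$, $\epsilon_a\cdot k_a=0$ for $a\in h$, $\sum_ik_i=0$, and the scattering equations $k_i\cdot P(\sigma_i)=0$ hold for all $i$. The two fixed operators may be two gluons, two gravitons, or one of each. Below, $\mathcal T$ runs over all partitions $T_1,\dots,T_m$ of $g$ into sets with $|T_i|\ge2$. 2. $$\langle F\rangle=\sum_{\mathcal T}s_{\mathcal T}\sum_{c_i<d_i\in T_i}\mathcal K(c_1,d_1|T_1)\cdots\mathcal K(c_m,d_m|T_m)\ \mathrm{Pf}'M(h;c;d),$$ where for each $\mathcal T$ the inner sum with $\mathrm{Pf}'$ may be read in any of the following ways: for gravitons $a<b$, with $\mathrm{Pf}'M=\frac{(-1)^{a+b}}{\sigma_{ab}}\mathrm{Pf}\,M(h\setminus\{a,b\};c;d)$; or, for a trace $T_l$, by removing both rows $c_l,d_l$, with no choice of pair in $T_l$ and with $\mathcal K(c_l,d_l|T_l)/\sigma_{d_lc_l}=\mathcal C(T_l)$, i.e. as $(-1)^{m+1}\,\mathcal C(T_l)\sum_{c_i<d_i\in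 T_i,\,i\neq l}\prod_{i\ne l}\mathcal K(c_i,d_i|T_i)\ \mathrm{Pf}\,M(h;(c_i)_{i\ne l};(d_i)_{i\ne l})$. 3. It is the Einstein–Yang–Mills block of Cachazo, He and Yuan: $$\langle F\rangle=\sum_{\mathcal T}s_{\mathcal T}\,\mathcal C(T_1)\cdots\mathcal C(T_m)\ \mathrm{Pf}'\,\Pi,$$ where for each $\mathcal T$ the reduced Pfaffian $\mathrm{Pf}'\,\Pi$ may be computed as any of $$\frac{(-1)^{a+b}}{\sigma_{ab}}\mathrm{Pf}\,\Pi_{a,b}\ (a<b),\quad (-1)^{i+j+m+1}\,\mathrm{Pf}\,\Pi_{i,j'},\quad \frac{(-1)^{a+|h|+i}}{\sigma_a}\,\mathrm{Pf}\,\Pi_{a,i}\ (\sigma_a\ne0),\quad (-1)^{a+|h|+m+j+1}\,\mathrm{Pf}\,\Pi_{a,j'},$$ with $a,b\in h$ and $1\le i,j\le m$. -/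

import Mathlib

noncomputable section

namespace EYM

/-! ### Pfaffians -/

/-- Pfaffian of the skew array `(M x y)`, rows and columns running over the list `L` in its order
(expansion along the first row; the empty Pfaffian is `1`, those of odd size vanish). -/
def pfaffian {R : Type*} (M : R → R → ℂ) : List R → ℂ
  | [] => 1
  | x :: xs => ∑ p : Fin xs.length, (-1) ^ (p : ℕ) * M x xs[p] * pfaffian M (xs.eraseIdx p)
  termination_by L => L.length
  decreasing_by
    have := p.2
    simp only [List.length_eraseIdx, List.length_cons]
    split <;> omega

/-! ### External data -/

/-- Labels `Fin n`, those in `gluons` are gluons and the others gravitons. Particle `i` sits at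
`pos i` and has momentum `mom i`; `pol i` is the polarization vector (used for gravitons only) and
`col i` the Lie algebra element (used for gluons only). -/
structure ExternalData (V 𝔤 : Type*) (n : ℕ) where
  gluons : Finset (Fin n)
  pos : Fin n → ℂ
  mom : Fin n → V
  pol : Fin n → V
  col : Fin n → 𝔤

namespace ExternalData

variable {V 𝔤 : Type*} {n : ℕ}

/-- The graviton labels. -/
def gravitons (D : ExternalData V 𝔤 n) : Finset (Fin n) := D.gluonsᶜ

/-- `σ_{ij} = σ_i - σ_j`. -/
def diff (D : ExternalData V 𝔤 n) (i j : Fin n) : ℂ := D.pos i - D.pos j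

/-- The position (from `0`) of `a` in the increasing list of gravitons. -/
def rank (D : ExternalData V 𝔤 n) (a : Fin n) : ℕ := (D.gravitons.filter (· < a)).card

/-- `P(σ_i) = ∑_{j ≠ i} k_j / σ_{ij}`. -/
def momentumField [AddCommGroup V] [Module ℂ V] (D : ExternalData V 𝔤 n) (i : Fin n) : V :=
  ∑ j ∈ Finset.univ.erase i, (D.diff i j)⁻¹ • D.mom j

end ExternalData

/-- Null momenta, transverse polarizations, momentum conservation and the scattering equations. -/
structure OnShell {V 𝔤 : Type*} [AddCommGroup V] [Module ℂ V] {n : ℕ}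
    (η : LinearMap.BilinForm ℂ V) (D : ExternalData V 𝔤 n) : Prop where
  null : ∀ i, η (D.mom i) (D.mom i) = 0
  transverse : ∀ a ∈ D.gravitons, η (D.pol a) (D.mom a) = 0
  conservation : ∑ i, D.mom i = 0
  scattering : ∀ i, η (D.mom i) (D.momentumField i) = 0

/-! ### The worldsheet matter -/

section Matter

variable {V 𝔤 : Type*} [AddCommGroup V] [Module ℂ V] [LieRing 𝔤] [LieAlgebra ℂ 𝔤] {N n : ℕ}

/-- The pair `(x, s)` stands for the free fermion `x·Ψ + s·ρ`. -/
abbrev Fermion (V 𝔤 : Type*) := V × 𝔤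

/-- `x·Ψ` -/
def psi (x : V) : Fermion V 𝔤 := (x, 0)

/-- `s·ρ` -/
def rho (s : 𝔤) : Fermion V 𝔤 := (0, s)

/-- Contraction of two fermion insertions, from `Ψ^μ(σ)Ψ^ν(0) ~ η^{μν}/σ`, `ρ^a(σ)ρ^b(0) ~ δ^{ab}/σ`
and `Ψρ ~ 0`. Insertions at the same puncture belong to a normal-ordered product and are not
contracted. -/
def contraction (η : LinearMap.BilinForm ℂ V) (κ : LinearMap.BilinForm ℂ 𝔤) (σ : Fin n → ℂ)
    (x y : Fin n × Fermion V 𝔤) : ℂ :=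
  if x.1 = y.1 then 0 else (η x.2.1 y.2.1 + κ x.2.2 y.2.2) / (σ x.1 - σ y.1)

/-- Wick's theorem: the vacuum expectation value of an ordered product of fermions. -/
def fermionCorrelator (η : LinearMap.BilinForm ℂ V) (κ : LinearMap.BilinForm ℂ 𝔤) (σ : Fin n → ℂ)
    (L : List (Fin n × Fermion V 𝔤)) : ℂ :=
  pfaffian (contraction η κ σ) L

/-- `½ f^{abc} f^{a'bc}` contracted with `s_a r_{a'}`, where `f^{abc} = κ([b_a, b_b], b_c)` for an
orthonormal basis `b`. It is the level form of `j`; the fermion bilinear `-½ f^{abc} ρ^b ρ^c` has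
the opposite one, so that their sum has level zero. -/
def level (κ : LinearMap.BilinForm ℂ 𝔤) (b : Module.Basis (Fin N) ℂ 𝔤) (s r : 𝔤) : ℂ :=
  (1 / 2) * ∑ x, ∑ y, κ ⁅s, b x⁆ (b y) * κ ⁅r, b x⁆ (b y)

/-- Genus zero correlators of the current algebra
`(s·j)(z) (r·j)(w) ~ ℓ(s,r)/(z-w)² + ([s,r]·j)(w)/(z-w)`: the first current is replaced by its
singular operator products with all the other ones. -/
def currentCorrelator (ℓ : 𝔤 → 𝔤 → ℂ) (σ : Fin n → ℂ) : List (Fin n × 𝔤) → ℂ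
  | [] => 1
  | x :: xs => ∑ p : Fin xs.length,
      (ℓ x.2 xs[p].2 / (σ x.1 - σ xs[p].1) ^ 2 * currentCorrelator ℓ σ (xs.eraseIdx p)
        + 1 / (σ x.1 - σ xs[p].1) *
          currentCorrelator ℓ σ (xs.set p (xs[p].1, ⁅x.2, xs[p].2⁆)))
  termination_by L => L.length
  decreasing_by
    · have := p.2
      simp only [List.length_eraseIdx, List.length_cons]
      split <;> omega
    · simp

/-- A number times a normal-ordered product of fermions and currents `s·j`. -/
structure Monomial (V 𝔤 : Type*) where
  coeff : ℂ
  fermions : List (Fermion V 𝔤)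
  currents : List 𝔤

/-- A local operator: a finite sum of monomials. -/
abbrev LocalOperator (V 𝔤 : Type*) := List (Monomial V 𝔤)

/-- The matter part `t·ρ` of the fixed gluon operator `u_t = δ(γ) t·ρ`. -/
def uGluon (t : 𝔤) : LocalOperator V 𝔤 := [⟨1, [rho t], []⟩]

/-- The matter part `ε·Ψ` of the fixed graviton operator `u_ε = δ(γ) ε·Ψ`. -/
def uGraviton (ε : V) : LocalOperator V 𝔤 := [⟨1, [psi ε], []⟩]

/-- `v⁰_t = t^a (-½ f^{abc} ρ^b ρ^c + j^a)`. -/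
def vGluonZero (κ : LinearMap.BilinForm ℂ 𝔤) (b : Module.Basis (Fin N) ℂ 𝔤) (t : 𝔤) :
    LocalOperator V 𝔤 :=
  ⟨1, [], [t]⟩ :: (List.finRange N).flatMap fun x => (List.finRange N).map fun y =>
    ⟨-(1 / 2) * κ ⁅t, b x⁆ (b y), [rho (b x), rho (b y)], []⟩

/-- `v_t = k·Ψ t·ρ + v⁰_t`. -/
def vGluon (κ : LinearMap.BilinForm ℂ 𝔤) (b : Module.Basis (Fin N) ℂ 𝔤) (k : V) (t : 𝔤) :
    LocalOperator V 𝔤 :=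
  ⟨1, [psi k, rho t], []⟩ :: vGluonZero κ b t

/-- `v_ε = ε·P + k·Ψ ε·Ψ`. The argument `P` is the value of the field `P` at the puncture: inside a
correlator with the factors `exp(i k_j·X(σ_j))` this is `∑ k_j/(σ - σ_j)`. -/
def vGraviton (η : LinearMap.BilinForm ℂ V) (P k ε : V) : LocalOperator V 𝔤 :=
  [⟨η ε P, [], []⟩, ⟨1, [psi k, psi ε], []⟩]

/-- The correlator of an ordered product of local operators: expand into monomials; the fermions
and the currents of a product of monomials give independent factors. The last two arguments collect
the fermions and currents already read. -/
def matterCorrelator (η : LinearMap.BilinForm ℂ V) (κ : LinearMap.BilinForm ℂ 𝔤)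
    (b : Module.Basis (Fin N) ℂ 𝔤) (σ : Fin n → ℂ) :
    List (Fin n × LocalOperator V 𝔤) → List (Fin n × Fermion V 𝔤) → List (Fin n × 𝔤) → ℂ
  | [], Φ, J => fermionCorrelator η κ σ Φ * currentCorrelator (level κ b) σ J
  | x :: xs, Φ, J => (x.2.map fun m => m.coeff *
      matterCorrelator η κ b σ xs (Φ ++ m.fermions.map fun w => (x.1, w))
        (J ++ m.currents.map fun s => (x.1, s))).sum

/-- Sphere correlator `⟨∏ exp(q_i φ(σ_i))⟩` of the bosonized `β,γ` ghosts, in increasing order of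
`i`: it is zero unless the charges add up to `-2` (the two zero modes of `γ`), and
`∏_{i<j} σ_{ij}^{-q_i q_j}` otherwise. Here `δ(γ) = exp(-φ)`. -/
def ghostCorrelator (σ : Fin n → ℂ) (q : Fin n → ℤ) : ℂ :=
  if ∑ i, q i = -2 then ∏ i, ∏ j ∈ Finset.Ioi i, (σ i - σ j) ^ (-(q i * q j)) else 0

/-- The matter part of the operator of particle `i`: a fixed one (`u`) if `i ∈ F`, otherwise an
integrated one (`v`). -/
def vertexOperator (η : LinearMap.BilinForm ℂ V) (κ : LinearMap.BilinForm ℂ 𝔤)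
    (b : Module.Basis (Fin N) ℂ 𝔤) (D : ExternalData V 𝔤 n) (F : Finset (Fin n)) (i : Fin n) :
    LocalOperator V 𝔤 :=
  if i ∈ D.gluons then
    if i ∈ F then uGluon (D.col i) else vGluon κ b (D.mom i) (D.col i)
  else
    if i ∈ F then uGraviton (D.pol i) else vGraviton η (D.momentumField i) (D.mom i) (D.pol i)

/-- The correlator of the combined system with fixed operators at the labels in `F` and integrated
ones at all the others, in increasing order of the labels. -/
def correlator (η : LinearMap.BilinForm ℂ V) (κ : LinearMap.BilinForm ℂ 𝔤)
    (b : Module.Basis (Fin N) ℂ 𝔤) (D : ExternalData V 𝔤 n) (F : Finset (Fin n)) : ℂ :=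
  ghostCorrelator D.pos (fun i => if i ∈ F then -1 else 0) *
    matterCorrelator η κ b D.pos
      ((List.finRange n).map fun i => (i, vertexOperator η κ b D F i)) [] []

end Matter

/-! ### Combs, the matrices and their reduced Pfaffians -/

section Amplitude

variable {V 𝔤 : Type*} [AddCommGroup V] [Module ℂ V] [LieRing 𝔤] [LieAlgebra ℂ 𝔤] {n : ℕ}

/-- `tr(t_a [t_{c_1}, [ … , [t_{c_r}, t_b] … ]]) / (σ_{a c_1} σ_{c_1 c_2} ⋯ σ_{c_r b} σ_{b a})`. -/
def combTerm (κ : LinearMap.BilinForm ℂ 𝔤) (D : ExternalData V 𝔤 n) (a b : Fin n)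
    (c : List (Fin n)) : ℂ :=
  let l := a :: c ++ [b]
  κ (D.col a) (c.foldr (fun i x => ⁅D.col i, x⁆) (D.col b)) /
    (List.zipWith D.diff l (l.rotate 1)).prod

/-- `𝒞(T)`: the first and the last label of `T` are the ends of the comb, and the sum runs over all
orderings of the remaining ones. -/
def comb (κ : LinearMap.BilinForm ℂ 𝔤) (D : ExternalData V 𝔤 n) (T : Finset (Fin n)) : ℂ :=
  if h : T.Nonempty then
    ((((T.erase (T.min' h)).erase (T.max' h)).sort.permutations).map
      (combTerm κ D (T.min' h) (T.max' h))).sum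
  else 0

/-- `𝒦(i,j|T) = σ_{ji} 𝒞(T)`. -/
def combK (κ : LinearMap.BilinForm ℂ 𝔤) (D : ExternalData V 𝔤 n) (i j : Fin n)
    (T : Finset (Fin n)) : ℂ :=
  D.diff j i * comb κ D T

/-- `A_{ij} = k_i·k_j/σ_{ij}`, `A_{ii} = 0`. -/
def matA (η : LinearMap.BilinForm ℂ V) (D : ExternalData V 𝔤 n) (i j : Fin n) : ℂ :=
  if i = j then 0 else η (D.mom i) (D.mom j) / D.diff i j

/-- `B_{ij} = ε_i·ε_j/σ_{ij}`, `B_{ii} = 0`. -/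
def matB (η : LinearMap.BilinForm ℂ V) (D : ExternalData V 𝔤 n) (i j : Fin n) : ℂ :=
  if i = j then 0 else η (D.pol i) (D.pol j) / D.diff i j

/-- `C_{ij} = ε_i·k_j/σ_{ij}`, `C_{ii} = -ε_i·P(σ_i)`. -/
def matC (η : LinearMap.BilinForm ℂ V) (D : ExternalData V 𝔤 n) (i j : Fin n) : ℂ :=
  if i = j then -η (D.pol i) (D.momentumField i) else η (D.pol i) (D.mom j) / D.diff i j

/-- Rows and columns of the block matrix `(A, -Cᵀ; C, B)`: `mom i` for a row of `A` (a graviton or a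
chosen gluon), `pol a` for a row of `B`. -/
inductive Row (n : ℕ)
  | mom (i : Fin n)
  | pol (a : Fin n)

/-- The block matrix `(A, -Cᵀ; C, B)`. -/
def matM (η : LinearMap.BilinForm ℂ V) (D : ExternalData V 𝔤 n) : Row n → Row n → ℂ
  | .mom i, .mom j => matA η D i j
  | .mom i, .pol b => -matC η D b i
  | .pol a, .mom j => matC η D a j
  | .pol a, .pol b => matB η D a b

/-- The sum over `c_i < d_i` in `T_i`, where `T_1, …, T_m` is the list `Ts`, of
`∏ 𝒦(c_i,d_i|T_i)` times the Pfaffian of the block matrix with rows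
`(h, c_1, …, c_m, d_1, …, d_m | gravitons)`. Here `h` is a set of gravitons. -/
def combPfaffianSum (η : LinearMap.BilinForm ℂ V) (κ : LinearMap.BilinForm ℂ 𝔤)
    (D : ExternalData V 𝔤 n) (h : Finset (Fin n)) (Ts : List (Finset (Fin n))) : ℂ :=
  ∑ p ∈ Fintype.piFinset
      (fun i : Fin Ts.length => (Ts[i] ×ˢ Ts[i]).filter fun cd => cd.1 < cd.2),
    (∏ i : Fin Ts.length, combK κ D (p i).1 (p i).2 Ts[i]) *
      pfaffian (matM η D)
        (h.sort.map Row.mom ++ (List.ofFn fun i => Row.mom (p i).1) ++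
          (List.ofFn fun i => Row.mom (p i).2) ++ D.gravitons.sort.map Row.pol)

/-- The ways to reduce the sum of comb structures times Pfaffians: remove the `A`-rows of two
gravitons, or remove a whole trace `T_i` (both rows `c_i`, `d_i`). -/
inductive CombReduction (D : ExternalData V 𝔤 n) (Ts : List (Finset (Fin n)))
  | gravitons (a b : Fin n) (ha : a ∈ D.gravitons) (hb : b ∈ D.gravitons) (hab : a < b)
  | trace (i : Fin Ts.length)

/-- `∑ ∏ 𝒦(c_i,d_i|T_i) Pf′`. If two gravitons are removed, this is
`(-1)^{a+b}/σ_{ab}` times the sum over all pairs; if the trace `T_i` is removed, there is no choice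
of pair in `T_i`, whose comb structure contributes `𝒦(c,d|T_i)/σ_{dc} = 𝒞(T_i)`. -/
def combReduced (η : LinearMap.BilinForm ℂ V) (κ : LinearMap.BilinForm ℂ 𝔤)
    (D : ExternalData V 𝔤 n) (Ts : List (Finset (Fin n))) : CombReduction D Ts → ℂ
  | .gravitons a b _ _ _ => (-1) ^ (D.rank a + D.rank b) / D.diff a b *
      combPfaffianSum η κ D ((D.gravitons.erase a).erase b) Ts
  | .trace i => (-1) ^ (Ts.length + 1) * comb κ D Ts[i] *
      combPfaffianSum η κ D D.gravitons (Ts.eraseIdx i)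

/-- Rows and columns of the Cachazo–He–Yuan matrix `Π`: `mom a` and `pol a` for gravitons, and for
every trace `T` the rows `trace false T` (labelled `i`) and `trace true T` (labelled `i'`). -/
inductive PiRow (n : ℕ)
  | mom (a : Fin n)
  | trace (primed : Bool) (T : Finset (Fin n))
  | pol (a : Fin n)

/-- The weight of gluon `c` in a trace row: `1` in the row `i`, and `σ_c` in the row `i'`. -/
def weight (D : ExternalData V 𝔤 n) (primed : Bool) (c : Fin n) : ℂ :=
  if primed then D.pos c else 1

/-- The Cachazo–He–Yuan matrix `Π`. -/
def matPi (η : LinearMap.BilinForm ℂ V) (D : ExternalData V 𝔤 n) : PiRow n → PiRow n → ℂ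
  | .mom a, .mom b => matA η D a b
  | .mom a, .trace q S => ∑ d ∈ S, weight D q d * matA η D a d
  | .mom a, .pol b => -matC η D b a
  | .trace p T, .mom b => ∑ c ∈ T, weight D p c * matA η D c b
  | .trace p T, .trace q S => ∑ c ∈ T, ∑ d ∈ S, weight D p c * weight D q d * matA η D c d
  | .trace p T, .pol b => -∑ c ∈ T, weight D p c * matC η D b c
  | .pol a, .mom b => matC η D a b
  | .pol a, .trace q S => ∑ d ∈ S, weight D q d * matC η D a d
  | .pol a, .pol b => matB η D a b

/-- The Pfaffian of `Π` with graviton rows `h`, unprimed trace rows `Us`, primed trace rows `Us'`,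
and all the rows of the block `B`. -/
def piPfaffian (η : LinearMap.BilinForm ℂ V) (D : ExternalData V 𝔤 n) (h : Finset (Fin n))
    (Us Us' : List (Finset (Fin n))) : ℂ :=
  pfaffian (matPi η D)
    (h.sort.map PiRow.mom ++ Us.map (PiRow.trace false) ++ Us'.map (PiRow.trace true) ++
      D.gravitons.sort.map PiRow.pol)

/-- The two rows and columns that are removed from `Π`: `{a, b}`, `{i, j'}`, `{a, i}` or `{a, j'}`,
with `a < b` gravitons and `i`, `j` traces. -/
inductive Reduction (D : ExternalData V 𝔤 n) (Ts : List (Finset (Fin n)))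
  | gravitons (a b : Fin n) (ha : a ∈ D.gravitons) (hb : b ∈ D.gravitons) (hab : a < b)
  | traces (i j : Fin Ts.length)
  | gravitonTrace (a : Fin n) (ha : a ∈ D.gravitons) (hpos : D.pos a ≠ 0) (i : Fin Ts.length)
  | gravitonTracePrimed (a : Fin n) (ha : a ∈ D.gravitons) (j : Fin Ts.length)

/-- The reduced Pfaffian `Pf′ Π`, computed by removing the chosen rows and columns. The signs
are those of the positions of the removed rows. -/
def reducedPfaffian (η : LinearMap.BilinForm ℂ V) (D : ExternalData V 𝔤 n)
    (Ts : List (Finset (Fin n))) : Reduction D Ts → ℂ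
  | .gravitons a b _ _ _ => (-1) ^ (D.rank a + D.rank b) / D.diff a b *
      piPfaffian η D ((D.gravitons.erase a).erase b) Ts Ts
  | .traces i j => (-1) ^ ((i : ℕ) + j + Ts.length + 1) *
      piPfaffian η D D.gravitons (Ts.eraseIdx i) (Ts.eraseIdx j)
  | .gravitonTrace a _ _ i => (-1) ^ (D.rank a + D.gravitons.card + i) / D.pos a *
      piPfaffian η D (D.gravitons.erase a) (Ts.eraseIdx i) Ts
  | .gravitonTracePrimed a _ j =>
      (-1) ^ (D.rank a + D.gravitons.card + Ts.length + j + 1) *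
        piPfaffian η D (D.gravitons.erase a) Ts (Ts.eraseIdx j)

/-- The partitions of the gluons into sets with at least two elements. -/
def tracePartitions (D : ExternalData V 𝔤 n) : Finset (Finpartition D.gluons) :=
  Finset.univ.filter fun P => ∀ T ∈ P.parts, 2 ≤ T.card

/-- The parts of a partition as a list `T_1, …, T_m` (their order is immaterial). -/
def traces {D : ExternalData V 𝔤 n} (P : Finpartition D.gluons) : List (Finset (Fin n)) :=
  P.parts.toList

/-- The sign `(-1)^{m(m+1)/2 + |h|(|h|-1)/2}` of reordering the fermions of the vertex operators into
the block order of the rows, for `m` traces and `|h|` gravitons. -/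
def orderSign (D : ExternalData V 𝔤 n) (P : Finpartition D.gluons) : ℂ :=
  (-1) ^ (P.parts.card * (P.parts.card + 1) / 2 +
    D.gravitons.card * (D.gravitons.card - 1) / 2)

end Amplitude

end EYM

end

noncomputable section
namespace EYM

/-! ### Wick contraction in the exterior algebra -/

section Wick

variable {M N R : Type*} [AddCommGroup M] [Module ℂ M] [AddCommGroup N] [Module ℂ N]

/-! Correlators of free fermions are treated as linear functionals on an exterior algebra: `wick`
exponentiates the contraction with the propagator and takes the scalar part, and a Pfaffian is its
value on a product of vectors (`pfaffian_eq_wick`). Combining rows, contracting some fermions before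
others and deleting rows all become linear algebra.

Gluons. Replace `k_i·Ψ` by a formal vector `μ_i` and contract only `ρ`. The integrated operator at
one puncture has simple poles at the others, where it brackets the colours and adds the momenta,
together with a term contracting two `ρ`s; the double poles of `j` and of `ρρ` cancel because the
total level is zero (`gluonCorrelator_insert`). The sum over set partitions of `∏ -𝒞(T) (∑ μ_c) ∧ (∑
σ_d μ_d)` obeys the same recursion (`traceSum_insert`). For the combs this is partial fractions plus
the Jacobi identity (`chain_insert`); the shift of the weighted momentum sum drops out by colour
invariance of `𝒞(T)`. Hence the two agree (`gluonCorrelator_eq`).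

Fixed operators and diagonal. A fixed operator is the derivative of the integrated one with respect
to its own `k·Ψ`, so fixing `p` and `q` means contracting with the coordinates of `μ_p` and `μ_q`.
The terms `ε·P` come from the exponential of a contraction pairing only `k_a·Ψ` with `ε_a·Ψ`, so
they become the diagonal entries of `C` (`wickExp_rowProduct`). The correlator is thus a sum over
partitions of double contractions of the product `y` of all rows of `Π` (`correlator_eq`).

Reduction. On shell, `∑ μ_i` and `∑ σ_i μ_i` lie in the kernel of the matrix, and both multiply `y`
to zero. Therefore the double contraction with any dual vectors `α`, `β` is their 2×2 determinant on
these two vectors times a common constant (`wick_contr_contr_eq`). For `μ_p`, `μ_q` the determinant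
is `σ_q - σ_p`, cancelled up to sign by the ghosts; for the coordinates of two rows of `Π` it gives
exactly the normalization of the corresponding reduced Pfaffian. Expanding each trace factor over
pairs `c < d` gives the comb form (`sum_combK_smul_vec₂`). -/

/-- Contraction of the exterior algebra with a dual vector. -/
abbrev contr : Module.Dual ℂ M →ₗ[ℂ] ExteriorAlgebra ℂ M →ₗ[ℂ] ExteriorAlgebra ℂ M :=
  CliffordAlgebra.contractLeft

/-- The inclusion of vectors. -/
abbrev vec (v : M) : ExteriorAlgebra ℂ M := ExteriorAlgebra.ι ℂ v

theorem contr_vec_mul (d : Module.Dual ℂ M) (v : M) (x : ExteriorAlgebra ℂ M) :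
    contr d (vec v * x) = d v • x - vec v * contr d x :=
  CliffordAlgebra.contractLeft_ι_mul ..

theorem contr_one (d : Module.Dual ℂ M) : contr d (1 : ExteriorAlgebra ℂ M) = 0 :=
  CliffordAlgebra.contractLeft_one ..

theorem contr_algebraMap (d : Module.Dual ℂ M) (r : ℂ) :
    contr d (algebraMap ℂ (ExteriorAlgebra ℂ M) r) = 0 :=
  CliffordAlgebra.contractLeft_algebraMap ..

theorem contr_vec (d : Module.Dual ℂ M) (v : M) :
    contr d (vec v) = algebraMap ℂ (ExteriorAlgebra ℂ M) (d v) :=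
  CliffordAlgebra.contractLeft_ι ..

theorem contr_comm (d d' : Module.Dual ℂ M) (x : ExteriorAlgebra ℂ M) :
    contr d (contr d' x) = -contr d' (contr d x) :=
  CliffordAlgebra.contractLeft_comm ..

@[elab_as_elim]
theorem exterior_induction {P : ExteriorAlgebra ℂ M → Prop}
    (algebraMap : ∀ r : ℂ, P (algebraMap ℂ _ r)) (add : ∀ x y, P x → P y → P (x + y))
    (vec_mul : ∀ x (m : M), P x → P (vec m * x)) (x : ExteriorAlgebra ℂ M) : P x :=
  CliffordAlgebra.left_induction _ algebraMap add vec_mul x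

theorem contr_map (f : M →ₗ[ℂ] N) (d : Module.Dual ℂ N) (x : ExteriorAlgebra ℂ M) :
    contr d (ExteriorAlgebra.map f x) = ExteriorAlgebra.map f (contr (d ∘ₗ f) x) := by
  induction x using exterior_induction with
  | algebraMap r => rw [AlgHom.commutes, contr_algebraMap, contr_algebraMap, map_zero]
  | add x y hx hy => simp only [map_add, hx, hy]
  | vec_mul x m hx =>
    rw [map_mul, ExteriorAlgebra.map_apply_ι, contr_vec_mul, contr_vec_mul, hx, map_sub, map_mul,
      map_smul, ExteriorAlgebra.map_apply_ι]
    rfl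

theorem vec_mul_vec_self (v : M) : vec v * vec v = 0 := ExteriorAlgebra.ι_sq_zero v

theorem vec_mul_vec_comm (v w : M) : vec v * vec w = -(vec w * vec v) :=
  eq_neg_of_add_eq_zero_left (ExteriorAlgebra.ι_add_mul_swap v w)

/-- An alternating form has zero quadratic form, so changing the Clifford form by it leads from the
exterior algebra back to itself. The sign matches the convention of `changeForm`, so that `wickExp`
contracts with `+B`. -/
theorem neg_toQuadraticMap_eq_zero {B : LinearMap.BilinForm ℂ M} (hB : B.IsAlt) :
    (-B).toQuadraticMap = (0 : QuadraticForm ℂ M) - 0 := by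
  ext v
  simp [hB v]

/-- `exp` of the contraction with the alternating form `B`. -/
def wickExp {B : LinearMap.BilinForm ℂ M} (hB : B.IsAlt) :
    ExteriorAlgebra ℂ M →ₗ[ℂ] ExteriorAlgebra ℂ M :=
  CliffordAlgebra.changeForm (neg_toQuadraticMap_eq_zero hB)

theorem wickExp_one {B : LinearMap.BilinForm ℂ M} (hB : B.IsAlt) : wickExp hB 1 = 1 :=
  CliffordAlgebra.changeForm_one _

theorem wickExp_vec_mul {B : LinearMap.BilinForm ℂ M} (hB : B.IsAlt) (v : M)
    (x : ExteriorAlgebra ℂ M) :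
    wickExp hB (vec v * x) = vec v * wickExp hB x + contr (B v) (wickExp hB x) := by
  refine (CliffordAlgebra.changeForm_ι_mul _ v x).trans ?_
  rw [LinearMap.neg_apply, map_neg, LinearMap.neg_apply, sub_neg_eq_add]
  rfl

theorem wickExp_contr {B : LinearMap.BilinForm ℂ M} (hB : B.IsAlt) (d : Module.Dual ℂ M)
    (x : ExteriorAlgebra ℂ M) : wickExp hB (contr d x) = contr d (wickExp hB x) :=
  CliffordAlgebra.changeForm_contractLeft _ d x

/-- The vacuum expectation value with propagator `B`. -/
def wick {B : LinearMap.BilinForm ℂ M} (hB : B.IsAlt) : ExteriorAlgebra ℂ M →ₗ[ℂ] ℂ :=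
  ExteriorAlgebra.algebraMapInv.toLinearMap ∘ₗ wickExp hB

theorem wick_one {B : LinearMap.BilinForm ℂ M} (hB : B.IsAlt) : wick hB 1 = 1 := by
  simp [wick, wickExp_one]

/-- Wick's recursion: if the first vector stays uncontracted there is no scalar part, so it must be
contracted with a later one. -/
theorem wick_vec_mul {B : LinearMap.BilinForm ℂ M} (hB : B.IsAlt) (v : M)
    (x : ExteriorAlgebra ℂ M) : wick hB (vec v * x) = wick hB (contr (B v) x) := by
  have h : ExteriorAlgebra.algebraMapInv (vec v) = (0 : ℂ) := by
    simp [ExteriorAlgebra.algebraMapInv]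
  simp [wick, wickExp_vec_mul, wickExp_contr, h]

/-- Contractions with different forms can be carried out one after the other. This later separates
the diagonal of `C` from the rest of the matrix. -/
theorem wickExp_add {B B' : LinearMap.BilinForm ℂ M} (hB : B.IsAlt) (hB' : B'.IsAlt)
    (h : (B + B').IsAlt) (x : ExteriorAlgebra ℂ M) :
    wickExp h x = wickExp hB (wickExp hB' x) := by
  induction x using exterior_induction with
  | algebraMap r =>
    simp only [Algebra.algebraMap_eq_smul_one, map_smul, wickExp_one]
  | add x y hx hy => simp only [map_add, hx, hy]
  | vec_mul x m hx =>
    rw [wickExp_vec_mul, wickExp_vec_mul, map_add, wickExp_vec_mul, wickExp_contr, hx,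
      LinearMap.add_apply, map_add, LinearMap.add_apply, add_assoc]

theorem wick_add {B B' : LinearMap.BilinForm ℂ M} (hB : B.IsAlt) (hB' : B'.IsAlt)
    (h : (B + B').IsAlt) (x : ExteriorAlgebra ℂ M) : wick h x = wick hB (wickExp hB' x) := by
  simp [wick, wickExp_add hB hB' h]

/-- The antiderivation rule has the same alternating signs as the expansion of a Pfaffian along its
first row. -/
theorem contr_list_prod (d : Module.Dual ℂ M) (u : R → M) (L : List R) :
    contr d (L.map fun x => vec (u x)).prod =
      ∑ p : Fin L.length, ((-1) ^ (p : ℕ) * d (u L[p])) •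
        ((L.eraseIdx p).map fun x => vec (u x)).prod := by
  induction L with
  | nil => simp
  | cons x L ih =>
    rw [List.map_cons, List.prod_cons, contr_vec_mul, ih]
    simp only [List.length_cons]
    rw [Fin.sum_univ_succ, sub_eq_add_neg]
    congr 1
    · simp
    · rw [Finset.mul_sum, ← Finset.sum_neg_distrib]
      refine Finset.sum_congr rfl fun p _ => ?_
      simp [pow_succ]

/-- Both sides satisfy the first-row recursion. Agreement of array and form is required only on the
rows in the list, since the matrices used below agree with a bilinear form only on physical rows. -/
theorem pfaffian_eq_wick {B : LinearMap.BilinForm ℂ M} (hB : B.IsAlt) (u : R → M)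
    (K : R → R → ℂ) (L : List R) (hL : ∀ x ∈ L, ∀ y ∈ L, K x y = B (u x) (u y)) :
    pfaffian K L = wick hB (L.map fun x => vec (u x)).prod := by
  induction h : L.length using Nat.strong_induction_on generalizing L with
  | _ k ih =>
    cases L with
    | nil => simp [pfaffian, wick_one]
    | cons x L =>
      rw [pfaffian, List.map_cons, List.prod_cons, wick_vec_mul, contr_list_prod, map_sum]
      refine Finset.sum_congr rfl fun p _ => ?_
      rw [map_smul, smul_eq_mul, hL x (by simp) _ (by simp),
        ih (L.eraseIdx p).length (by rw [← h]; simp [List.length_eraseIdx]) _ _ rfl]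
      intro y hy z hz
      exact hL _ (List.mem_cons_of_mem _ (List.mem_of_mem_eraseIdx hy)) _
        (List.mem_cons_of_mem _ (List.mem_of_mem_eraseIdx hz))

/-- A linear functional that obeys Wick's theorem is the vacuum expectation value. -/
theorem eq_wick {B : LinearMap.BilinForm ℂ M} (hB : B.IsAlt) (φ : ExteriorAlgebra ℂ M →ₗ[ℂ] ℂ)
    (h1 : φ 1 = 1) (h : ∀ v x, φ (vec v * x) = φ (contr (B v) x)) (x : ExteriorAlgebra ℂ M) :
    φ x = wick hB x := by
  have key : ∀ L : List M, φ (L.map fun x => vec x).prod = wick hB (L.map fun x => vec x).prod := by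
    intro L
    induction hk : L.length using Nat.strong_induction_on generalizing L with
    | _ k ih =>
      cases L with
      | nil => simp [h1, wick_one]
      | cons x L =>
        rw [List.map_cons, List.prod_cons, wick_vec_mul, h, contr_list_prod _ (fun x => x), map_sum,
          map_sum]
        refine Finset.sum_congr rfl fun p _ => ?_
        rw [map_smul, map_smul,
          ih (L.eraseIdx p).length (by rw [← hk]; simp [List.length_eraseIdx]) _ rfl]
  -- Products of vectors span the algebra, so it suffices to compare the functionals on them.
  have h2 : ∀ (L : List M) (y : ExteriorAlgebra ℂ M),
      y ∈ Submodule.span ℂ (Set.range fun L : List M => (L.map fun x => vec x).prod) := by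
    intro _ y
    induction y using exterior_induction with
    | algebraMap r =>
      rw [Algebra.algebraMap_eq_smul_one]
      exact Submodule.smul_mem _ _ (Submodule.subset_span ⟨[], by simp⟩)
    | add x y hx hy => exact Submodule.add_mem _ hx hy
    | vec_mul x m hx =>
      induction hx using Submodule.span_induction with
      | mem x hx =>
        obtain ⟨L, rfl⟩ := hx
        exact Submodule.subset_span ⟨m :: L, by simp⟩
      | zero => simp
      | add x y _ _ hx hy => rw [mul_add]; exact Submodule.add_mem _ hx hy
      | smul a x _ hx => rw [mul_smul_comm]; exact Submodule.smul_mem _ _ hx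
  have h3 := h2 [] x
  induction h3 using Submodule.span_induction with
  | mem x hx => obtain ⟨L, rfl⟩ := hx; exact key L
  | zero => simp
  | add x y _ _ hx hy => rw [map_add, map_add, hx, hy]
  | smul a x _ hx => rw [map_smul, map_smul, hx]

end Wick

/-! ### Even elements -/

section Even

variable {M : Type*} [AddCommGroup M] [Module ℂ M]

variable (M) in
/-- The central elements on which contractions act by the Leibniz rule without a sign. -/
def evenSubalgebra : Subalgebra ℂ (ExteriorAlgebra ℂ M) where
  carrier := {a | (∀ x, a * x = x * a) ∧ ∀ d x, contr d (a * x) = contr d a * x + a * contr d x}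
  mul_mem' := by
    rintro a b ⟨ha, ha'⟩ ⟨hb, hb'⟩
    refine ⟨fun x => by rw [mul_assoc, hb, ← mul_assoc, ha, mul_assoc], fun d x => ?_⟩
    rw [mul_assoc, ha', hb', ha', add_mul, mul_add]
    noncomm_ring
  one_mem' := ⟨fun x => by simp, fun d x => by simp⟩
  add_mem' := by
    rintro a b ⟨ha, ha'⟩ ⟨hb, hb'⟩
    refine ⟨fun x => by rw [add_mul, mul_add, ha, hb], fun d x => ?_⟩
    rw [add_mul, map_add, ha', hb', map_add]
    noncomm_ring
  zero_mem' := ⟨fun x => by simp, fun d x => by simp⟩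
  algebraMap_mem' r := ⟨fun x => Algebra.commutes r x, fun d x => by
    rw [contr_algebraMap, zero_mul, zero_add, ← Algebra.smul_def, map_smul, Algebra.smul_def]⟩

variable (M) in
/-- The commutative algebra of even elements. -/
def evenPart : Type _ := evenSubalgebra M

variable (M) in
/-- The commutative ring structure of `evenPart M`. -/
def evenCommRing : CommRing (evenPart M) :=
  { (evenSubalgebra M).toRing with
    mul_comm := fun a b => Subtype.ext (a.2.1 b.1) }

instance : CommRing (evenPart M) := evenCommRing M

variable (M) in
/-- The algebra structure of `evenPart M`. -/
def evenAlgebra : Algebra ℂ (evenPart M) := (evenSubalgebra M).algebra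

instance : Algebra ℂ (evenPart M) := evenAlgebra M

/-- The inclusion of the even elements. -/
def evenVal : evenPart M →ₐ[ℂ] ExteriorAlgebra ℂ M := (evenSubalgebra M).val

instance : CoeOut (evenPart M) (ExteriorAlgebra ℂ M) := ⟨evenVal⟩

theorem even_ext {a b : evenPart M} (h : evenVal a = evenVal b) : a = b := Subtype.ext h

theorem contr_even_mul (d : Module.Dual ℂ M) (a : evenPart M) (x : ExteriorAlgebra ℂ M) :
    contr d (a * x) = contr d a * x + a * contr d x := a.2.2 d x

theorem even_comm (a : evenPart M) (x : ExteriorAlgebra ℂ M) : a * x = x * a := a.2.1 x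

/-- Moving a vector past a pair costs two signs, which cancel. All operators needed are built from
scalars and such pairs, so their products can be taken over finsets without an order. -/
theorem vec_mul_vec_mem (v w : M) : vec v * vec w ∈ evenSubalgebra M := by
  have hc : ∀ x, vec v * vec w * x = x * (vec v * vec w) := by
    intro x
    induction x using exterior_induction with
    | algebraMap r => exact (Algebra.commutes r _).symm
    | add x y hx hy => rw [mul_add, add_mul, hx, hy]
    | vec_mul x m hx =>
      rw [mul_assoc (vec m), ← hx]
      simp only [← mul_assoc]
      rw [mul_assoc (vec v), vec_mul_vec_comm w m, mul_neg, ← mul_assoc, vec_mul_vec_comm v m]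
      simp
  refine ⟨hc, fun d x => ?_⟩
  rw [mul_assoc, contr_vec_mul, contr_vec_mul, contr_vec_mul, contr_vec,
    ← Algebra.commutes, ← Algebra.smul_def]
  simp only [mul_sub, sub_mul, smul_mul_assoc, mul_smul_comm, mul_assoc]
  abel

/-- The product of two vectors as an even element. -/
def vec₂ (v w : M) : evenPart M := ⟨vec v * vec w, vec_mul_vec_mem v w⟩

@[simp] theorem coe_vec₂ (v w : M) : (vec₂ v w : ExteriorAlgebra ℂ M) = vec v * vec w := rfl

end Even

end EYM
end

noncomputable section
namespace EYM

/-! ### Sums of chains of brackets -/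

theorem list_sum_finset_comm {α β A : Type*} [AddCommMonoid A] (L : List α) (s : Finset β)
    (f : α → β → A) :
    (L.map fun l => ∑ r ∈ s, f l r).sum = ∑ r ∈ s, (L.map fun l => f l r).sum := by
  induction L with
  | nil => simp
  | cons a L ih => simp [ih, Finset.sum_add_distrib]

section Chain

variable {𝔤 : Type*} [LieRing 𝔤] {n : ℕ}

/-- The colours `t` after the action of `x` on the one at `r`. -/
def adAt (t : Fin n → 𝔤) (x : 𝔤) (r : Fin n) : Fin n → 𝔤 := Function.update t r ⁅x, t r⁆

theorem adAt_self (t : Fin n → 𝔤) (x : 𝔤) (r : Fin n) : adAt t x r r = ⁅x, t r⁆ := by simp [adAt]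

theorem adAt_of_ne (t : Fin n → 𝔤) (x : 𝔤) {r j : Fin n} (h : j ≠ r) : adAt t x r j = t j := by
  simp [adAt, h]

variable [LieAlgebra ℂ 𝔤]

/-- `[t_{c_1}, [ … , [t_{c_r}, t_d] … ]] / (σ_{a c_1} σ_{c_1 c_2} ⋯ σ_{c_r d})`. -/
def chain (σ : Fin n → ℂ) (t : Fin n → 𝔤) (d : Fin n) : Fin n → List (Fin n) → 𝔤
  | a, [] => (σ a - σ d)⁻¹ • t d
  | a, c :: l => (σ a - σ c)⁻¹ • ⁅t c, chain σ t d c l⁆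

theorem chain_congr (σ : Fin n → ℂ) {t t' : Fin n → 𝔤} {d : Fin n} {l : List (Fin n)}
    (h : ∀ c ∈ d :: l, t c = t' c) (a : Fin n) : chain σ t d a l = chain σ t' d a l := by
  induction l generalizing a with
  | nil => simp only [chain, h d (by simp)]
  | cons c l ih =>
    simp only [chain]
    rw [h c (by simp), ih (fun x hx => h x (by simp at hx ⊢; tauto))]

/-- Inserting `i` just before `c` produces `[t_i, [t_c, X]]`, which Jacobi splits into an action on
`t_c` and one on `X`. By partial fractions the contributions of neighbouring slots telescope: what
remains is a simple pole at each label with the adjoint action on its colour, and a boundary term at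
`a`. -/
theorem chain_insert (σ : Fin n → ℂ) (hσ : Function.Injective σ) (t : Fin n → 𝔤) {a d i : Fin n}
    {l : List (Fin n)} (hl : (a :: d :: l).Nodup) (hi : i ∉ a :: d :: l) :
    ((List.permutations'Aux i l).map (chain σ t d a)).sum =
      -((σ i - σ a)⁻¹ • ⁅t i, chain σ t d a l⁆) +
        ∑ r ∈ (d :: l).toFinset, (σ i - σ r)⁻¹ • chain σ (adAt t (t i) r) d a l := by
  induction l generalizing a with
  | nil =>
    have h1 : σ i - σ a ≠ 0 := sub_ne_zero.2 fun h => hi (by simp [hσ h])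
    have h2 : σ i - σ d ≠ 0 := sub_ne_zero.2 fun h => hi (by simp [hσ h])
    have h3 : σ a - σ d ≠ 0 := sub_ne_zero.2 fun h => by simp [hσ h] at hl
    have h4 : σ a - σ i ≠ 0 := by rwa [← neg_sub, neg_ne_zero]
    simp only [List.permutations'Aux, List.map_cons, List.map_nil, List.sum_cons, List.sum_nil,
      chain, List.toFinset_cons, List.toFinset_nil, insert_empty_eq, Finset.sum_singleton,
      adAt_self, lie_smul]
    match_scalars
    field_simp
    ring
  | cons c l ih =>
    have hc : c ∉ d :: l := by
      simp only [List.nodup_cons, List.mem_cons, not_or] at hl ⊢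
      exact ⟨fun h => hl.2.1.1 h.symm, hl.2.2.1⟩
    have h1 : σ i - σ a ≠ 0 := sub_ne_zero.2 fun h => hi (by simp [hσ h])
    have h2 : σ i - σ c ≠ 0 := sub_ne_zero.2 fun h => hi (by simp [hσ h])
    have h3 : σ a - σ c ≠ 0 := sub_ne_zero.2 fun h => by simp [hσ h] at hl
    have h4 : σ a - σ i ≠ 0 := by rwa [← neg_sub, neg_ne_zero]
    have hl' : (c :: d :: l).Nodup := by
      simp only [List.nodup_cons, List.mem_cons, not_or] at hl hc ⊢
      tauto
    have hi' : i ∉ c :: d :: l := by simp at hi ⊢; tauto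
    have hs : (d :: c :: l).toFinset = insert c (d :: l).toFinset := by
      ext; simp; tauto
    have e1 : ((List.permutations'Aux i l).map (chain σ t d a ∘ (c :: ·))).sum =
        (σ a - σ c)⁻¹ • ⁅t c, ((List.permutations'Aux i l).map (chain σ t d c)).sum⁆ := by
      generalize List.permutations'Aux i l = L
      induction L with
      | nil => simp
      | cons x L ih => simp only [List.map_cons, List.sum_cons, ih, Function.comp, chain, lie_add,
          smul_add]
    have e2 : ∀ r ∈ (d :: l).toFinset, (σ i - σ r)⁻¹ • chain σ (adAt t (t i) r) d a (c :: l) =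
        (σ a - σ c)⁻¹ • ⁅t c, (σ i - σ r)⁻¹ • chain σ (adAt t (t i) r) d c l⁆ := by
      intro r hr
      have : c ≠ r := by rintro rfl; exact hc (by simpa using hr)
      simp only [chain, adAt_of_ne t (t i) this, lie_smul]
      rw [smul_comm]
    rw [hs, Finset.sum_insert (by simpa using hc), Finset.sum_congr rfl e2]
    rw [← Finset.smul_sum, ← lie_sum]
    simp only [List.permutations'Aux, List.map_cons, List.sum_cons, List.map_map]
    rw [e1, ih hl' hi']
    have e3 : chain σ (adAt t (t i) c) d c l = chain σ t d c l :=
      chain_congr σ (fun x hx => adAt_of_ne t _ (by rintro rfl; exact hc hx)) c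
    -- `lie_lie` is the Jacobi identity; comparing coefficients leaves the partial fraction identity
    -- for the differences of `σ_a`, `σ_c`, `σ_i`.
    simp only [chain, adAt_self, e3, lie_smul, lie_add, lie_neg, smul_add, lie_lie]
    match_scalars <;> field_simp
    all_goals ring

/-- The sum over all orderings `c` of `u` of
`κ(t_a, [t_{c_1}, [ … , [t_{c_r}, t_d] … ]]) / (σ_{a c_1} σ_{c_1 c_2} ⋯ σ_{c_r d})`. -/
def chainSum (κ : LinearMap.BilinForm ℂ 𝔤) (σ : Fin n → ℂ) (t : Fin n → 𝔤) (a d : Fin n)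
    (u : List (Fin n)) : ℂ :=
  (u.permutations'.map fun l => κ (t a) (chain σ t d a l)).sum

theorem chainSum_perm (κ : LinearMap.BilinForm ℂ 𝔤) (σ : Fin n → ℂ) (t : Fin n → 𝔤) (a d : Fin n)
    {u u' : List (Fin n)} (h : u.Perm u') : chainSum κ σ t a d u = chainSum κ σ t a d u' :=
  (h.permutations'.map _).sum_eq

/-- Invariance of `κ` turns the boundary term of `chain_insert` into the action on `t_a`. The
recursion then treats all labels alike, including the endpoints, which makes the symmetry statements
below inductions from two or three labels. -/
theorem chainSum_cons (κ : LinearMap.BilinForm ℂ 𝔤) (hκ : ∀ x y z, κ ⁅x, y⁆ z = κ x ⁅y, z⁆)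
    (σ : Fin n → ℂ) (hσ : Function.Injective σ) (t : Fin n → 𝔤) {a d i : Fin n}
    {u : List (Fin n)} (hu : (a :: d :: u).Nodup) (hi : i ∉ a :: d :: u) :
    chainSum κ σ t a d (i :: u) = ∑ r ∈ (a :: d :: u).toFinset,
      (σ i - σ r)⁻¹ * chainSum κ σ (adAt t (t i) r) a d u := by
  have ha : a ∉ d :: u := (List.nodup_cons.1 hu).1
  have e : ∀ l ∈ u.permutations',
      ((List.permutations'Aux i l).map fun l => κ (t a) (chain σ t d a l)).sum =
        ∑ r ∈ (a :: d :: u).toFinset, (σ i - σ r)⁻¹ *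
          κ (adAt t (t i) r a) (chain σ (adAt t (t i) r) d a l) := by
    intro l hl
    have hp : l.Perm u := List.mem_permutations'.1 hl
    have hp' : (a :: d :: l).Perm (a :: d :: u) := (hp.cons d).cons a
    have hs : (d :: l).toFinset = (d :: u).toFinset := List.toFinset_eq_of_perm _ _ (hp.cons d)
    have := congrArg (κ (t a)) (chain_insert σ hσ t (hp'.nodup_iff.2 hu)
      (fun h => hi (hp'.mem_iff.1 h)))
    rw [map_list_sum, List.map_map] at this
    refine this.trans ?_
    rw [hs, List.toFinset_cons (a := a), Finset.sum_insert (by simpa using ha), map_add, map_sum]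
    congr 1
    · rw [adAt_self, chain_congr σ (t := adAt t (t i) a) (t' := t) (fun x hx => adAt_of_ne t _ (by
        rintro rfl; exact ha ((hp.cons d).mem_iff.1 hx))), ← lie_skew (t i) (t a),
        map_neg κ, LinearMap.neg_apply, hκ]
      simp
    · refine Finset.sum_congr rfl fun r hr => ?_
      rw [adAt_of_ne t _ (by rintro rfl; exact ha (by simpa using hr)), map_smul, smul_eq_mul]
  rw [chainSum, List.permutations', List.map_flatMap, List.flatMap_def, List.sum_flatten,
    List.map_map]
  simp only [Function.comp_def]
  rw [List.map_congr_left e, list_sum_finset_comm]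
  refine Finset.sum_congr rfl fun r _ => ?_
  rw [List.sum_map_mul_left]
  rfl

/-- The recursion does not distinguish the endpoints, so only two labels need checking; there `κ` is
symmetric and `σ_a - σ_d` antisymmetric. -/
theorem chainSum_swap (κ : LinearMap.BilinForm ℂ 𝔤) (hκ : ∀ x y z, κ ⁅x, y⁆ z = κ x ⁅y, z⁆)
    (hs : ∀ x y, κ x y = κ y x)
    (σ : Fin n → ℂ) (hσ : Function.Injective σ) (t : Fin n → 𝔤) {a d : Fin n}
    {u : List (Fin n)} (hu : (a :: d :: u).Nodup) :
    chainSum κ σ t a d u = -chainSum κ σ t d a u := by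
  induction u generalizing t with
  | nil =>
    have : σ a - σ d ≠ 0 := sub_ne_zero.2 fun h => by simp [hσ h] at hu
    rw [← neg_sub, neg_ne_zero] at this
    simp only [chainSum, List.permutations', List.map_cons, List.map_nil, List.sum_cons,
      List.sum_nil, chain, map_smul, hs (t d), smul_eq_mul, LinearMap.smul_apply]
    rw [← neg_sub (σ d) (σ a), inv_neg]
    ring
  | cons i u ih =>
    have h0 : (i :: a :: d :: u).Nodup :=
      ((List.Perm.swap i d u).cons a |>.trans (List.Perm.swap i a _)).nodup_iff.1 hu
    have hsw : (a :: d :: u).Perm (d :: a :: u) := List.Perm.swap d a u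
    rw [chainSum_cons κ hκ σ hσ t (List.nodup_cons.1 h0).2 (List.nodup_cons.1 h0).1,
      chainSum_cons κ hκ σ hσ t (hsw.nodup_iff.1 (List.nodup_cons.1 h0).2)
        (fun h => (List.nodup_cons.1 h0).1 (hsw.mem_iff.2 h)),
      List.toFinset_eq_of_perm _ _ hsw, ← Finset.sum_neg_distrib]
    refine Finset.sum_congr rfl fun r _ => ?_
    rw [ih _ (List.nodup_cons.1 h0).2, mul_neg]

/-- The same induction, starting from three labels, where the claim is the antisymmetry of one
bracket. -/
theorem chainSum_move (κ : LinearMap.BilinForm ℂ 𝔤) (hκ : ∀ x y z, κ ⁅x, y⁆ z = κ x ⁅y, z⁆)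
    (σ : Fin n → ℂ) (hσ : Function.Injective σ) (t : Fin n → 𝔤) {a d e : Fin n}
    {u : List (Fin n)} (hu : (a :: d :: e :: u).Nodup) :
    (σ e - σ a) * chainSum κ σ t a d (e :: u) = (σ d - σ a) * chainSum κ σ t a e (d :: u) := by
  induction u generalizing t with
  | nil =>
    simp only [List.nodup_cons, List.mem_cons, not_or] at hu
    have h1 : σ a - σ d ≠ 0 := sub_ne_zero.2 (hσ.ne hu.1.1)
    have h2 : σ a - σ e ≠ 0 := sub_ne_zero.2 (hσ.ne hu.1.2.1)
    have h3 : σ d - σ e ≠ 0 := sub_ne_zero.2 (hσ.ne hu.2.1.1)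
    have h4 : σ e - σ d ≠ 0 := by rwa [← neg_sub, neg_ne_zero]
    simp only [chainSum, List.permutations', List.permutations'Aux, List.flatMap_cons,
      List.flatMap_nil, List.append_nil, List.map_cons, List.map_nil, List.sum_cons,
      List.sum_nil, chain, map_smul, smul_eq_mul, lie_smul]
    rw [← lie_skew (t d) (t e), map_neg]
    field_simp
    ring
  | cons i u ih =>
    have hp : (a :: d :: e :: i :: u).Perm (i :: a :: d :: e :: u) :=
      ((((List.Perm.swap i e u).cons d).trans (List.Perm.swap i d _)).cons a).trans
        (List.Perm.swap i a _)
    have h0 := hp.nodup_iff.1 hu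
    have hsw : (a :: d :: e :: u).Perm (a :: e :: d :: u) := (List.Perm.swap e d u).cons a
    rw [chainSum_perm κ σ t a d (List.Perm.swap i e u), chainSum_perm κ σ t a e (List.Perm.swap i d u),
      chainSum_cons κ hκ σ hσ t (List.nodup_cons.1 h0).2 (List.nodup_cons.1 h0).1,
      chainSum_cons κ hκ σ hσ t (hsw.nodup_iff.1 (List.nodup_cons.1 h0).2)
        (fun h => (List.nodup_cons.1 h0).1 (hsw.mem_iff.2 h)),
      List.toFinset_eq_of_perm _ _ hsw, Finset.mul_sum, Finset.mul_sum]
    refine Finset.sum_congr rfl fun r _ => ?_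
    rw [mul_left_comm, ih _ (List.nodup_cons.1 h0).2, mul_left_comm]

/-- The adjoint action is a derivation of nested brackets. -/
theorem chain_invariant (σ : Fin n → ℂ) (t : Fin n → 𝔤) (x : 𝔤) {d : Fin n} {l : List (Fin n)}
    (hl : (d :: l).Nodup) (a : Fin n) :
    ∑ r ∈ (d :: l).toFinset, chain σ (adAt t x r) d a l = ⁅x, chain σ t d a l⁆ := by
  induction l generalizing a with
  | nil => simp [chain, adAt_self]
  | cons c l ih =>
    have hl' : (c :: d :: l).Nodup := (List.Perm.swap c d l).nodup_iff.1 hl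
    have hc := (List.nodup_cons.1 hl').1
    have hs : (d :: c :: l).toFinset = insert c (d :: l).toFinset := by
      ext; simp; tauto
    have e2 : ∀ r ∈ (d :: l).toFinset, chain σ (adAt t x r) d a (c :: l) =
        (σ a - σ c)⁻¹ • ⁅t c, chain σ (adAt t x r) d c l⁆ := by
      intro r hr
      have : c ≠ r := by rintro rfl; exact hc (by simpa using hr)
      simp only [chain, adAt_of_ne t x this]
    rw [hs, Finset.sum_insert (by simpa using hc), Finset.sum_congr rfl e2, ← Finset.smul_sum,
      ← lie_sum, ih (List.nodup_cons.1 hl').2]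
    have e3 : chain σ (adAt t x c) d c l = chain σ t d c l :=
      chain_congr σ (fun y hy => adAt_of_ne t _ (by rintro rfl; exact hc hy)) c
    simp only [chain, adAt_self, e3, lie_smul, lie_lie, ← smul_add, sub_add_cancel]

/-- Global colour invariance: the Leibniz rule on the nested bracket together with the invariance of
`κ`. -/
theorem chainSum_invariant (κ : LinearMap.BilinForm ℂ 𝔤)
    (hκ : ∀ x y z, κ ⁅x, y⁆ z = κ x ⁅y, z⁆)
    (σ : Fin n → ℂ) (t : Fin n → 𝔤) (x : 𝔤) {a d : Fin n}
    {u : List (Fin n)} (hu : (a :: d :: u).Nodup) :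
    ∑ r ∈ (a :: d :: u).toFinset, chainSum κ σ (adAt t x r) a d u = 0 := by
  have ha : a ∉ d :: u := (List.nodup_cons.1 hu).1
  simp only [chainSum]
  rw [← list_sum_finset_comm]
  refine List.sum_eq_zero fun z hz => ?_
  obtain ⟨l, hl, rfl⟩ := List.mem_map.1 hz
  have hp : l.Perm u := List.mem_permutations'.1 hl
  have hs : (d :: l).toFinset = (d :: u).toFinset := List.toFinset_eq_of_perm _ _ (hp.cons d)
  rw [List.toFinset_cons, Finset.sum_insert (by simpa using ha), adAt_self,
    chain_congr σ (t := adAt t x a) (t' := t) (fun y hy => adAt_of_ne t _ (by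
        rintro rfl; exact ha ((hp.cons d).mem_iff.1 hy))), ← hs]
  have : ∀ r ∈ (d :: l).toFinset, κ (adAt t x r a) (chain σ (adAt t x r) d a l) =
      κ (t a) (chain σ (adAt t x r) d a l) := by
    intro r hr
    rw [adAt_of_ne t _ (by rintro rfl; rw [hs] at hr; exact ha (by simpa using hr))]
  rw [Finset.sum_congr rfl this, ← map_sum,
    chain_invariant σ t x ((hp.cons d).nodup_iff.2 (List.nodup_cons.1 hu).2), ← lie_skew, map_neg,
    LinearMap.neg_apply, hκ]
  simp

end Chain
end EYM
end

noncomputable section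
namespace EYM

/-! ### Comb structures -/

section Comb

variable {V 𝔤 : Type*} [LieRing 𝔤] [LieAlgebra ℂ 𝔤] {n : ℕ}

theorem chainSum_move_of_perm (κ : LinearMap.BilinForm ℂ 𝔤) (hκ : ∀ x y z, κ ⁅x, y⁆ z = κ x ⁅y, z⁆)
    (σ : Fin n → ℂ) (hσ : Function.Injective σ) (t : Fin n → 𝔤) {a d e : Fin n}
    {u u' : List (Fin n)} (hu : (a :: d :: u).Nodup) (h : (a :: d :: u).Perm (a :: e :: u')) :
    (σ e - σ a) * chainSum κ σ t a d u = (σ d - σ a) * chainSum κ σ t a e u' := by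
  have h1 : (d :: u).Perm (e :: u') := h.cons_inv
  by_cases hde : d = e
  · subst hde
    rw [chainSum_perm κ σ t a d h1.cons_inv]
  · have he : e ∈ u := by
      have := h1.mem_iff.2 (List.mem_cons_self)
      simpa [Ne.symm hde] using this
    have h2 : u.Perm (e :: u.erase e) := List.perm_cons_erase he
    have h3 : u'.Perm (d :: u.erase e) := by
      have : (e :: u').Perm (e :: d :: u.erase e) :=
        h1.symm.trans ((h2.cons d).trans (List.Perm.swap e d _))
      exact this.cons_inv
    rw [chainSum_perm κ σ t a d h2, chainSum_perm κ σ t a e h3]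
    exact chainSum_move κ hκ σ hσ t (((h2.cons d).cons a).nodup_iff.1 hu)

/-- The quotient of the chain sum by `σ_d - σ_a` does not depend on the endpoints. If `a ≠ a'`, pass
through `(a, d)`, `(a, a')`, `(a', a)`, `(a', d')`: move the last endpoint, swap, move again. -/
theorem chainSum_endpoints (κ : LinearMap.BilinForm ℂ 𝔤) (hκ : ∀ x y z, κ ⁅x, y⁆ z = κ x ⁅y, z⁆)
    (hs : ∀ x y, κ x y = κ y x) (σ : Fin n → ℂ) (hσ : Function.Injective σ) (t : Fin n → 𝔤)
    {a d a' d' : Fin n} {u u' : List (Fin n)} (hu : (a :: d :: u).Nodup)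
    (h : (a :: d :: u).Perm (a' :: d' :: u')) :
    (σ d' - σ a') * chainSum κ σ t a d u = (σ d - σ a) * chainSum κ σ t a' d' u' := by
  by_cases haa : a = a'
  · subst haa
    exact chainSum_move_of_perm κ hκ σ hσ t hu h
  · have ha' : a' ∈ d :: u := by
      have := h.mem_iff.2 (List.mem_cons_self)
      simpa [Ne.symm haa] using this
    have h2 : (a :: d :: u).Perm (a :: a' :: (d :: u).erase a') :=
      (List.perm_cons_erase ha').cons a
    have h3 := h2.trans (List.Perm.swap a' a _)
    have e1 := chainSum_move_of_perm κ hκ σ hσ t hu h2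
    have e2 := chainSum_swap κ hκ hs σ hσ t (h2.nodup_iff.1 hu)
    have e3 := chainSum_move_of_perm κ hκ σ hσ t (h3.nodup_iff.1 hu) (h3.symm.trans h)
    have h0 : σ a' - σ a ≠ 0 := sub_ne_zero.2 (hσ.ne (Ne.symm haa))
    apply mul_left_cancel₀ h0
    rw [e2] at e1
    linear_combination (σ d' - σ a') * e1 - (σ d - σ a) * e3

theorem combTerm_eq (κ : LinearMap.BilinForm ℂ 𝔤) (D : ExternalData V 𝔤 n) (a b : Fin n)
    (c : List (Fin n)) :
    combTerm κ D a b c = κ (D.col a) (chain D.pos D.col b a c) / (D.pos b - D.pos a) := by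
  -- The closing label `z` is kept separate from the start `a`, because the start changes along the
  -- induction while the cyclic product still closes at the original label.
  have key : ∀ a z, (List.zipWith D.diff (a :: (c ++ [b])) (c ++ [b] ++ [z])).prod⁻¹ •
      c.foldr (fun i x => ⁅D.col i, x⁆) (D.col b) =
        (D.pos b - D.pos z)⁻¹ • chain D.pos D.col b a c := by
    intro a z
    induction c generalizing a with
    | nil => simp [chain, ExternalData.diff, smul_smul]
    | cons c l ih =>
      have := ih c
      simp only [List.cons_append, List.zipWith_cons_cons, List.prod_cons, chain, List.foldr_cons,
        mul_inv, mul_smul] at this ⊢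
      rw [← lie_smul, this, lie_smul, smul_comm]
      rfl
  have h := congrArg (κ (D.col a)) (key a a)
  simp only [map_smul, smul_eq_mul] at h
  simp only [combTerm, List.cons_append, List.rotate_cons_succ, List.rotate_zero]
  rw [div_eq_inv_mul, div_eq_inv_mul, h]

/-- The definition uses the smallest and largest labels as endpoints; independence of the endpoints
allows any two. -/
theorem comb_eq (κ : LinearMap.BilinForm ℂ 𝔤) (hκ : ∀ x y z, κ ⁅x, y⁆ z = κ x ⁅y, z⁆)
    (hs : ∀ x y, κ x y = κ y x) (D : ExternalData V 𝔤 n) (hσ : Function.Injective D.pos)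
    {a d : Fin n} {u : List (Fin n)} (hu : (a :: d :: u).Nodup) :
    (D.pos d - D.pos a) * comb κ D (a :: d :: u).toFinset = chainSum κ D.pos D.col a d u := by
  set T := (a :: d :: u).toFinset with hT
  have ha : a ∈ T := by simp [hT]
  have hd : d ∈ T := by simp [hT]
  have hne : T.Nonempty := ⟨a, ha⟩
  have had : a ≠ d := by rintro rfl; simp at hu
  have hlt : T.min' hne < T.max' hne := Finset.min'_lt_max' _ ha hd had
  set w := ((T.erase (T.min' hne)).erase (T.max' hne)).sort with hw
  have hmm : T.max' hne ∈ T.erase (T.min' hne) :=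
    Finset.mem_erase.2 ⟨hlt.ne', T.max'_mem hne⟩
  have hwn : (T.min' hne :: T.max' hne :: w).Nodup := by
    simp [hw, hlt.ne]
  have hp : (T.min' hne :: T.max' hne :: w).Perm (a :: d :: u) := by
    refine List.perm_of_nodup_nodup_toFinset_eq hwn hu ?_
    rw [← hT]
    simp [hw, Finset.insert_erase hmm, Finset.insert_erase (T.min'_mem hne)]
  have h0 : D.pos (T.max' hne) - D.pos (T.min' hne) ≠ 0 := sub_ne_zero.2 (hσ.ne hlt.ne')
  have hc : comb κ D T = chainSum κ D.pos D.col (T.min' hne) (T.max' hne) w /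
      (D.pos (T.max' hne) - D.pos (T.min' hne)) := by
    rw [comb, dif_pos hne, ((List.permutations_perm_permutations' _).map _).sum_eq, ← hw, chainSum]
    rw [List.map_congr_left fun l _ => combTerm_eq κ D _ _ l]
    simp only [div_eq_mul_inv]
    rw [List.sum_map_mul_right]
  rw [hc]
  field_simp
  linear_combination chainSum_endpoints κ hκ hs D.pos hσ D.col hwn hp

end Comb

section Comb

variable {V 𝔤 : Type*} {n : ℕ}

/-- The external data with other colours. -/
def ExternalData.recolor (D : ExternalData V 𝔤 n) (t : Fin n → 𝔤) : ExternalData V 𝔤 n :=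
  { D with col := t }

variable [LieRing 𝔤] [LieAlgebra ℂ 𝔤]

theorem exists_list_of_two_le_card {T : Finset (Fin n)} (hT : 2 ≤ T.card) :
    ∃ a d, ∃ u : List (Fin n), (a :: d :: u).Nodup ∧ (a :: d :: u).toFinset = T := by
  have h1 := T.toList_toFinset
  have h2 := T.nodup_toList
  have h3 := T.length_toList
  match h : T.toList with
  | [] => simp [h] at h3; omega
  | [a] => simp [h] at h3; omega
  | a :: d :: u => exact ⟨a, d, u, h ▸ h2, h ▸ h1⟩

/-- Two endpoints can be chosen inside `T`, so the factor `σ_d - σ_a` is the same on both sides and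
`chainSum_cons` passes to the comb. -/
theorem comb_insert (κ : LinearMap.BilinForm ℂ 𝔤) (hκ : ∀ x y z, κ ⁅x, y⁆ z = κ x ⁅y, z⁆)
    (hs : ∀ x y, κ x y = κ y x) (D : ExternalData V 𝔤 n) (hσ : Function.Injective D.pos)
    (t : Fin n → 𝔤) {T : Finset (Fin n)} (hT : 2 ≤ T.card) {i : Fin n} (hi : i ∉ T) :
    comb κ (D.recolor t) (insert i T) = ∑ r ∈ T, (D.pos i - D.pos r)⁻¹ *
      comb κ (D.recolor (adAt t (t i) r)) T := by
  obtain ⟨a, d, u, hu, rfl⟩ := exists_list_of_two_le_card hT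
  have hi' : i ∉ a :: d :: u := by simpa using hi
  have hp : (i :: a :: d :: u).Perm (a :: d :: i :: u) :=
    (List.Perm.swap a i _).trans ((List.Perm.swap d i u).cons a)
  have h0 : D.pos d - D.pos a ≠ 0 :=
    sub_ne_zero.2 (hσ.ne (by rintro rfl; simp at hu))
  apply mul_left_cancel₀ h0
  have e1 := comb_eq κ hκ hs (D.recolor t) hσ (hp.nodup_iff.1 (List.nodup_cons.2 ⟨hi', hu⟩))
  rw [← List.toFinset_eq_of_perm _ _ hp, List.toFinset_cons] at e1
  refine e1.trans ((chainSum_cons κ hκ _ hσ _ hu hi').trans ?_)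
  rw [Finset.mul_sum]
  refine Finset.sum_congr rfl fun r _ => ?_
  rw [mul_left_comm]
  exact congrArg _ (comb_eq κ hκ hs (D.recolor (adAt t (t i) r)) hσ hu).symm

theorem comb_pair (κ : LinearMap.BilinForm ℂ 𝔤) (hκ : ∀ x y z, κ ⁅x, y⁆ z = κ x ⁅y, z⁆)
    (hs : ∀ x y, κ x y = κ y x) (D : ExternalData V 𝔤 n) (hσ : Function.Injective D.pos)
    (t : Fin n → 𝔤) {i j : Fin n} (hij : i ≠ j) :
    (D.pos j - D.pos i) * comb κ (D.recolor t) {i, j} =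
      (D.pos i - D.pos j)⁻¹ * κ (t i) (t j) := by
  have h := comb_eq κ hκ hs (D.recolor t) hσ (a := i) (d := j) (u := []) (by simpa using hij)
  simpa [chainSum, chain, ExternalData.recolor] using h

theorem comb_invariant (κ : LinearMap.BilinForm ℂ 𝔤) (hκ : ∀ x y z, κ ⁅x, y⁆ z = κ x ⁅y, z⁆)
    (hs : ∀ x y, κ x y = κ y x) (D : ExternalData V 𝔤 n) (hσ : Function.Injective D.pos)
    (t : Fin n → 𝔤) (x : 𝔤) {T : Finset (Fin n)} (hT : 2 ≤ T.card) :
    ∑ r ∈ T, comb κ (D.recolor (adAt t x r)) T = 0 := by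
  obtain ⟨a, d, u, hu, rfl⟩ := exists_list_of_two_le_card hT
  have h0 : D.pos d - D.pos a ≠ 0 :=
    sub_ne_zero.2 (hσ.ne (by rintro rfl; simp at hu))
  apply mul_left_cancel₀ h0
  rw [Finset.mul_sum, mul_zero, ← chainSum_invariant κ hκ D.pos t x hu]
  exact Finset.sum_congr rfl fun r _ => comb_eq κ hκ hs (D.recolor (adAt t x r)) hσ hu

theorem comb_congr (κ : LinearMap.BilinForm ℂ 𝔤) (D : ExternalData V 𝔤 n) {t t' : Fin n → 𝔤}
    {T : Finset (Fin n)} (h : ∀ i ∈ T, t i = t' i) :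
    comb κ (D.recolor t) T = comb κ (D.recolor t') T := by
  by_cases hT : T.Nonempty
  · simp only [comb, dif_pos hT]
    congr 1
    refine List.map_congr_left fun l hl => ?_
    have hl' : ∀ c ∈ l, c ∈ T := by
      intro c hc
      have := (List.mem_permutations.1 hl).mem_iff.1 hc
      simp only [Finset.mem_sort, Finset.mem_erase] at this
      exact this.2.2
    rw [combTerm_eq, combTerm_eq]
    simp only [ExternalData.recolor]
    rw [h _ (T.min'_mem hT), chain_congr D.pos (t := t) (t' := t')]
    intro c hc
    rcases List.mem_cons.1 hc with rfl | hc
    · exact h _ (T.max'_mem hT)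
    · exact h _ (hl' c hc)
  · simp [comb, hT]

end Comb

/-! ### Traces as even elements -/

section Absorb

variable {M : Type*} [AddCommGroup M] {n : ℕ}

/-- The momenta after the gluon `i` has been absorbed by the one at `r`. -/
def absorb (μ : Fin n → M) (i r : Fin n) : Fin n → M := Function.update μ r (μ i + μ r)

theorem absorb_self (μ : Fin n → M) (i r : Fin n) : absorb μ i r r = μ i + μ r := by simp [absorb]

theorem absorb_of_ne (μ : Fin n → M) (i : Fin n) {r j : Fin n} (h : j ≠ r) :
    absorb μ i r j = μ j := by simp [absorb, h]

end Absorb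

section Trace

variable {V 𝔤 M : Type*} [LieRing 𝔤] [LieAlgebra ℂ 𝔤] {n : ℕ} [AddCommGroup M] [Module ℂ M]

/-- `∑_{c ∈ T} μ_c` -/
def rowSum (μ : Fin n → M) (T : Finset (Fin n)) : M := ∑ c ∈ T, μ c

/-- `∑_{c ∈ T} σ_c μ_c` -/
def weightedRowSum (σ : Fin n → ℂ) (μ : Fin n → M) (T : Finset (Fin n)) : M := ∑ c ∈ T, σ c • μ c

/-- `∑_{c ∈ T} μ_c ∧ ∑_{d ∈ T} σ_d μ_d` -/
def tracePair (σ : Fin n → ℂ) (μ : Fin n → M) (T : Finset (Fin n)) : evenPart M :=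
  vec₂ (rowSum μ T) (weightedRowSum σ μ T)

/-- `-𝒞(T) ∑_{c ∈ T} μ_c ∧ ∑_{d ∈ T} σ_d μ_d` -/
def traceTerm (κ : LinearMap.BilinForm ℂ 𝔤) (D : ExternalData V 𝔤 n) (t : Fin n → 𝔤)
    (μ : Fin n → M) (T : Finset (Fin n)) : evenPart M :=
  -comb κ (D.recolor t) T • tracePair D.pos μ T

theorem vec₂_add_left (v v' w : M) : vec₂ (v + v') w = vec₂ v w + vec₂ v' w :=
  even_ext (by simp [add_mul])

theorem vec₂_add_right (v w w' : M) : vec₂ v (w + w') = vec₂ v w + vec₂ v w' :=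
  even_ext (by simp [mul_add])

theorem vec₂_sub_right (v w w' : M) : vec₂ v (w - w') = vec₂ v w - vec₂ v w' :=
  even_ext (by simp [mul_sub])

theorem vec₂_smul_right (r : ℂ) (v w : M) : vec₂ v (r • w) = r • vec₂ v w :=
  even_ext (by simp)

theorem vec₂_self (v : M) : vec₂ v v = 0 := even_ext (by simp)

theorem vec₂_swap (v w : M) : vec₂ v w = -vec₂ w v := even_ext (vec_mul_vec_comm v w)

theorem traceTerm_congr (κ : LinearMap.BilinForm ℂ 𝔤) (D : ExternalData V 𝔤 n) {t t' : Fin n → 𝔤}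
    {μ μ' : Fin n → M} {T : Finset (Fin n)} (h : ∀ i ∈ T, t i = t' i) (h' : ∀ i ∈ T, μ i = μ' i) :
    traceTerm κ D t μ T = traceTerm κ D t' μ' T := by
  rw [traceTerm, traceTerm, comb_congr κ D h]
  simp only [tracePair, rowSum, weightedRowSum]
  rw [Finset.sum_congr rfl h', Finset.sum_congr rfl fun i hi => congrArg (D.pos i • ·) (h' i hi)]

/-- The two vectors are proportional. This removes the partitions with one-element blocks, whatever
value the comb takes there. -/
theorem traceTerm_singleton (κ : LinearMap.BilinForm ℂ 𝔤) (D : ExternalData V 𝔤 n) (t : Fin n → 𝔤)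
    (μ : Fin n → M) (i : Fin n) : traceTerm κ D t μ {i} = 0 := by
  simp [traceTerm, tracePair, rowSum, weightedRowSum, vec₂_smul_right, vec₂_self]

theorem traceTerm_pair (κ : LinearMap.BilinForm ℂ 𝔤) (hκ : ∀ x y z, κ ⁅x, y⁆ z = κ x ⁅y, z⁆)
    (hs : ∀ x y, κ x y = κ y x) (D : ExternalData V 𝔤 n) (hσ : Function.Injective D.pos)
    (t : Fin n → 𝔤) (μ : Fin n → M) {i j : Fin n} (hij : i ≠ j) :
    traceTerm κ D t μ {i, j} =
      -((D.pos i - D.pos j)⁻¹ * κ (t i) (t j)) • vec₂ (μ i) (μ j) := by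
  rw [← comb_pair κ hκ hs D hσ t hij]
  simp only [traceTerm, tracePair, rowSum, weightedRowSum, Finset.sum_pair hij, vec₂_add_left,
    vec₂_add_right, vec₂_smul_right, vec₂_self, vec₂_swap (μ j) (μ i)]
  module

/-- Absorbing `i` at `r` keeps the total momentum and lowers the weighted sum by `(σ_i - σ_r) μ_i`.
That shift cancels the pole, so the extra terms carry a factor `∑_r 𝒞(T)` with colours acted on at
`r`, which is zero by colour invariance; the rest is `comb_insert`. -/
theorem traceTerm_insert (κ : LinearMap.BilinForm ℂ 𝔤) (hκ : ∀ x y z, κ ⁅x, y⁆ z = κ x ⁅y, z⁆)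
    (hs : ∀ x y, κ x y = κ y x) (D : ExternalData V 𝔤 n) (hσ : Function.Injective D.pos)
    (t : Fin n → 𝔤) (μ : Fin n → M) {T : Finset (Fin n)} (hT : 2 ≤ T.card) {i : Fin n}
    (hi : i ∉ T) :
    traceTerm κ D t μ (insert i T) = ∑ r ∈ T, (D.pos i - D.pos r)⁻¹ •
      traceTerm κ D (adAt t (t i) r) (absorb μ i r) T := by
  have h1 : ∀ r ∈ T, rowSum (absorb μ i r) T = rowSum μ (insert i T) := by
    intro r hr
    rw [rowSum, rowSum, Finset.sum_insert hi, ← Finset.add_sum_erase T _ hr,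
      ← Finset.add_sum_erase T μ hr, absorb_self, add_assoc]
    congr 2
    exact Finset.sum_congr rfl fun j hj => absorb_of_ne _ _ (Finset.ne_of_mem_erase hj)
  have h2 : ∀ r ∈ T, weightedRowSum D.pos (absorb μ i r) T =
      weightedRowSum D.pos μ (insert i T) - (D.pos i - D.pos r) • μ i := by
    intro r hr
    rw [weightedRowSum, weightedRowSum, Finset.sum_insert hi, ← Finset.add_sum_erase T _ hr,
      ← Finset.add_sum_erase T (fun c => D.pos c • μ c) hr, absorb_self,
      Finset.sum_congr rfl fun j hj => by rw [absorb_of_ne _ _ (Finset.ne_of_mem_erase hj)]]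
    module
  have h3 : ∀ r ∈ T, (D.pos i - D.pos r)⁻¹ • traceTerm κ D (adAt t (t i) r) (absorb μ i r) T =
      -((D.pos i - D.pos r)⁻¹ * comb κ (D.recolor (adAt t (t i) r)) T) •
        tracePair D.pos μ (insert i T) +
      comb κ (D.recolor (adAt t (t i) r)) T • vec₂ (rowSum μ (insert i T)) (μ i) := by
    intro r hr
    have h0 : D.pos i - D.pos r ≠ 0 := sub_ne_zero.2 (hσ.ne (by rintro rfl; exact hi hr))
    rw [traceTerm, tracePair, h1 r hr, h2 r hr, vec₂_sub_right, vec₂_smul_right, ← tracePair]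
    match_scalars
    · field_simp
    · field_simp
  rw [Finset.sum_congr rfl h3, Finset.sum_add_distrib, ← Finset.sum_smul, ← Finset.sum_smul,
    Finset.sum_neg_distrib, ← comb_insert κ hκ hs D hσ t hT hi, comb_invariant κ hκ hs D hσ t _ hT,
    zero_smul, add_zero, traceTerm]

end Trace

/-! ### Sums over set partitions -/

section Partition

variable {A : Type*} [CommRing A] {n : ℕ}

/-- `∑ ∏_{T} f(T)` over all partitions of `s`. -/
def partitionSum (f : Finset (Fin n) → A) (s : Finset (Fin n)) : A :=
  ∑ P : Finpartition s, ∏ T ∈ P.parts, f T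

theorem partitionSum_congr {f f' : Finset (Fin n) → A} {s : Finset (Fin n)}
    (h : ∀ T ⊆ s, f T = f' T) : partitionSum f s = partitionSum f' s :=
  Finset.sum_congr rfl fun P _ => Finset.prod_congr rfl fun _ hT => h _ (P.subset hT)

theorem partitionSum_empty (f : Finset (Fin n) → A) : partitionSum f ∅ = 1 := by
  have : ∀ P : Finpartition (∅ : Finset (Fin n)), P.parts = ∅ := fun P =>
    Finpartition.parts_eq_empty_iff.2 rfl
  have h1 : Fintype.card (Finpartition (∅ : Finset (Fin n))) = 1 :=
    Fintype.card_eq_one_iff.2 ⟨Finpartition.empty _, fun P =>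
      Finpartition.ext ((this P).trans (this _).symm)⟩
  simp [partitionSum, this, h1]

/-- A partition of `s` is the block containing `i` together with a partition of the complement of
that block. -/
theorem partitionSum_eq_sum_mem (f : Finset (Fin n) → A) {s : Finset (Fin n)} {i : Fin n}
    (hi : i ∈ s) :
    partitionSum f s = ∑ T ∈ s.powerset.filter (i ∈ ·), f T * partitionSum f (s \ T) := by
  have h1 : ∀ P ∈ (Finset.univ : Finset (Finpartition s)),
      P.part i ∈ s.powerset.filter (i ∈ ·) := fun P _ => by
    simp [P.part_subset, hi]
  rw [partitionSum, ← Finset.sum_fiberwise_of_maps_to h1]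
  refine Finset.sum_congr rfl fun T hT => ?_
  simp only [Finset.mem_filter, Finset.mem_powerset] at hT
  obtain ⟨hTs, hiT⟩ := hT
  have hb : T ≠ ⊥ := by rintro rfl; simp at hiT
  rw [partitionSum, Finset.mul_sum]
  symm
  have hdis : Disjoint (s \ T) T := Finset.sdiff_disjoint
  have hsup : (s \ T) ⊔ T = s := Finset.sdiff_union_of_subset hTs
  have hnot : ∀ Q : Finpartition (s \ T), T ∉ Q.parts := fun Q hQ =>
    (Finset.mem_sdiff.1 (Q.subset hQ hiT)).2 hiT
  refine Finset.sum_bij (fun Q _ => Q.extend hb hdis hsup) ?_ ?_ ?_ ?_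
  · intro Q _
    simp only [Finset.mem_filter, Finset.mem_univ, true_and]
    exact Finpartition.part_eq_of_mem _ (by simp [Finpartition.extend]) hiT
  · intro Q _ Q' _ h
    have h2 := congrArg Finpartition.parts h
    simp only [Finpartition.extend] at h2
    exact Finpartition.ext (by
      rw [← Finset.erase_insert (hnot Q), h2, Finset.erase_insert (hnot Q')])
  · intro P hP
    simp only [Finset.mem_filter, Finset.mem_univ, true_and] at hP
    have hTP : T ∈ P.parts := hP ▸ P.part_mem.2 hi
    refine ⟨⟨P.parts.erase T, ?_, ?_, ?_⟩, Finset.mem_univ _, ?_⟩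
    · exact P.supIndep.subset (Finset.erase_subset _ _)
    · ext x
      simp only [Finset.mem_sup, Finset.mem_erase, Finset.mem_sdiff, id]
      constructor
      · rintro ⟨U, ⟨hne, hU⟩, hx⟩
        exact ⟨P.subset hU hx, fun hxT => hne (P.eq_of_mem_parts hU hTP hx hxT)⟩
      · rintro ⟨hx, hxT⟩
        obtain ⟨U, hU, hxU⟩ := P.exists_mem hx
        exact ⟨U, ⟨by rintro rfl; exact hxT hxU, hU⟩, hxU⟩
    · exact fun h => P.bot_notMem (Finset.mem_of_mem_erase h)
    · exact Finpartition.ext (by simp [Finpartition.extend, Finset.insert_erase hTP])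
  · intro Q _
    simp only [Finpartition.extend]
    rw [Finset.prod_insert (hnot Q)]

end Partition

end EYM
end

noncomputable section
namespace EYM

/-! ### The recursion for the sum over partitions into traces -/

section TraceSum

variable {V 𝔤 M : Type*} [LieRing 𝔤] [LieAlgebra ℂ 𝔤] {n : ℕ} [AddCommGroup M] [Module ℂ M]

/-- Sort by the block `insert i T`. It contributes nothing for `T` empty, the contraction of two
gluons for `T` a singleton, and the recursion of `traceTerm_insert` for larger `T`; resumming over
the blocks containing `j` restores sums over all partitions. -/
theorem traceSum_insert (κ : LinearMap.BilinForm ℂ 𝔤) (hκ : ∀ x y z, κ ⁅x, y⁆ z = κ x ⁅y, z⁆)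
    (hs : ∀ x y, κ x y = κ y x) (D : ExternalData V 𝔤 n) (hσ : Function.Injective D.pos)
    (t : Fin n → 𝔤) (μ : Fin n → M) {s : Finset (Fin n)} {i : Fin n} (hi : i ∉ s) :
    partitionSum (traceTerm κ D t μ) (insert i s) = ∑ j ∈ s, (D.pos i - D.pos j)⁻¹ •
      (partitionSum (traceTerm κ D (adAt t (t i) j) (absorb μ i j)) s -
        κ (t i) (t j) • (vec₂ (μ i) (μ j) * partitionSum (traceTerm κ D t μ) (s.erase j))) := by
  have h1 : partitionSum (traceTerm κ D t μ) (insert i s) = ∑ T ∈ s.powerset,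
      traceTerm κ D t μ (insert i T) * partitionSum (traceTerm κ D t μ) (s \ T) := by
    rw [partitionSum_eq_sum_mem _ (Finset.mem_insert_self i s)]
    symm
    refine Finset.sum_bij (fun T _ => insert i T) ?_ ?_ ?_ ?_
    · intro T hT
      simp only [Finset.mem_powerset, Finset.mem_filter] at hT ⊢
      exact ⟨Finset.insert_subset_insert i hT, Finset.mem_insert_self i T⟩
    · intro T hT T' hT' h
      simp only [Finset.mem_powerset] at hT hT'
      rw [← Finset.erase_insert (fun h => hi (hT h)), h,
        Finset.erase_insert (fun h => hi (hT' h))]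
    · intro T hT
      simp only [Finset.mem_powerset, Finset.mem_filter] at hT
      exact ⟨T.erase i, Finset.mem_powerset.2 (Finset.subset_insert_iff.1 hT.1),
        Finset.insert_erase hT.2⟩
    · intro T hT
      have : s \ T = insert i s \ insert i T := by
        ext x
        simp only [Finset.mem_sdiff, Finset.mem_insert, not_or]
        constructor
        · rintro ⟨h, h'⟩
          exact ⟨Or.inr h, fun h0 => hi (h0 ▸ h), h'⟩
        · rintro ⟨h | h, h', h''⟩
          · exact absurd h h'
          · exact ⟨h, h''⟩
      rw [this]
  -- One formula covers all sizes of `T`: for `T = {j}` the absorbed trace term is zero and only the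
  -- correction remains.
  have h2 : ∀ T ∈ s.powerset, traceTerm κ D t μ (insert i T) =
      ∑ j ∈ T, (D.pos i - D.pos j)⁻¹ •
        (traceTerm κ D (adAt t (t i) j) (absorb μ i j) T -
          if T = {j} then κ (t i) (t j) • vec₂ (μ i) (μ j) else 0) := by
    intro T hT
    have hiT : i ∉ T := fun h => hi (Finset.mem_powerset.1 hT h)
    rcases Nat.lt_or_ge T.card 2 with h | h
    · interval_cases hc : T.card
      · obtain rfl := Finset.card_eq_zero.1 hc
        simpa using traceTerm_singleton κ D t μ i
      · obtain ⟨j, rfl⟩ := Finset.card_eq_one.1 hc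
        rw [Finset.sum_singleton, if_pos rfl, traceTerm_singleton, zero_sub, ← neg_smul,
          smul_smul, traceTerm_pair κ hκ hs D hσ t μ (by simpa using hiT), mul_neg]
    · rw [traceTerm_insert κ hκ hs D hσ t μ h hiT]
      refine Finset.sum_congr rfl fun j _ => ?_
      rw [if_neg (by rintro rfl; simp at h), sub_zero]
  rw [h1]
  calc _ = ∑ T ∈ s.powerset, ∑ j ∈ T, (D.pos i - D.pos j)⁻¹ •
        (traceTerm κ D (adAt t (t i) j) (absorb μ i j) T *
            partitionSum (traceTerm κ D (adAt t (t i) j) (absorb μ i j)) (s \ T) -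
          if T = {j} then κ (t i) (t j) •
            (vec₂ (μ i) (μ j) * partitionSum (traceTerm κ D t μ) (s.erase j)) else 0) := by
        refine Finset.sum_congr rfl fun T hT => ?_
        rw [h2 T hT, Finset.sum_mul]
        refine Finset.sum_congr rfl fun j hj => ?_
        -- The blocks outside `T` do not contain `j`, so they do not see the changed colour and
        -- momentum.
        have h3 : partitionSum (traceTerm κ D t μ) (s \ T) =
            partitionSum (traceTerm κ D (adAt t (t i) j) (absorb μ i j)) (s \ T) := by
          refine partitionSum_congr fun U hU => traceTerm_congr κ D ?_ ?_
          · intro k hk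
            exact (adAt_of_ne t _ (by rintro rfl; exact (Finset.mem_sdiff.1 (hU hk)).2 hj)).symm
          · intro k hk
            exact (absorb_of_ne μ _ (by rintro rfl; exact (Finset.mem_sdiff.1 (hU hk)).2 hj)).symm
        rw [smul_mul_assoc, sub_mul, h3]
        split_ifs with h
        · rw [← h3, h, Finset.sdiff_singleton_eq_erase, smul_mul_assoc]
        · rw [zero_mul]
    _ = ∑ j ∈ s, ∑ T ∈ s.powerset.filter (j ∈ ·), (D.pos i - D.pos j)⁻¹ •
        (traceTerm κ D (adAt t (t i) j) (absorb μ i j) T *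
            partitionSum (traceTerm κ D (adAt t (t i) j) (absorb μ i j)) (s \ T) -
          if T = {j} then κ (t i) (t j) •
            (vec₂ (μ i) (μ j) * partitionSum (traceTerm κ D t μ) (s.erase j)) else 0) := by
        refine Finset.sum_comm' fun T j => ?_
        simp only [Finset.mem_powerset, Finset.mem_filter]
        exact ⟨fun h => ⟨h, h.1 h.2⟩, fun h => h.1⟩
    _ = _ := by
        refine Finset.sum_congr rfl fun j hj => ?_
        rw [← Finset.smul_sum, Finset.sum_sub_distrib, ← partitionSum_eq_sum_mem _ hj,
          Finset.sum_ite_eq', if_pos (by simpa using hj)]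

end TraceSum
end EYM
end

noncomputable section
namespace EYM

/-! ### The fermions `ρ` and their currents -/

section Derivation

variable {M ι : Type*} [DecidableEq ι] [AddCommGroup M] [Module ℂ M]

/-- Stated for any even Leibniz map, so that it serves both for contractions and for `adDerivation`.
-/
theorem derivation_prod (δ : ExteriorAlgebra ℂ M →ₗ[ℂ] ExteriorAlgebra ℂ M)
    (hδ : ∀ (a : evenPart M) (x : ExteriorAlgebra ℂ M), δ (a * x) = δ a * x + a * δ x)
    (A : Finset ι) (v : ι → evenPart M) :
    δ (∏ j ∈ A, v j : evenPart M) =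
      ∑ j ∈ A, δ (v j) * (∏ k ∈ A.erase j, v k : evenPart M) := by
  have h1 : δ 1 = 0 := by simpa using hδ 1 1
  induction A using Finset.induction_on with
  | empty => simpa using h1
  | insert i A hi ih =>
    rw [Finset.prod_insert hi, map_mul, hδ, ih, Finset.sum_insert hi,
      Finset.erase_insert hi, Finset.mul_sum]
    congr 1
    refine Finset.sum_congr rfl fun j hj => ?_
    have hij : i ≠ j := by rintro rfl; exact hi hj
    rw [Finset.erase_insert_of_ne hij, Finset.prod_insert (fun h => hi (Finset.mem_of_mem_erase h)),
      map_mul, ← mul_assoc, ← mul_assoc, even_comm]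

theorem contr_prod (d : Module.Dual ℂ M) (A : Finset ι) (v : ι → evenPart M) :
    contr d (∏ j ∈ A, v j : evenPart M) =
      ∑ j ∈ A, contr d (v j) * (∏ k ∈ A.erase j, v k : evenPart M) :=
  derivation_prod (contr d) (contr_even_mul d) A v

end Derivation

section Linear

variable {M : Type*} [AddCommGroup M] [Module ℂ M]

/-- `vec₂ v w` as a linear function of `w`. -/
def vec₂L (v : M) : M →ₗ[ℂ] evenPart M where
  toFun := vec₂ v
  map_add' := vec₂_add_right v
  map_smul' c w := vec₂_smul_right c v w

theorem vec₂L_apply (v w : M) : vec₂L v w = vec₂ v w := rfl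

theorem map_sum_smul {ι A B : Type*} [Fintype ι] [AddCommMonoid A] [Module ℂ A] [AddCommMonoid B]
    [Module ℂ B] (f : A →ₗ[ℂ] B) (c : ι → ℂ) (a : ι → A) :
    f (∑ i, c i • a i) = ∑ i, c i • f (a i) := by
  simp

end Linear

section FermionSpace

/-- The span of `M` and the fermions `s·ρ` at the punctures. -/
def FermionSpace (M 𝔤 : Type*) (n : ℕ) : Type _ := M × (Fin n → 𝔤)

variable (M 𝔤 : Type*) (n : ℕ) [AddCommGroup M] [Module ℂ M] [LieRing 𝔤]

/-- The additive group structure of `FermionSpace`. -/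
def fermionSpaceGroup : AddCommGroup (FermionSpace M 𝔤 n) :=
  (Prod.instAddCommGroup : AddCommGroup (M × (Fin n → 𝔤)))

instance : AddCommGroup (FermionSpace M 𝔤 n) := fermionSpaceGroup M 𝔤 n

variable [LieAlgebra ℂ 𝔤]

/-- The module structure of `FermionSpace`. -/
def fermionSpaceModule : Module ℂ (FermionSpace M 𝔤 n) :=
  (Prod.instModule : Module ℂ (M × (Fin n → 𝔤)))

instance : Module ℂ (FermionSpace M 𝔤 n) := fermionSpaceModule M 𝔤 n

/-- The component in `M`. -/
def base : FermionSpace M 𝔤 n →ₗ[ℂ] M where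
  toFun w := w.1
  map_add' _ _ := rfl
  map_smul' _ _ := rfl

/-- The vectors of `M` as fermions. -/
def psiV : M →ₗ[ℂ] FermionSpace M 𝔤 n where
  toFun m := (m, (0 : Fin n → 𝔤))
  map_add' x y := congrArg (Prod.mk (x + y)) (add_zero (0 : Fin n → 𝔤)).symm
  map_smul' c x := congrArg (Prod.mk (c • x)) (smul_zero (A := Fin n → 𝔤) c).symm

variable {𝔤 n}

/-- The component in `𝔤` at the puncture `j`. -/
def slot (j : Fin n) : FermionSpace M 𝔤 n →ₗ[ℂ] 𝔤 where
  toFun w := w.2 j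
  map_add' _ _ := rfl
  map_smul' _ _ := rfl

/-- The fermion `s·ρ(σ_j)`. -/
def rhoV (j : Fin n) : 𝔤 →ₗ[ℂ] FermionSpace M 𝔤 n where
  toFun s := ((0 : M), (Pi.single j s : Fin n → 𝔤))
  map_add' x y := Prod.ext (add_zero (0 : M)).symm (Pi.single_add (f := fun _ => 𝔤) j x y)
  map_smul' c x := Prod.ext (smul_zero (A := M) c).symm (Pi.single_smul (f := fun _ => 𝔤) j c x)

end FermionSpace

section Gauge

variable {𝔤 M : Type*} [LieRing 𝔤] [LieAlgebra ℂ 𝔤] {n N : ℕ} [AddCommGroup M] [Module ℂ M]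

theorem base_psiV (m : M) : base M 𝔤 n (psiV M 𝔤 n m) = m := rfl

theorem base_rhoV (j : Fin n) (s : 𝔤) : base M 𝔤 n (rhoV M j s) = 0 := rfl

theorem slot_psiV (j : Fin n) (m : M) : slot M j (psiV M 𝔤 n m) = 0 := rfl

theorem slot_rhoV (j : Fin n) (s : 𝔤) : slot M j (rhoV M j s) = s :=
  Pi.single_eq_same (M := fun _ : Fin n => 𝔤) j s

theorem slot_rhoV_of_ne {j k : Fin n} (h : j ≠ k) (s : 𝔤) : slot M j (rhoV M k s) = 0 :=
  Pi.single_eq_of_ne (M := fun _ : Fin n => 𝔤) h s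

variable (M) in
/-- The dual vector `w ↦ κ(s, w_j)`. -/
def rhoDual (κ : LinearMap.BilinForm ℂ 𝔤) (j : Fin n) :
    𝔤 →ₗ[ℂ] Module.Dual ℂ (FermionSpace M 𝔤 n) :=
  κ.compl₂ (slot M j)

theorem rhoDual_apply (κ : LinearMap.BilinForm ℂ 𝔤) (j : Fin n) (s : 𝔤)
    (w : FermionSpace M 𝔤 n) : rhoDual M κ j s w = κ s (slot M j w) := rfl

theorem rhoDual_psiV (κ : LinearMap.BilinForm ℂ 𝔤) (j : Fin n) (s : 𝔤) (m : M) :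
    rhoDual M κ j s (psiV M 𝔤 n m) = 0 := by rw [rhoDual_apply, slot_psiV, map_zero]

theorem rhoDual_rhoV (κ : LinearMap.BilinForm ℂ 𝔤) (j : Fin n) (s r : 𝔤) :
    rhoDual M κ j s (rhoV M j r) = κ s r := by rw [rhoDual_apply, slot_rhoV]

theorem rhoDual_rhoV_of_ne (κ : LinearMap.BilinForm ℂ 𝔤) {j k : Fin n} (h : j ≠ k) (s r : 𝔤) :
    rhoDual M κ j s (rhoV M k r) = 0 := by rw [rhoDual_apply, slot_rhoV_of_ne h, map_zero]

variable (M) in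
/-- The propagator of `ρ`. -/
def rhoForm (κ : LinearMap.BilinForm ℂ 𝔤) (σ : Fin n → ℂ) :
    LinearMap.BilinForm ℂ (FermionSpace M 𝔤 n) :=
  ∑ j, ∑ k, (σ j - σ k)⁻¹ • (rhoDual M κ k ∘ₗ slot M j)

theorem rhoForm_apply (κ : LinearMap.BilinForm ℂ 𝔤) (σ : Fin n → ℂ)
    (w w' : FermionSpace M 𝔤 n) :
    rhoForm M κ σ w w' = ∑ j, ∑ k, (σ j - σ k)⁻¹ * κ (slot M j w) (slot M k w') := by
  simp [rhoForm, rhoDual_apply, LinearMap.sum_apply]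

theorem rhoForm_isAlt (κ : LinearMap.BilinForm ℂ 𝔤) (hs : ∀ x y, κ x y = κ y x)
    (σ : Fin n → ℂ) : (rhoForm M κ σ).IsAlt := by
  intro w
  rw [rhoForm_apply]
  have : ∑ j, ∑ k, (σ j - σ k)⁻¹ * κ (slot M j w) (slot M k w) =
      -∑ j, ∑ k, (σ j - σ k)⁻¹ * κ (slot M j w) (slot M k w) := by
    conv_lhs => rw [Finset.sum_comm]
    simp only [← Finset.sum_neg_distrib]
    refine Finset.sum_congr rfl fun j _ => Finset.sum_congr rfl fun k _ => ?_
    rw [hs, ← neg_sub (σ j), inv_neg, neg_mul]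
  exact self_eq_neg.1 this

theorem rhoForm_psiV (κ : LinearMap.BilinForm ℂ 𝔤) (σ : Fin n → ℂ) (m : M) :
    rhoForm M κ σ (psiV M 𝔤 n m) = 0 := by
  refine LinearMap.ext fun w => ?_
  simp [rhoForm_apply, slot_psiV]

/-- The term `k = i` vanishes because `0⁻¹ = 0`; this encodes normal ordering at one puncture. -/
theorem rhoForm_rhoV (κ : LinearMap.BilinForm ℂ 𝔤) (σ : Fin n → ℂ) (i : Fin n) (s : 𝔤) :
    rhoForm M κ σ (rhoV M i s) = ∑ k, (σ i - σ k)⁻¹ • rhoDual M κ k s := by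
  refine LinearMap.ext fun w => ?_
  rw [rhoForm_apply, LinearMap.sum_apply, Finset.sum_eq_single i]
  · simp [slot_rhoV, rhoDual_apply]
  · intro j _ hj
    simp [slot_rhoV_of_ne hj]
  · simp

/-- Wick contraction of the fermions `ρ`. -/
def rhoWick (κ : LinearMap.BilinForm ℂ 𝔤) (hs : ∀ x y, κ x y = κ y x) (σ : Fin n → ℂ) :
    ExteriorAlgebra ℂ (FermionSpace M 𝔤 n) →ₗ[ℂ] ExteriorAlgebra ℂ M :=
  (ExteriorAlgebra.map (base M 𝔤 n)).toLinearMap ∘ₗ wickExp (rhoForm_isAlt κ hs σ)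

variable (κ : LinearMap.BilinForm ℂ 𝔤) (hs : ∀ x y, κ x y = κ y x) (σ : Fin n → ℂ)

theorem rhoWick_one : rhoWick (M := M) κ hs σ 1 = 1 := by
  simp [rhoWick, wickExp_one]

/-- Contraction followed by projection to `M`: an uncontracted `ρ` dies, whereas vectors of `M` have
no `ρ` propagator and pass through. -/
theorem rhoWick_vec_mul (w : FermionSpace M 𝔤 n) (x : ExteriorAlgebra ℂ (FermionSpace M 𝔤 n)) :
    rhoWick κ hs σ (vec w * x) =
      vec (base M 𝔤 n w) * rhoWick κ hs σ x + rhoWick κ hs σ (contr (rhoForm M κ σ w) x) := by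
  simp [rhoWick, wickExp_vec_mul, wickExp_contr]

theorem rhoWick_psiV_mul (m : M) (x : ExteriorAlgebra ℂ (FermionSpace M 𝔤 n)) :
    rhoWick κ hs σ (vec (psiV M 𝔤 n m) * x) = vec m * rhoWick κ hs σ x := by
  rw [rhoWick_vec_mul, rhoForm_psiV]
  simp [base_psiV]

theorem rhoWick_rhoV_mul (i : Fin n) (s : 𝔤) (x : ExteriorAlgebra ℂ (FermionSpace M 𝔤 n)) :
    rhoWick κ hs σ (vec (rhoV M i s) * x) =
      ∑ k, (σ i - σ k)⁻¹ • rhoWick κ hs σ (contr (rhoDual M κ k s) x) := by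
  rw [rhoWick_vec_mul, rhoForm_rhoV]
  simp [base_rhoV, LinearMap.sum_apply]

theorem contr_rhoWick (d : Module.Dual ℂ M) (x : ExteriorAlgebra ℂ (FermionSpace M 𝔤 n)) :
    contr d (rhoWick κ hs σ x) =
      rhoWick κ hs σ (contr (d ∘ₗ base M 𝔤 n) x) := by
  simp [rhoWick, wickExp_contr, contr_map]

variable (b : Module.Basis (Fin N) ℂ 𝔤) (hb : ∀ x y, κ (b x) (b y) = if x = y then 1 else 0)

include hb in
theorem symmetric_of_orthonormal (x y : 𝔤) : κ x y = κ y x := by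
  have : κ = κ.flip := b.ext fun i => b.ext fun j => by
    refine (hb i j).trans (Eq.trans ?_ (hb j i).symm)
    simp only [eq_comm]
  exact LinearMap.congr_fun₂ this x y

include hb in
theorem sum_form_smul_basis (x : 𝔤) : ∑ z, κ x (b z) • b z = x := by
  conv_rhs => rw [← b.sum_repr x]
  refine Finset.sum_congr rfl fun z _ => ?_
  have : κ x (b z) = b.repr x z := by
    conv_lhs => rw [← b.sum_repr x]
    rw [map_sum, LinearMap.sum_apply]
    simp [hb]
  rw [this]

variable (M) in
/-- `-½ f^{abc} s^a ρ^b ρ^c` at the puncture `j`. -/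
def rhoCurrent (j : Fin n) (s : 𝔤) : evenPart (FermionSpace M 𝔤 n) :=
  ∑ x, ∑ y, (-(1 / 2) * κ ⁅s, b x⁆ (b y)) • vec₂ (rhoV M j (b x)) (rhoV M j (b y))

include hb in
theorem rhoCurrent_eq (j : Fin n) (s : 𝔤) :
    rhoCurrent M κ b j s = (-(1 / 2) : ℂ) • ∑ x, vec₂ (rhoV M j (b x)) (rhoV M j ⁅s, b x⁆) := by
  have h1 : ∀ x, vec₂ (rhoV M j (b x)) (rhoV M j ⁅s, b x⁆) =
      ∑ y, κ ⁅s, b x⁆ (b y) • vec₂ (rhoV M j (b x)) (rhoV M j (b y)) := fun x => by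
    have h := map_sum_smul (vec₂L (rhoV M j (b x)) ∘ₗ rhoV M j) (fun y => κ ⁅s, b x⁆ (b y)) b
    rw [sum_form_smul_basis κ b hb] at h
    simpa only [LinearMap.comp_apply, vec₂L_apply] using h
  rw [rhoCurrent, Finset.smul_sum]
  refine Finset.sum_congr rfl fun x _ => ?_
  rw [h1, Finset.smul_sum]
  exact Finset.sum_congr rfl fun y _ => mul_smul _ _ _

/-- The gluon operator `μ s·ρ - ½ f^{abc} s^a ρ^b ρ^c` at the puncture `j`. -/
def gluonOp (j : Fin n) (s : 𝔤) (m : M) : evenPart (FermionSpace M 𝔤 n) :=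
  vec₂ (psiV M 𝔤 n m) (rhoV M j s) + rhoCurrent M κ b j s

end Gauge
end EYM
end

noncomputable section
namespace EYM

/-! ### The Ward identity for the gluon operators -/

section Ward

variable {𝔤 M : Type*} [LieRing 𝔤] [LieAlgebra ℂ 𝔤] {n N : ℕ} [AddCommGroup M] [Module ℂ M]

theorem contr_vec₂ {M : Type*} [AddCommGroup M] [Module ℂ M] (d : Module.Dual ℂ M) (v w : M) :
    contr d (vec₂ v w : evenPart M) = d v • vec w - d w • vec v := by
  have : ((vec₂ v w : evenPart M) : ExteriorAlgebra ℂ M) = vec v * vec w := rfl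
  rw [this, contr_vec_mul, contr_vec, ← Algebra.commutes, ← Algebra.smul_def]

variable (M) in
/-- `∑ κ([t, b_y], b_z) ∂_{k,z} ∂_{j,y}` -/
def pairContr (κ : LinearMap.BilinForm ℂ 𝔤) (b : Module.Basis (Fin N) ℂ 𝔤) (t : 𝔤) (j k : Fin n) :
    ExteriorAlgebra ℂ (FermionSpace M 𝔤 n) →ₗ[ℂ] ExteriorAlgebra ℂ (FermionSpace M 𝔤 n) :=
  ∑ y, ∑ z, κ ⁅t, b y⁆ (b z) • (contr (rhoDual M κ k (b z)) ∘ₗ contr (rhoDual M κ j (b y)))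

variable (κ : LinearMap.BilinForm ℂ 𝔤) (hs : ∀ x y, κ x y = κ y x)
  (hκ : ∀ x y z, κ ⁅x, y⁆ z = κ x ⁅y, z⁆) (σ : Fin n → ℂ)
  (b : Module.Basis (Fin N) ℂ 𝔤) (hb : ∀ x y, κ (b x) (b y) = if x = y then 1 else 0)

theorem pairContr_apply (t : 𝔤) (j k : Fin n) (x : ExteriorAlgebra ℂ (FermionSpace M 𝔤 n)) :
    pairContr M κ b t j k x = ∑ y, ∑ z, κ ⁅t, b y⁆ (b z) •
      contr (rhoDual M κ k (b z)) (contr (rhoDual M κ j (b y)) x) := by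
  simp [pairContr, LinearMap.sum_apply]

include hs hκ in
theorem form_lie_antisymm (t x y : 𝔤) : κ ⁅t, x⁆ y = -κ ⁅t, y⁆ x := by
  rw [← lie_skew, map_neg, LinearMap.neg_apply, hκ, hs]

include hs hκ in
-- The structure constants are antisymmetric and contractions anticommute; the two signs cancel.
theorem pairContr_comm (t : 𝔤) (j k : Fin n) (x : ExteriorAlgebra ℂ (FermionSpace M 𝔤 n)) :
    pairContr M κ b t j k x = pairContr M κ b t k j x := by
  rw [pairContr_apply, pairContr_apply, Finset.sum_comm]
  refine Finset.sum_congr rfl fun y _ => Finset.sum_congr rfl fun z _ => ?_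
  rw [form_lie_antisymm κ hs hκ, contr_comm, smul_neg, neg_smul, neg_neg]

/-- Neither fermion of the current survives the projection, so both are contracted with the rest, at
punctures `j` and `k`. -/
theorem rhoWick_rhoCurrent_mul (i : Fin n) (t : 𝔤)
    (x : ExteriorAlgebra ℂ (FermionSpace M 𝔤 n)) :
    rhoWick κ hs σ (evenVal (rhoCurrent M κ b i t) * x) = (1 / 2 : ℂ) • ∑ j, ∑ k,
      ((σ i - σ j)⁻¹ * (σ i - σ k)⁻¹) • rhoWick κ hs σ (pairContr M κ b t j k x) := by
  have h1 : ∀ p q : 𝔤, rhoWick κ hs σ (vec (rhoV M i p) * (vec (rhoV M i q) * x)) =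
      -∑ j, ∑ k, ((σ i - σ j)⁻¹ * (σ i - σ k)⁻¹) •
        rhoWick κ hs σ (contr (rhoDual M κ k q) (contr (rhoDual M κ j p) x)) := by
    intro p q
    rw [rhoWick_rhoV_mul, ← Finset.sum_neg_distrib]
    refine Finset.sum_congr rfl fun j _ => ?_
    by_cases hj : j = i
    · simp [hj]
    · rw [contr_vec_mul, rhoDual_rhoV_of_ne κ hj, zero_smul, zero_sub, map_neg, rhoWick_rhoV_mul,
        smul_neg, Finset.smul_sum]
      simp only [mul_smul]
  have h2 : ((rhoCurrent M κ b i t : evenPart (FermionSpace M 𝔤 n)) :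
      ExteriorAlgebra ℂ (FermionSpace M 𝔤 n)) = ∑ y, ∑ z, (-(1 / 2) * κ ⁅t, b y⁆ (b z)) •
        (vec (rhoV M i (b y)) * vec (rhoV M i (b z))) := by
    simp only [rhoCurrent, map_sum, map_smul]
    rfl
  rw [h2]
  simp only [Finset.sum_mul, smul_mul_assoc, mul_assoc, map_sum, map_smul, h1, pairContr_apply,
    Finset.smul_sum, smul_neg, smul_smul]
  rw [Finset.sum_comm' (t' := Finset.univ) (s' := fun _ => Finset.univ) (by simp)]
  simp only [← Finset.sum_neg_distrib]
  calc _ = ∑ z, ∑ j, ∑ y, ∑ k, _ := Finset.sum_congr rfl fun z _ => Finset.sum_comm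
    _ = ∑ j, ∑ z, ∑ y, ∑ k, _ := Finset.sum_comm
    _ = ∑ j, ∑ z, ∑ k, ∑ y, _ :=
      Finset.sum_congr rfl fun j _ => Finset.sum_congr rfl fun z _ => Finset.sum_comm
    _ = ∑ j, ∑ k, ∑ z, ∑ y, _ := Finset.sum_congr rfl fun j _ => Finset.sum_comm
    _ = ∑ j, ∑ k, ∑ y, ∑ z, _ :=
      Finset.sum_congr rfl fun j _ => Finset.sum_congr rfl fun k _ => Finset.sum_comm
    _ = _ := by
      refine Finset.sum_congr rfl fun j _ => Finset.sum_congr rfl fun k _ =>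
        Finset.sum_congr rfl fun y _ => Finset.sum_congr rfl fun z _ => ?_
      rw [← neg_smul]
      congr 1
      ring

variable (M) in
/-- The derivation that takes `s·ρ(σ_j)` to `[t, s]·ρ(σ_j) / σ_{ij}`. -/
def adDerivation (i : Fin n) (t : 𝔤) :
    ExteriorAlgebra ℂ (FermionSpace M 𝔤 n) →ₗ[ℂ] ExteriorAlgebra ℂ (FermionSpace M 𝔤 n) :=
  ∑ j, ∑ y, (σ i - σ j)⁻¹ •
    (LinearMap.mulLeft ℂ (vec (rhoV M j ⁅t, b y⁆)) ∘ₗ contr (rhoDual M κ j (b y)))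

theorem adDerivation_apply (i : Fin n) (t : 𝔤) (x : ExteriorAlgebra ℂ (FermionSpace M 𝔤 n)) :
    adDerivation M κ σ b i t x = ∑ j, ∑ y, (σ i - σ j)⁻¹ •
      (vec (rhoV M j ⁅t, b y⁆) * contr (rhoDual M κ j (b y)) x) := by
  simp [adDerivation, LinearMap.sum_apply]

theorem adDerivation_even_mul (i : Fin n) (t : 𝔤) (a : evenPart (FermionSpace M 𝔤 n))
    (x : ExteriorAlgebra ℂ (FermionSpace M 𝔤 n)) :
    adDerivation M κ σ b i t (a * x) =
      adDerivation M κ σ b i t a * x + a * adDerivation M κ σ b i t x := by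
  simp only [adDerivation_apply, Finset.sum_mul, Finset.mul_sum, ← Finset.sum_add_distrib]
  refine Finset.sum_congr rfl fun j _ => Finset.sum_congr rfl fun y _ => ?_
  rw [contr_even_mul, mul_add, smul_add, smul_mul_assoc, mul_assoc, mul_smul_comm, ← mul_assoc _ (evenVal a),
    ← even_comm a, mul_assoc]

include hb in
-- The rotated fermion at `σ_j` is contracted in turn with one at `σ_k`. This brings the simple-pole
-- action into the same double contractions as `rhoWick_rhoCurrent_mul`.
theorem rhoWick_adDerivation (i : Fin n) (t : 𝔤) (x : ExteriorAlgebra ℂ (FermionSpace M 𝔤 n)) :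
    rhoWick κ hs σ (adDerivation M κ σ b i t x) = ∑ j, ∑ k,
      ((σ i - σ j)⁻¹ * (σ j - σ k)⁻¹) • rhoWick κ hs σ (pairContr M κ b t j k x) := by
  have h1 : ∀ (k : Fin n) (s : 𝔤) (z : ExteriorAlgebra ℂ (FermionSpace M 𝔤 n)),
      contr (rhoDual M κ k s) z = ∑ y, κ s (b y) • contr (rhoDual M κ k (b y)) z := by
    intro k s z
    conv_lhs => rw [← sum_form_smul_basis κ b hb s]
    simp [LinearMap.sum_apply]
  simp only [adDerivation_apply, map_sum, map_smul, rhoWick_rhoV_mul, pairContr_apply,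
    Finset.smul_sum, smul_smul]
  refine Finset.sum_congr rfl fun j _ => ?_
  rw [Finset.sum_comm]
  refine Finset.sum_congr rfl fun k _ => Finset.sum_congr rfl fun y _ => ?_
  rw [h1 k ⁅t, b y⁆, map_sum, Finset.smul_sum]
  simp only [map_smul, smul_smul]

include hb hκ in
-- For `j ≠ k` use `1/(σ_ij σ_ik) = 1/(σ_ij σ_jk) + 1/(σ_ik σ_kj)`. The double contraction is
-- symmetric in `j`, `k`, so both terms give the same sum and the factor ½ disappears; the
-- coincident terms `j = k` are the double poles.
theorem rhoWick_rhoCurrent_mul_eq (hσ : Function.Injective σ) (i : Fin n) (t : 𝔤)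
    (x : ExteriorAlgebra ℂ (FermionSpace M 𝔤 n)) (hx : ∀ s, contr (rhoDual M κ i s) x = 0) :
    rhoWick κ hs σ (evenVal (rhoCurrent M κ b i t) * x) =
      rhoWick κ hs σ (adDerivation M κ σ b i t x) + (1 / 2 : ℂ) • ∑ j,
        ((σ i - σ j)⁻¹ ^ 2) • rhoWick κ hs σ (pairContr M κ b t j j x) := by
  set K : Fin n → Fin n → ExteriorAlgebra ℂ M := fun j k =>
    rhoWick κ hs σ (pairContr M κ b t j k x) with hK
  have hK1 : ∀ j k, K j k = K k j := fun j k => by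
    simp only [hK, pairContr_comm κ hs hκ b t j k]
  have hK2 : ∀ k, K i k = 0 := fun k => by simp [hK, pairContr_apply, hx]
  -- At `j = k` both partial fractions are zero because `0⁻¹ = 0`, so the double pole is added
  -- separately; at `j = i` or `k = i` the contraction itself vanishes by `hx`.
  have h0 : ∀ j k, ((σ i - σ j)⁻¹ * (σ i - σ k)⁻¹) • K j k =
      ((σ i - σ j)⁻¹ * (σ j - σ k)⁻¹) • K j k + ((σ i - σ k)⁻¹ * (σ k - σ j)⁻¹) • K j k +
        if j = k then ((σ i - σ j)⁻¹ ^ 2) • K j j else 0 := by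
    intro j k
    by_cases hj : j = i
    · subst hj; simp [hK2]
    by_cases hk : k = i
    · subst hk; simp [hK1 j, hK2, hj]
    by_cases hjk : j = k
    · subst hjk; simp [sq]
    · have e1 : σ i - σ j ≠ 0 := sub_ne_zero.2 (hσ.ne (Ne.symm hj))
      have e2 : σ i - σ k ≠ 0 := sub_ne_zero.2 (hσ.ne (Ne.symm hk))
      have e3 : σ j - σ k ≠ 0 := sub_ne_zero.2 (hσ.ne hjk)
      rw [if_neg hjk, add_zero, ← add_smul, ← neg_sub (σ j) (σ k)]
      congr 1
      field_simp
      ring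
  have h1 : ∑ j, ∑ k, ((σ i - σ k)⁻¹ * (σ k - σ j)⁻¹) • K j k =
      ∑ j, ∑ k, ((σ i - σ j)⁻¹ * (σ j - σ k)⁻¹) • K j k := by
    rw [Finset.sum_comm]
    exact Finset.sum_congr rfl fun j _ => Finset.sum_congr rfl fun k _ => by rw [hK1]
  rw [rhoWick_rhoCurrent_mul, rhoWick_adDerivation κ hs σ b hb]
  change (1 / 2 : ℂ) • ∑ j, ∑ k, ((σ i - σ j)⁻¹ * (σ i - σ k)⁻¹) • K j k =
    ∑ j, ∑ k, ((σ i - σ j)⁻¹ * (σ j - σ k)⁻¹) • K j k +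
      (1 / 2 : ℂ) • ∑ j, ((σ i - σ j)⁻¹ ^ 2) • K j j
  simp only [h0, Finset.sum_add_distrib, h1, Finset.sum_ite_eq, Finset.mem_univ, if_true]
  module

end Ward
end EYM
end

noncomputable section
namespace EYM

section Ward

theorem evenVal_add {M : Type*} [AddCommGroup M] [Module ℂ M] (a b : evenPart M) :
    evenVal (a + b) = evenVal a + evenVal b := map_add _ a b

theorem evenVal_smul_sum {M ι : Type*} [AddCommGroup M] [Module ℂ M] (c : ℂ) (s : Finset ι)
    (a : ι → evenPart M) : evenVal (c • ∑ i ∈ s, a i) = c • ∑ i ∈ s, evenVal (a i) := by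
  rw [map_smul, map_sum]

theorem evenVal_vec₂ {M : Type*} [AddCommGroup M] [Module ℂ M] (v w : M) :
    evenVal (vec₂ v w) = vec v * vec w := rfl

variable {𝔤 M : Type*} [LieRing 𝔤] [LieAlgebra ℂ 𝔤] {n N : ℕ} [AddCommGroup M] [Module ℂ M]
  (κ : LinearMap.BilinForm ℂ 𝔤) (hs : ∀ x y, κ x y = κ y x)
  (hκ : ∀ x y z, κ ⁅x, y⁆ z = κ x ⁅y, z⁆) (σ : Fin n → ℂ)
  (b : Module.Basis (Fin N) ℂ 𝔤) (hb : ∀ x y, κ (b x) (b y) = if x = y then 1 else 0)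

include hb in
theorem evenVal_rhoCurrent (j : Fin n) (s : 𝔤) :
    evenVal (rhoCurrent M κ b j s) =
      (-(1 / 2) : ℂ) • ∑ x, vec (rhoV M j (b x)) * vec (rhoV M j ⁅s, b x⁆) := by
  rw [rhoCurrent_eq κ b hb, evenVal_smul_sum]
  simp only [evenVal_vec₂]

theorem evenVal_gluonOp (j : Fin n) (s : 𝔤) (m : M) :
    evenVal (gluonOp κ b j s m) =
      vec (psiV M 𝔤 n m) * vec (rhoV M j s) + evenVal (rhoCurrent M κ b j s) := by
  rw [gluonOp, evenVal_add, evenVal_vec₂]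

theorem vec_neg {M : Type*} [AddCommGroup M] [Module ℂ M] (v : M) : vec (-v) = -vec v :=
  map_neg _ v

theorem contr_vec_mul_vec {M : Type*} [AddCommGroup M] [Module ℂ M] (d : Module.Dual ℂ M)
    (v w : M) : contr d (vec v * vec w) = d v • vec w - d w • vec v :=
  contr_vec₂ d v w

include hb in
theorem sum_form_basis_smul {A : Type*} [AddCommMonoid A] [Module ℂ A] (f : 𝔤 →ₗ[ℂ] A) (s : 𝔤) :
    ∑ x, κ s (b x) • f (b x) = f s := by
  conv_rhs => rw [← sum_form_smul_basis κ b hb s]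
  simp

include hκ hb in
-- Contracting the first or the second fermion gives the same vector, which removes the factor ½:
-- the bilinear acts on `ρ` by the adjoint action.
theorem contr_rhoCurrent (j : Fin n) (s t : 𝔤) :
    contr (rhoDual M κ j s) (evenVal (rhoCurrent M κ b j t)) = vec (rhoV M j ⁅s, t⁆) := by
  have h1 : ∑ x, κ s (b x) • vec (rhoV M j ⁅t, b x⁆) = vec (rhoV M j ⁅t, s⁆) := by
    simpa using sum_form_basis_smul κ b hb
      (ExteriorAlgebra.ι ℂ ∘ₗ rhoV M j ∘ₗ (LieAlgebra.ad ℂ 𝔤 t : 𝔤 →ₗ[ℂ] 𝔤)) s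
  have h2 : ∑ x, κ s ⁅t, b x⁆ • vec (rhoV M j (b x)) = vec (rhoV M j ⁅s, t⁆) := by
    have := sum_form_basis_smul κ b hb (ExteriorAlgebra.ι ℂ ∘ₗ rhoV M j) ⁅s, t⁆
    simp only [hκ] at this
    exact this
  rw [evenVal_rhoCurrent κ b hb, map_smul, map_sum]
  simp only [contr_vec_mul_vec, rhoDual_rhoV, Finset.sum_sub_distrib]
  rw [h1, h2, ← lie_skew s t, map_neg, vec_neg]
  module

include hb in
theorem contr_rhoCurrent_of_ne {j k : Fin n} (h : k ≠ j) (s t : 𝔤) :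
    contr (rhoDual M κ k s) (evenVal (rhoCurrent M κ b j t)) = 0 := by
  rw [evenVal_rhoCurrent κ b hb, map_smul, map_sum]
  simp only [contr_vec_mul_vec, rhoDual_rhoV_of_ne κ h]
  simp

include hκ hb in
theorem contr_gluonOp (j : Fin n) (s t : 𝔤) (m : M) :
    contr (rhoDual M κ j s) (evenVal (gluonOp κ b j t m)) =
      vec (rhoV M j ⁅s, t⁆) - κ s t • vec (psiV M 𝔤 n m) := by
  rw [evenVal_gluonOp, map_add, contr_vec_mul_vec, contr_rhoCurrent κ hκ b hb, rhoDual_rhoV,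
    rhoDual_psiV]
  module

include hb in
theorem contr_gluonOp_of_ne {j k : Fin n} (h : k ≠ j) (s t : 𝔤) (m : M) :
    contr (rhoDual M κ k s) (evenVal (gluonOp κ b j t m)) = 0 := by
  rw [evenVal_gluonOp, map_add, contr_vec_mul_vec, contr_rhoCurrent_of_ne κ b hb h,
    rhoDual_rhoV_of_ne κ h, rhoDual_psiV]
  simp

variable (M) in
/-- The vector `[t, s]·ρ(σ_j) / σ_{ij}` as a linear function of `s·ρ(σ_j)`. -/
def adVector (i : Fin n) (t : 𝔤) : FermionSpace M 𝔤 n →ₗ[ℂ] FermionSpace M 𝔤 n :=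
  ∑ j, (σ i - σ j)⁻¹ • (rhoV M j ∘ₗ (LieAlgebra.ad ℂ 𝔤 t : 𝔤 →ₗ[ℂ] 𝔤) ∘ₗ slot M j)

theorem adVector_apply (i : Fin n) (t : 𝔤) (w : FermionSpace M 𝔤 n) :
    adVector M σ i t w = ∑ j, (σ i - σ j)⁻¹ • rhoV M j ⁅t, slot M j w⁆ := by
  simp [adVector, LinearMap.sum_apply]

theorem adVector_psiV (i : Fin n) (t : 𝔤) (m : M) : adVector M σ i t (psiV M 𝔤 n m) = 0 := by
  simp [adVector_apply, slot_psiV]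

theorem adVector_rhoV (i j : Fin n) (t s : 𝔤) :
    adVector M σ i t (rhoV M j s) = (σ i - σ j)⁻¹ • rhoV M j ⁅t, s⁆ := by
  rw [adVector_apply, Finset.sum_eq_single j]
  · rw [slot_rhoV]
  · intro k _ hk
    rw [slot_rhoV_of_ne hk]
    simp
  · simp

include hs hb in
theorem adDerivation_vec_mul_vec (i : Fin n) (t : 𝔤) (v w : FermionSpace M 𝔤 n) :
    adDerivation M κ σ b i t (vec v * vec w) =
      vec (adVector M σ i t v) * vec w + vec v * vec (adVector M σ i t w) := by
  have h1 : ∀ (j : Fin n) (s : 𝔤), ∑ y, κ (b y) s • vec (rhoV M j ⁅t, b y⁆) =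
      vec (rhoV M j ⁅t, s⁆) := by
    intro j s
    simpa [hs] using sum_form_basis_smul κ b hb
      (ExteriorAlgebra.ι ℂ ∘ₗ rhoV M j ∘ₗ (LieAlgebra.ad ℂ 𝔤 t : 𝔤 →ₗ[ℂ] 𝔤)) s
  have h2 : ∀ w : FermionSpace M 𝔤 n, vec (adVector M σ i t w) =
      ∑ j, ∑ y, (σ i - σ j)⁻¹ • κ (b y) (slot M j w) • vec (rhoV M j ⁅t, b y⁆) := by
    intro w
    simp only [← Finset.smul_sum, h1, adVector_apply, map_sum, map_smul]
  rw [adDerivation_apply, vec_mul_vec_comm v (adVector M σ i t w), h2, h2, Finset.sum_mul, Finset.sum_mul,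
    ← sub_eq_add_neg, ← Finset.sum_sub_distrib]
  refine Finset.sum_congr rfl fun j _ => ?_
  rw [Finset.sum_mul, Finset.sum_mul, ← Finset.sum_sub_distrib]
  refine Finset.sum_congr rfl fun y _ => ?_
  simp only [contr_vec_mul_vec, rhoDual_apply, mul_sub, mul_smul_comm, smul_mul_assoc, smul_sub]

include hs hκ hb in
-- Invariance of the tensor `∑ b_x ⊗ b_x` under the adjoint action.
theorem sum_vec_lie_mul (j : Fin n) (t : 𝔤) (f : 𝔤 →ₗ[ℂ] 𝔤) :
    ∑ x, vec (rhoV M j ⁅t, b x⁆) * vec (rhoV M j (f (b x))) =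
      -∑ x, vec (rhoV M j (b x)) * vec (rhoV M j (f ⁅t, b x⁆)) := by
  have h1 : ∀ x, vec (rhoV M j ⁅t, b x⁆) = ∑ y, κ ⁅t, b x⁆ (b y) • vec (rhoV M j (b y)) :=
    fun x => (sum_form_basis_smul κ b hb (ExteriorAlgebra.ι ℂ ∘ₗ rhoV M j) ⁅t, b x⁆).symm
  have h2 : ∀ x, vec (rhoV M j (f ⁅t, b x⁆)) =
      ∑ y, κ ⁅t, b x⁆ (b y) • vec (rhoV M j (f (b y))) :=
    fun x => (sum_form_basis_smul κ b hb (ExteriorAlgebra.ι ℂ ∘ₗ rhoV M j ∘ₗ f) ⁅t, b x⁆).symm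
  simp only [h1, h2, Finset.sum_mul, Finset.mul_sum, smul_mul_assoc, mul_smul_comm]
  rw [Finset.sum_comm, ← Finset.sum_neg_distrib]
  refine Finset.sum_congr rfl fun x _ => ?_
  rw [← Finset.sum_neg_distrib]
  refine Finset.sum_congr rfl fun y _ => ?_
  rw [form_lie_antisymm κ hs hκ, neg_smul]

include hs hκ hb in
-- The gluon operator is an adjoint vector: for the term `μ s·ρ` this is immediate, and for the
-- bilinear it follows from invariance of `∑ b_x ⊗ b_x` and Jacobi.
theorem adDerivation_gluonOp (i j : Fin n) (t s : 𝔤) (m : M) :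
    adDerivation M κ σ b i t (evenVal (gluonOp κ b j s m)) =
      (σ i - σ j)⁻¹ • evenVal (gluonOp κ b j ⁅t, s⁆ m) := by
  have h := sum_vec_lie_mul (M := M) κ hs hκ b hb j t (LieAlgebra.ad ℂ 𝔤 s : 𝔤 →ₗ[ℂ] 𝔤)
  simp only [LieAlgebra.ad_apply] at h
  rw [evenVal_gluonOp, evenVal_gluonOp, map_add, adDerivation_vec_mul_vec κ hs σ b hb,
    adVector_psiV, adVector_rhoV, evenVal_rhoCurrent κ b hb, evenVal_rhoCurrent κ b hb, map_smul,
    map_sum]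
  simp only [adDerivation_vec_mul_vec κ hs σ b hb, adVector_rhoV, map_zero, zero_mul, zero_add,
    map_smul, mul_smul_comm, smul_mul_assoc, Finset.sum_add_distrib, ← Finset.smul_sum, h, lie_lie,
    map_sub, mul_sub, Finset.sum_sub_distrib]
  module

include hb hs hκ in
-- Only the bilinear can absorb two contractions at the same puncture, and it leaves two structure
-- constants: the level form with the sign opposite to that of `j`.
theorem pairContr_gluonOp_mul (j : Fin n) (t s : 𝔤) (m : M)
    (x : ExteriorAlgebra ℂ (FermionSpace M 𝔤 n)) (hx : ∀ r, contr (rhoDual M κ j r) x = 0) :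
    pairContr M κ b t j j (evenVal (gluonOp κ b j s m) * x) = (-2 * level κ b t s) • x := by
  have h : ∀ y z, κ ⁅t, b y⁆ (b z) • contr (rhoDual M κ j (b z)) (contr (rhoDual M κ j (b y))
      (evenVal (gluonOp κ b j s m) * x)) = (-(κ ⁅t, b y⁆ (b z) * κ ⁅s, b y⁆ (b z))) • x := by
    intro y z
    rw [contr_even_mul, contr_gluonOp κ hκ b hb, hx, mul_zero, add_zero, sub_mul, smul_mul_assoc,
      map_sub, map_smul, contr_vec_mul, contr_vec_mul, rhoDual_psiV, rhoDual_rhoV, hx, mul_zero,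
      mul_zero, zero_smul, sub_zero, sub_zero, smul_zero, sub_zero, smul_smul,
      ← lie_skew (b y) s, map_neg, hs (b z), mul_neg]
  rw [pairContr_apply]
  simp only [h, ← Finset.sum_smul, level, Finset.sum_neg_distrib]
  congr 1
  ring

variable (t : Fin n → 𝔤) (μ : Fin n → M)

include hκ hb in
theorem contr_prod_gluonOp {A : Finset (Fin n)} {k : Fin n} (hk : k ∈ A) (s : 𝔤) :
    contr (rhoDual M κ k s) (evenVal (∏ j ∈ A, gluonOp κ b j (t j) (μ j))) =
      (vec (rhoV M k ⁅s, t k⁆) - κ s (t k) • vec (psiV M 𝔤 n (μ k))) *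
        evenVal (∏ j ∈ A.erase k, gluonOp κ b j (t j) (μ j)) := by
  rw [contr_prod, Finset.sum_eq_single_of_mem k hk fun j _ hj => ?_, contr_gluonOp κ hκ b hb]
  rw [contr_gluonOp_of_ne κ b hb hj.symm, zero_mul]

include hb in
theorem contr_prod_gluonOp_of_notMem {A : Finset (Fin n)} {k : Fin n} (hk : k ∉ A) (s : 𝔤) :
    contr (rhoDual M κ k s) (evenVal (∏ j ∈ A, gluonOp κ b j (t j) (μ j))) = 0 := by
  rw [contr_prod]
  refine Finset.sum_eq_zero fun j hj => ?_
  rw [contr_gluonOp_of_ne κ b hb fun h : k = j => hk (by rwa [h]), zero_mul]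

theorem gluonOp_add (j : Fin n) (s : 𝔤) (m m' : M) :
    gluonOp κ b j s (m + m') = vec₂ (psiV M 𝔤 n m) (rhoV M j s) + gluonOp κ b j s m' := by
  rw [gluonOp, gluonOp, map_add, vec₂_add_left, add_assoc]

include hs hκ hb in
/-- The Ward identity for the gluon operators. -/
theorem rhoWick_gluonOp_mul (hσ : Function.Injective σ) {A : Finset (Fin n)} {i : Fin n}
    (hi : i ∉ A) :
    rhoWick κ hs σ (evenVal (gluonOp κ b i (t i) (μ i) * ∏ j ∈ A, gluonOp κ b j (t j) (μ j))) =
      ∑ k ∈ A, ((σ i - σ k)⁻¹ • rhoWick κ hs σ (evenVal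
          ((gluonOp κ b k ⁅t i, t k⁆ (μ i + μ k) -
            κ (t i) (t k) • vec₂ (psiV M 𝔤 n (μ i)) (psiV M 𝔤 n (μ k))) *
          ∏ j ∈ A.erase k, gluonOp κ b j (t j) (μ j))) -
        ((σ i - σ k)⁻¹ ^ 2 * level κ b (t i) (t k)) • rhoWick κ hs σ (evenVal
          (∏ j ∈ A.erase k, gluonOp κ b j (t j) (μ j)))) := by
  have h0 := fun s => contr_prod_gluonOp_of_notMem κ b hb t μ hi s
  have h1 : ∀ k ∉ A, contr (rhoDual M κ k (t i)) (evenVal (∏ j ∈ A, gluonOp κ b j (t j) (μ j))) = 0 :=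
    fun k hk => contr_prod_gluonOp_of_notMem κ b hb t μ hk _
  have h2 : ∀ k ∉ A, pairContr M κ b (t i) k k
      (evenVal (∏ j ∈ A, gluonOp κ b j (t j) (μ j))) = 0 := fun k hk => by
    simp [pairContr_apply, contr_prod_gluonOp_of_notMem κ b hb t μ hk]
  have h3 : ∀ k ∈ A, pairContr M κ b (t i) k k (evenVal (∏ j ∈ A, gluonOp κ b j (t j) (μ j))) =
      (-2 * level κ b (t i) (t k)) • evenVal (∏ j ∈ A.erase k, gluonOp κ b j (t j) (μ j)) := by
    intro k hk
    rw [← Finset.mul_prod_erase A _ hk, map_mul]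
    exact pairContr_gluonOp_mul κ hs hκ b hb k _ _ _ _
      fun r => contr_prod_gluonOp_of_notMem κ b hb t μ (Finset.notMem_erase k A) r
  have h4 : ∀ k, evenVal ((gluonOp κ b k ⁅t i, t k⁆ (μ i + μ k) -
      κ (t i) (t k) • vec₂ (psiV M 𝔤 n (μ i)) (psiV M 𝔤 n (μ k))) *
        ∏ j ∈ A.erase k, gluonOp κ b j (t j) (μ j)) =
      (vec (psiV M 𝔤 n (μ i)) * vec (rhoV M k ⁅t i, t k⁆) +
        evenVal (gluonOp κ b k ⁅t i, t k⁆ (μ k)) - κ (t i) (t k) •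
          (vec (psiV M 𝔤 n (μ i)) * vec (psiV M 𝔤 n (μ k)))) *
        evenVal (∏ j ∈ A.erase k, gluonOp κ b j (t j) (μ j)) := fun k => by
    rw [gluonOp_add, map_mul, map_sub, evenVal_add, map_smul, evenVal_vec₂, evenVal_vec₂]
  -- Contracting `ρ` in `μ_i t_i·ρ` gives the momentum shift and the term with `κ(t_i, t_k)`. The
  -- bilinear at `i` gives the rotated operator at `k` from its simple poles and the level term from
  -- its double poles.
  rw [map_mul, evenVal_gluonOp, add_mul, map_add, mul_assoc, rhoWick_psiV_mul, rhoWick_rhoV_mul,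
    rhoWick_rhoCurrent_mul_eq κ hs hκ σ b hb hσ i _ _ h0,
    derivation_prod _ (adDerivation_even_mul κ σ b i (t i)),
    ← Finset.sum_subset (Finset.subset_univ A) fun k _ hk => by rw [h1 k hk, map_zero, smul_zero],
    ← Finset.sum_subset (Finset.subset_univ A) fun k _ hk => by rw [h2 k hk, map_zero, smul_zero],
    map_sum, Finset.mul_sum, Finset.smul_sum, ← add_assoc, ← Finset.sum_add_distrib,
    ← Finset.sum_add_distrib]
  refine Finset.sum_congr rfl fun k hk => ?_
  rw [contr_prod_gluonOp κ hκ b hb t μ hk, adDerivation_gluonOp κ hs hκ σ b hb, h3 k hk,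
    h4 k]
  simp only [sub_mul, add_mul, smul_mul_assoc, map_sub, map_add, map_smul, mul_assoc,
    rhoWick_psiV_mul, mul_sub, mul_smul_comm]
  module

end Ward
end EYM
end

noncomputable section
namespace EYM

/-! ### Gluon correlators -/

section Currents

variable {𝔤 : Type*} [LieRing 𝔤] {n : ℕ}

theorem sort_erase {α : Type*} [LinearOrder α] (s : Finset α) (a : α) :
    (s.erase a).sort = s.sort.erase a := by
  have h1 : (s.sort.erase a).Nodup := (s.sort_nodup (· ≤ ·)).erase a
  have h2 : (s.sort.erase a).toFinset = s.erase a := by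
    ext x
    simp [(s.sort_nodup (· ≤ ·)).mem_erase_iff]
  rw [← h2, List.toFinset_sort _ h1]
  exact (s.pairwise_sort (· ≤ ·)).sublist List.erase_sublist

/-- The correlator of the currents `t_j·j(σ_j)`, `j ∈ U`. -/
def currentsOn (ℓ : 𝔤 → 𝔤 → ℂ) (σ : Fin n → ℂ) (t : Fin n → 𝔤) (U : Finset (Fin n)) : ℂ :=
  currentCorrelator ℓ σ (U.sort.map fun j => (j, t j))

theorem currentsOn_congr (ℓ : 𝔤 → 𝔤 → ℂ) (σ : Fin n → ℂ) {t t' : Fin n → 𝔤}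
    {U : Finset (Fin n)} (h : ∀ j ∈ U, t j = t' j) :
    currentsOn ℓ σ t U = currentsOn ℓ σ t' U := by
  rw [currentsOn, currentsOn]
  congr 1
  exact List.map_congr_left fun j hj => by rw [h j ((Finset.mem_sort _).1 hj)]

theorem currentsOn_empty (ℓ : 𝔤 → 𝔤 → ℂ) (σ : Fin n → ℂ) (t : Fin n → 𝔤) :
    currentsOn ℓ σ t ∅ = 1 := by
  simp [currentsOn, currentCorrelator]

/-- Since `i` is the smallest label it heads the sorted list, which is where the definition of the
current correlator expands. -/
theorem currentsOn_insert (ℓ : 𝔤 → 𝔤 → ℂ) (σ : Fin n → ℂ) (t : Fin n → 𝔤)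
    {U : Finset (Fin n)} {i : Fin n} (hi : ∀ j ∈ U, i < j) :
    currentsOn ℓ σ t (insert i U) =
      ∑ j ∈ U, ((σ i - σ j)⁻¹ ^ 2 * ℓ (t i) (t j) * currentsOn ℓ σ t (U.erase j) +
        (σ i - σ j)⁻¹ * currentsOn ℓ σ (adAt t (t i) j) U) := by
  rw [currentsOn, Finset.sort_insert _ (fun j hj => (hi j hj).le) fun h => lt_irrefl _ (hi i h),
    List.map_cons, currentCorrelator]
  have hN := U.sort_nodup (· ≤ ·)
  refine Finset.sum_bij
    (fun (p : Fin (U.sort.map fun j => (j, t j)).length) _ => U.sort[(p : ℕ)]'(by simpa using p.2))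
    ?_ ?_ ?_ ?_
  · intro p _
    exact (Finset.mem_sort (· ≤ ·)).1 (List.getElem_mem _)
  · intro p _ q _ h
    exact Fin.ext ((hN.getElem_inj_iff).1 h)
  · intro j hj
    obtain ⟨p, hp, rfl⟩ := List.getElem_of_mem ((Finset.mem_sort (· ≤ ·)).2 hj)
    exact ⟨⟨p, by simpa using hp⟩, Finset.mem_univ _, rfl⟩
  · intro p _
    have hp : (p : ℕ) < U.sort.length := by simpa using p.2
    simp only [Fin.getElem_fin, List.getElem_map]
    have e1 : (U.sort.map fun j => (j, t j)).eraseIdx p =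
        (U.erase U.sort[(p : ℕ)]).sort.map fun j => (j, t j) := by
      rw [sort_erase, List.eraseIdx_map, hN.erase_getElem]
    have e2 : (U.sort.map fun j => (j, t j)).set p (U.sort[(p : ℕ)], ⁅t i, t U.sort[(p : ℕ)]⁆) =
        U.sort.map fun j => (j, adAt t (t i) U.sort[(p : ℕ)] j) := by
      refine List.ext_getElem (by simp) fun q hq hq' => ?_
      rw [List.getElem_set]
      split_ifs with h
      · subst h
        simp [adAt_self]
      · have : U.sort[q]'(by simpa using hq') ≠ U.sort[(p : ℕ)] :=
          fun h' => h ((hN.getElem_inj_iff).1 h').symm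
        simp [adAt_of_ne _ _ this]
    rw [e1, e2, currentsOn, currentsOn, one_div, div_eq_inv_mul, inv_pow]

end Currents

section Powerset

variable {ι A : Type*} [DecidableEq ι] [AddCommMonoid A]

theorem sum_powerset_sdiff (g : Finset ι) (f : Finset ι → ι → A) :
    ∑ U ∈ g.powerset, ∑ k ∈ g \ U, f U k = ∑ k ∈ g, ∑ U ∈ (g.erase k).powerset, f U k := by
  refine Finset.sum_comm' fun U k => ?_
  simp only [Finset.mem_powerset, Finset.mem_sdiff, Finset.subset_erase]
  tauto

theorem sum_powerset_mem (g : Finset ι) (f : Finset ι → ι → A) :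
    ∑ U ∈ g.powerset, ∑ k ∈ U, f U k =
      ∑ k ∈ g, ∑ U ∈ (g.erase k).powerset, f (insert k U) k := by
  rw [Finset.sum_comm' (t' := g) (s' := fun k => g.powerset.filter (k ∈ ·)) fun U k => by
    simp only [Finset.mem_powerset, Finset.mem_filter]
    exact ⟨fun h => ⟨h, h.1 h.2⟩, fun h => h.1⟩]
  refine Finset.sum_congr rfl fun k hk => ?_
  symm
  refine Finset.sum_bij (fun U _ => insert k U) ?_ ?_ ?_ ?_
  · intro U hU
    simp only [Finset.mem_powerset, Finset.mem_filter, Finset.subset_erase] at hU ⊢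
    exact ⟨Finset.insert_subset hk hU.1, Finset.mem_insert_self k U⟩
  · intro U hU U' hU' h
    simp only [Finset.mem_powerset, Finset.subset_erase] at hU hU'
    rw [← Finset.erase_insert hU.2, h, Finset.erase_insert hU'.2]
  · intro U hU
    simp only [Finset.mem_powerset, Finset.mem_filter] at hU
    exact ⟨U.erase k, Finset.mem_powerset.2 (Finset.erase_subset_erase k hU.1),
      Finset.insert_erase hU.2⟩
  · intros; rfl

end Powerset

section Full

variable {V 𝔤 M : Type*} [LieRing 𝔤] [LieAlgebra ℂ 𝔤] {n N : ℕ} [AddCommGroup M] [Module ℂ M]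
  (κ : LinearMap.BilinForm ℂ 𝔤) (hs : ∀ x y, κ x y = κ y x)
  (hκ : ∀ x y z, κ ⁅x, y⁆ z = κ x ⁅y, z⁆) (σ : Fin n → ℂ)
  (b : Module.Basis (Fin N) ℂ 𝔤) (hb : ∀ x y, κ (b x) (b y) = if x = y then 1 else 0)

/-- `⟨∏_{j ∈ A} (μ_j t_j·ρ - ½ f t_j ρ ρ)⟩` with the fermions `ρ` integrated out. -/
def rhoOn (t : Fin n → 𝔤) (μ : Fin n → M) (A : Finset (Fin n)) : ExteriorAlgebra ℂ M :=
  rhoWick κ hs σ (evenVal (∏ j ∈ A, gluonOp κ b j (t j) (μ j)))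

theorem rhoOn_congr {t t' : Fin n → 𝔤} {μ μ' : Fin n → M} {A : Finset (Fin n)}
    (h : ∀ j ∈ A, t j = t' j) (h' : ∀ j ∈ A, μ j = μ' j) :
    rhoOn κ hs σ b t μ A = rhoOn κ hs σ b t' μ' A := by
  rw [rhoOn, rhoOn, Finset.prod_congr rfl fun j hj => by rw [h j hj, h' j hj]]

include hκ hb in
theorem rhoOn_insert (hσ : Function.Injective σ) (t : Fin n → 𝔤) (μ : Fin n → M)
    {A : Finset (Fin n)} {i : Fin n} (hi : i ∉ A) :
    rhoOn κ hs σ b t μ (insert i A) = ∑ k ∈ A, ((σ i - σ k)⁻¹ •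
      (rhoOn κ hs σ b (adAt t (t i) k) (absorb μ i k) A -
        κ (t i) (t k) • (evenVal (vec₂ (μ i) (μ k)) * rhoOn κ hs σ b t μ (A.erase k))) -
      ((σ i - σ k)⁻¹ ^ 2 * level κ b (t i) (t k)) • rhoOn κ hs σ b t μ (A.erase k)) := by
  rw [rhoOn, Finset.prod_insert hi, rhoWick_gluonOp_mul κ hs hκ σ b hb t μ hσ hi]
  refine Finset.sum_congr rfl fun k hk => ?_
  have h1 : gluonOp κ b k ⁅t i, t k⁆ (μ i + μ k) * ∏ j ∈ A.erase k, gluonOp κ b j (t j) (μ j) =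
      ∏ j ∈ A, gluonOp κ b j (adAt t (t i) k j) (absorb μ i k j) := by
    rw [← Finset.mul_prod_erase A _ hk, adAt_self, absorb_self]
    congr 1
    refine Finset.prod_congr rfl fun j hj => ?_
    rw [adAt_of_ne _ _ (Finset.ne_of_mem_erase hj), absorb_of_ne _ _ (Finset.ne_of_mem_erase hj)]
  rw [sub_mul, h1, smul_mul_assoc, map_sub, map_sub, map_smul, map_smul, map_mul, evenVal_vec₂,
    evenVal_vec₂, mul_assoc, mul_assoc, rhoWick_psiV_mul, rhoWick_psiV_mul]
  rfl

/-- The correlator of the integrated gluon operators, `Ψ` not yet contracted. -/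
def gluonCorrelator (t : Fin n → 𝔤) (μ : Fin n → M) (g : Finset (Fin n)) : ExteriorAlgebra ℂ M :=
  ∑ U ∈ g.powerset, currentsOn (level κ b) σ t U • rhoOn κ hs σ b t μ (g \ U)

include hκ hb in
-- If the fermion part is chosen at `i`, it acts on a `k` of the same kind, giving the double pole
-- with `-level`; if the current is chosen, it acts on another current with `+level`. After removal
-- of `i` and `k` the double poles range over the same configurations and cancel. The simple poles
-- combine into the action on the full operator at `k`.
theorem gluonCorrelator_insert (hσ : Function.Injective σ) (t : Fin n → 𝔤) (μ : Fin n → M)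
    {g : Finset (Fin n)} {i : Fin n} (hi : ∀ j ∈ g, i < j) :
    gluonCorrelator κ hs σ b t μ (insert i g) = ∑ k ∈ g, (σ i - σ k)⁻¹ •
      (gluonCorrelator κ hs σ b (adAt t (t i) k) (absorb μ i k) g -
        κ (t i) (t k) • (evenVal (vec₂ (μ i) (μ k)) *
          gluonCorrelator κ hs σ b t μ (g.erase k))) := by
  have hig : i ∉ g := fun h => lt_irrefl _ (hi i h)
  have e1 : ∀ U ∈ g.powerset, currentsOn (level κ b) σ t U •
      rhoOn κ hs σ b t μ (insert i g \ U) = ∑ k ∈ g \ U, ((σ i - σ k)⁻¹ •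
        (currentsOn (level κ b) σ (adAt t (t i) k) U •
            rhoOn κ hs σ b (adAt t (t i) k) (absorb μ i k) (g \ U)) +
        (-((σ i - σ k)⁻¹ * κ (t i) (t k)) • (evenVal (vec₂ (μ i) (μ k)) *
          (currentsOn (level κ b) σ t U • rhoOn κ hs σ b t μ (g.erase k \ U))) +
        (-((σ i - σ k)⁻¹ ^ 2 * level κ b (t i) (t k))) •
          (currentsOn (level κ b) σ t U • rhoOn κ hs σ b t μ (g.erase k \ U)))) := by
    intro U hU
    rw [Finset.mem_powerset] at hU
    rw [Finset.insert_sdiff_of_notMem _ fun h => hig (hU h),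
      rhoOn_insert κ hs hκ σ b hb hσ t μ fun h => hig (Finset.sdiff_subset h), Finset.smul_sum]
    refine Finset.sum_congr rfl fun k hk => ?_
    have hkU := (Finset.mem_sdiff.1 hk).2
    rw [currentsOn_congr _ σ (t := adAt t (t i) k) (t' := t) fun j hj =>
      adAt_of_ne _ _ fun h => hkU (h ▸ hj), ← Finset.erase_sdiff_comm, mul_smul_comm]
    module
  -- Here `i` is among the currents, so `k` runs over `U`; in `e1` it runs over the complement. `e3`
  -- joins the two ranges for the simple poles.
  have e2 : ∀ U ∈ g.powerset, currentsOn (level κ b) σ t (insert i U) •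
      rhoOn κ hs σ b t μ (insert i g \ insert i U) = ∑ k ∈ U, ((σ i - σ k)⁻¹ •
        (currentsOn (level κ b) σ (adAt t (t i) k) U •
            rhoOn κ hs σ b (adAt t (t i) k) (absorb μ i k) (g \ U)) +
        ((σ i - σ k)⁻¹ ^ 2 * level κ b (t i) (t k)) •
          (currentsOn (level κ b) σ t (U.erase k) • rhoOn κ hs σ b t μ (g \ U))) := by
    intro U hU
    rw [Finset.mem_powerset] at hU
    rw [Finset.insert_sdiff_insert, Finset.sdiff_insert_of_notMem hig,
      currentsOn_insert _ σ t fun j hj => hi j (hU hj), Finset.sum_smul]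
    refine Finset.sum_congr rfl fun k hk => ?_
    rw [rhoOn_congr κ hs σ b (t := adAt t (t i) k) (t' := t) (μ := absorb μ i k) (μ' := μ)
      (fun j hj => adAt_of_ne _ _ fun h => (Finset.mem_sdiff.1 hj).2 (h ▸ hk))
      (fun j hj => absorb_of_ne _ _ fun h => (Finset.mem_sdiff.1 hj).2 (h ▸ hk))]
    module
  have e3 : ∀ f : Finset (Fin n) → Fin n → ExteriorAlgebra ℂ M,
      ∑ U ∈ g.powerset, ∑ k ∈ g \ U, f U k + ∑ U ∈ g.powerset, ∑ k ∈ U, f U k =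
        ∑ k ∈ g, ∑ U ∈ g.powerset, f U k := by
    intro f
    rw [← Finset.sum_add_distrib, Finset.sum_comm]
    exact Finset.sum_congr rfl fun U hU => Finset.sum_sdiff (Finset.mem_powerset.1 hU)
  have e4 : ∑ k ∈ g, ∑ U ∈ (g.erase k).powerset, ((σ i - σ k)⁻¹ ^ 2 * level κ b (t i) (t k)) •
          (currentsOn (level κ b) σ t ((insert k U).erase k) •
            rhoOn κ hs σ b t μ (g \ insert k U)) =
      ∑ k ∈ g, ∑ U ∈ (g.erase k).powerset, ((σ i - σ k)⁻¹ ^ 2 * level κ b (t i) (t k)) •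
          (currentsOn (level κ b) σ t U • rhoOn κ hs σ b t μ (g.erase k \ U)) := by
    refine Finset.sum_congr rfl fun k hk => Finset.sum_congr rfl fun U hU => ?_
    rw [Finset.erase_insert (Finset.subset_erase.1 (Finset.mem_powerset.1 hU)).2,
      Finset.sdiff_insert, Finset.erase_sdiff_comm]
  rw [gluonCorrelator, Finset.sum_powerset_insert hig, Finset.sum_congr rfl e1,
    Finset.sum_congr rfl e2]
  simp only [Finset.sum_add_distrib]
  rw [sum_powerset_sdiff g fun U k => -((σ i - σ k)⁻¹ * κ (t i) (t k)) • _,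
    sum_powerset_sdiff g fun U k => (-((σ i - σ k)⁻¹ ^ 2 * level κ b (t i) (t k))) • _,
    sum_powerset_mem g fun U k => ((σ i - σ k)⁻¹ ^ 2 * level κ b (t i) (t k)) • _, e4,
    add_add_add_comm, e3]
  simp only [gluonCorrelator, neg_smul, Finset.sum_neg_distrib, smul_sub, Finset.smul_sum,
    Finset.mul_sum, Finset.sum_sub_distrib, mul_smul]
  abel

include hκ hb in
-- Correlator and partition sum obey the same recursion and are `1` on the empty set. The smallest
-- label is removed, as the ordered current correlator demands.
theorem gluonCorrelator_eq (D : ExternalData V 𝔤 n) (hσ : Function.Injective D.pos)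
    (t : Fin n → 𝔤) (μ : Fin n → M) (g : Finset (Fin n)) :
    gluonCorrelator κ hs D.pos b t μ g = evenVal (partitionSum (traceTerm κ D t μ) g) := by
  induction h : g.card using Nat.strong_induction_on generalizing g t μ with
  | _ m ih =>
    rcases g.eq_empty_or_nonempty with rfl | hg
    · rw [partitionSum_empty, gluonCorrelator, Finset.powerset_empty, Finset.sum_singleton,
        currentsOn_empty, one_smul, rhoOn, Finset.sdiff_empty, Finset.prod_empty, map_one, rhoWick_one,
        map_one]
    · have h1 := Finset.insert_erase (g.min'_mem hg)
      have h2 : (g.erase (g.min' hg)).card < m := h ▸ Finset.card_erase_lt_of_mem (g.min'_mem hg)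
      rw [← h1, gluonCorrelator_insert κ hs hκ D.pos b hb hσ t μ
        fun j hj => g.min'_lt_of_mem_erase_min' hg hj,
        traceSum_insert κ hκ hs D hσ t μ (Finset.notMem_erase _ _), map_sum]
      refine Finset.sum_congr rfl fun j hj => ?_
      rw [ih _ h2 _ _ _ rfl, ih _ ((Finset.card_erase_le).trans_lt h2) _ _ _ rfl, map_smul, map_sub,
        map_smul, map_mul]

end Full
end EYM
end

noncomputable section
namespace EYM

/-! ### Expansion of the matter correlator -/

section ArrayForm

variable {R : Type*}

/-- The bilinear form with the given array. -/
def arrayForm (K : R → R → ℂ) : LinearMap.BilinForm ℂ (R →₀ ℂ) :=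
  Finsupp.linearCombination ℂ fun r => Finsupp.linearCombination ℂ (K r)

theorem arrayForm_single (K : R → R → ℂ) (r s : R) :
    arrayForm K (Finsupp.single r 1) (Finsupp.single s 1) = K r s := by
  simp [arrayForm]

theorem arrayForm_isAlt {K : R → R → ℂ} (hK : ∀ r s, K r s = -K s r) : (arrayForm K).IsAlt := by
  intro x
  have h : arrayForm K = -(arrayForm K).flip := by
    refine Finsupp.lhom_ext' fun r => LinearMap.ext_ring (Finsupp.lhom_ext' fun s =>
      LinearMap.ext_ring ?_)
    change arrayForm K (Finsupp.single r 1) (Finsupp.single s 1) =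
      -arrayForm K (Finsupp.single s 1) (Finsupp.single r 1)
    rw [arrayForm_single, arrayForm_single, hK]
  exact self_eq_neg.1 (LinearMap.congr_fun₂ h x x)

theorem arrayForm_add (K K' : R → R → ℂ) :
    arrayForm (fun r s => K r s + K' r s) = arrayForm K + arrayForm K' := by
  refine Finsupp.lhom_ext' fun r => LinearMap.ext_ring (Finsupp.lhom_ext' fun s =>
    LinearMap.ext_ring ?_)
  change arrayForm _ (Finsupp.single r 1) (Finsupp.single s 1) =
    arrayForm K (Finsupp.single r 1) (Finsupp.single s 1) +
      arrayForm K' (Finsupp.single r 1) (Finsupp.single s 1)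
  simp only [arrayForm_single]

/-- The pullback satisfies Wick's recursion for the pulled-back form, and the recursion determines
the functional. -/
theorem wick_map {M N : Type*} [AddCommGroup M] [Module ℂ M] [AddCommGroup N] [Module ℂ N]
    {B : LinearMap.BilinForm ℂ N} (hB : B.IsAlt) (f : M →ₗ[ℂ] N) {B' : LinearMap.BilinForm ℂ M}
    (hB' : B'.IsAlt) (h : ∀ x y, B' x y = B (f x) (f y)) (x : ExteriorAlgebra ℂ M) :
    wick hB (ExteriorAlgebra.map f x) = wick hB' x := by
  refine eq_wick hB' (wick hB ∘ₗ (ExteriorAlgebra.map f).toLinearMap) ?_ (fun v y => ?_) x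
  · simp [wick_one]
  · have : B (f v) ∘ₗ f = B' v := LinearMap.ext fun y => (h v y).symm
    simp only [LinearMap.comp_apply, AlgHom.toLinearMap_apply, map_mul, ExteriorAlgebra.map_apply_ι]
    rw [wick_vec_mul, contr_map, this]

end ArrayForm

section Matter

variable {V 𝔤 : Type*} [AddCommGroup V] [Module ℂ V] [LieRing 𝔤] [LieAlgebra ℂ 𝔤] {N n : ℕ}

/-- The fermion `w` at the puncture `i`. -/
def fermionAt (x : Fin n × Fermion V 𝔤) : Fin n → Fermion V 𝔤 := Pi.single x.1 x.2

/-- The propagator of the fermions. -/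
def fermionForm (η : LinearMap.BilinForm ℂ V) (κ : LinearMap.BilinForm ℂ 𝔤) (σ : Fin n → ℂ) :
    LinearMap.BilinForm ℂ (Fin n → Fermion V 𝔤) :=
  ∑ i, ∑ j, (σ i - σ j)⁻¹ •
    (η.compl₁₂ (LinearMap.fst ℂ V 𝔤 ∘ₗ LinearMap.proj i) (LinearMap.fst ℂ V 𝔤 ∘ₗ LinearMap.proj j) +
      κ.compl₁₂ (LinearMap.snd ℂ V 𝔤 ∘ₗ LinearMap.proj i) (LinearMap.snd ℂ V 𝔤 ∘ₗ LinearMap.proj j))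

theorem fermionForm_apply (η : LinearMap.BilinForm ℂ V) (κ : LinearMap.BilinForm ℂ 𝔤)
    (σ : Fin n → ℂ) (f g : Fin n → Fermion V 𝔤) :
    fermionForm η κ σ f g =
      ∑ i, ∑ j, (σ i - σ j)⁻¹ * (η (f i).1 (g j).1 + κ (f i).2 (g j).2) := by
  simp [fermionForm, LinearMap.sum_apply, mul_add]

variable (η : LinearMap.BilinForm ℂ V) (hη : ∀ x y, η x y = η y x) (κ : LinearMap.BilinForm ℂ 𝔤)
  (hs : ∀ x y, κ x y = κ y x) (σ : Fin n → ℂ) (b : Module.Basis (Fin N) ℂ 𝔤)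

include hη hs in
theorem fermionForm_isAlt : (fermionForm η κ σ).IsAlt := by
  intro f
  rw [fermionForm_apply]
  refine self_eq_neg.1 ?_
  conv_lhs => rw [Finset.sum_comm]
  simp only [← Finset.sum_neg_distrib]
  refine Finset.sum_congr rfl fun j _ => Finset.sum_congr rfl fun k _ => ?_
  rw [hη, hs, ← neg_sub (σ j), inv_neg, neg_mul]

/-- The case distinction for equal punctures is absorbed by `0⁻¹ = 0`, so the contraction is an
honest bilinear form. -/
theorem fermionForm_fermionAt (x y : Fin n × Fermion V 𝔤) :
    contraction η κ σ x y = fermionForm η κ σ (fermionAt x) (fermionAt y) := by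
  rw [fermionForm_apply, Finset.sum_eq_single x.1, Finset.sum_eq_single y.1]
  · simp only [fermionAt, Pi.single_eq_same, contraction]
    split_ifs with h
    · simp [h]
    · rw [div_eq_inv_mul]
  · intro j _ hj
    simp [fermionAt, Pi.single_eq_of_ne hj]
  · simp
  · intro j _ hj
    simp [fermionAt, Pi.single_eq_of_ne hj]
  · simp

/-- The fermion part of a local operator without currents. -/
def operatorVal (i : Fin n) (O : LocalOperator V 𝔤) : ExteriorAlgebra ℂ (Fin n → Fermion V 𝔤) :=
  (O.map fun m => m.coeff • (m.fermions.map fun w => vec (fermionAt (i, w))).prod).sum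

/-- `U` is the set of labels at which the monomial `t·j` is chosen; at the others the current-free
operators multiply. `S` marks the operators that have such a monomial. Fermions and currents already
read are arbitrary, so that the induction goes through. -/
theorem matterCorrelator_eq (S : Finset (Fin n)) (t : Fin n → 𝔤)
    (O op : Fin n → LocalOperator V 𝔤) (hO : ∀ i, ∀ m ∈ O i, m.currents = [])
    (hop : ∀ i, (op i).Perm (if i ∈ S then ⟨1, [], [t i]⟩ :: O i else O i))
    (l : List (Fin n)) (hl : l.Nodup) (Φ : List (Fin n × Fermion V 𝔤)) (J : List (Fin n × 𝔤)) :
    matterCorrelator η κ b σ (l.map fun i => (i, op i)) Φ J =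
      ∑ U ∈ (l.toFinset ∩ S).powerset,
        currentCorrelator (level κ b) σ (J ++ (l.filter (· ∈ U)).map fun i => (i, t i)) *
          wick (fermionForm_isAlt η hη κ hs σ) ((Φ.map fun x => vec (fermionAt x)).prod *
            ((l.filter (· ∉ U)).map fun i => operatorVal i (O i)).prod) := by
  induction l generalizing Φ J with
  | nil =>
    simp only [List.map_nil, matterCorrelator, fermionCorrelator, List.toFinset_nil,
      Finset.empty_inter, Finset.powerset_empty, Finset.sum_singleton, List.filter_nil,
      List.append_nil, List.prod_nil, mul_one]
    rw [pfaffian_eq_wick (fermionForm_isAlt η hη κ hs σ) fermionAt _ _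
      fun x _ y _ => fermionForm_fermionAt η κ σ x y, mul_comm]
  | cons i l ih =>
    have hil : i ∉ l := (List.nodup_cons.1 hl).1
    replace ih := ih (List.nodup_cons.1 hl).2
    set X := (Φ.map fun x => vec (fermionAt x)).prod with hX
    -- The remaining correlator as a linear function of the operator at `i`; linearity turns the sum
    -- over monomials into its value on `operatorVal`.
    let lin : ExteriorAlgebra ℂ (Fin n → Fermion V 𝔤) →ₗ[ℂ] ℂ :=
      ∑ U ∈ (l.toFinset ∩ S).powerset,
        currentCorrelator (level κ b) σ (J ++ (l.filter (· ∈ U)).map fun i => (i, t i)) •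
          (wick (fermionForm_isAlt η hη κ hs σ) ∘ₗ LinearMap.mulLeft ℂ X ∘ₗ LinearMap.mulRight ℂ
            ((l.filter (· ∉ U)).map fun i => operatorVal i (O i)).prod)
    have hlin : ∀ y, lin y = ∑ U ∈ (l.toFinset ∩ S).powerset,
        currentCorrelator (level κ b) σ (J ++ (l.filter (· ∈ U)).map fun i => (i, t i)) *
          wick (fermionForm_isAlt η hη κ hs σ)
            (X * (y * ((l.filter (· ∉ U)).map fun i => operatorVal i (O i)).prod)) := by
      intro y
      simp [lin, LinearMap.sum_apply]
    have h1 : ((O i).map fun m => m.coeff * matterCorrelator η κ b σ (l.map fun i => (i, op i))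
        (Φ ++ m.fermions.map fun w => (i, w)) (J ++ m.currents.map fun s => (i, s))).sum =
        lin (operatorVal i (O i)) := by
      rw [operatorVal, map_list_sum, List.map_map]
      congr 1
      refine List.map_congr_left fun m hm => ?_
      rw [Function.comp_apply, map_smul, smul_eq_mul, hlin, hO i m hm, ih]
      simp only [List.map_nil, List.append_nil, List.map_append, List.prod_append, List.map_map,
        mul_assoc, ← hX]
      rfl
    have h2 : ∀ U ⊆ l.toFinset ∩ S, i ∉ U := fun U hU h =>
      hil (List.mem_toFinset.1 (Finset.mem_inter.1 (hU h)).1)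
    have h3 : ∑ U ∈ (l.toFinset ∩ S).powerset, currentCorrelator (level κ b) σ
          (J ++ ((i :: l).filter (· ∈ U)).map fun i => (i, t i)) *
        wick (fermionForm_isAlt η hη κ hs σ) (X *
          (((i :: l).filter (· ∉ U)).map fun i => operatorVal i (O i)).prod) =
        lin (operatorVal i (O i)) := by
      rw [hlin]
      refine Finset.sum_congr rfl fun U hU => ?_
      have := h2 U (Finset.mem_powerset.1 hU)
      rw [List.filter_cons_of_neg (by simpa using this), List.filter_cons_of_pos (by simpa using this),
        List.map_cons, List.prod_cons]
    rw [List.map_cons, matterCorrelator, ((hop i).map _).sum_eq, List.toFinset_cons]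
    by_cases hi : i ∈ S
    · rw [if_pos hi, List.map_cons, List.sum_cons, h1, Finset.insert_inter_of_mem hi,
        Finset.sum_powerset_insert (h2 _ subset_rfl), h3, add_comm]
      congr 1
      rw [one_mul, ih]
      refine Finset.sum_congr rfl fun U hU => ?_
      have hiU := h2 U (Finset.mem_powerset.1 hU)
      have e : ∀ j ∈ l, (j ∈ insert i U ↔ j ∈ U) := fun j hj => by
        rw [Finset.mem_insert, or_iff_right]
        rintro rfl
        exact hil hj
      have e1 : l.filter (· ∈ insert i U) = l.filter (· ∈ U) :=
        List.filter_congr fun j hj => by simp only [e j hj]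
      have e2 : l.filter (· ∉ insert i U) = l.filter (· ∉ U) :=
        List.filter_congr fun j hj => by simp only [e j hj]
      rw [List.filter_cons_of_pos (by simp), List.filter_cons_of_neg (by simp), e1, e2]
      simp [hX]
    · rw [if_neg hi, h1, Finset.insert_inter_of_notMem hi, h3]

end Matter
end EYM
end

noncomputable section
namespace EYM

/-! ### The correlator in the exterior algebra of the rows -/

section Fixed

variable {M : Type*} [AddCommGroup M] [Module ℂ M] {ι : Type*}
  (A : ι → evenPart M) (d : ι → Module.Dual ℂ M)

theorem contr_list_prod_of_notMem {l : List ι} {p : ι} (hp : p ∉ l)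
    (hd : ∀ i j, i ≠ j → contr (d j) (evenVal (A i)) = 0) :
    contr (d p) (evenVal (l.map A).prod) = 0 := by
  induction l with
  | nil => simp
  | cons i l ih =>
    rw [List.mem_cons, not_or] at hp
    rw [List.map_cons, List.prod_cons, map_mul, contr_even_mul, hd i p (Ne.symm hp.1), ih hp.2,
      zero_mul, mul_zero, add_zero]

variable [DecidableEq ι] (F : Finset ι)

/-- The operator at `i`: fixed for `i ∈ F` and integrated otherwise. -/
def fixedOrIntegrated (i : ι) : ExteriorAlgebra ℂ M :=
  if i ∈ F then contr (d i) (evenVal (A i)) else evenVal (A i)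

theorem fixedOrIntegrated_prod_of_filter_nil {l : List ι} (h : l.filter (· ∈ F) = []) :
    (l.map (fixedOrIntegrated A d F)).prod = evenVal (l.map A).prod := by
  rw [map_list_prod, List.map_map]
  congr 1
  refine List.map_congr_left fun i hi => ?_
  have : i ∉ F := by simpa using List.filter_eq_nil_iff.1 h i hi
  rw [fixedOrIntegrated, if_neg this, Function.comp_apply]

variable (hd : ∀ i j, i ≠ j → contr (d j) (evenVal (A i)) = 0)

include hd in
theorem fixedOrIntegrated_prod_of_filter_singleton {l : List ι} {q : ι}
    (h : l.filter (· ∈ F) = [q]) :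
    (l.map (fixedOrIntegrated A d F)).prod = contr (d q) (evenVal (l.map A).prod) := by
  induction l with
  | nil => simp at h
  | cons i l ih =>
    rw [List.map_cons, List.map_cons, List.prod_cons, List.prod_cons, map_mul, contr_even_mul]
    have hq : q ∈ F :=
      of_decide_eq_true (List.mem_filter.1 (by rw [h]; simp : q ∈ (i :: l).filter (· ∈ F))).2
    by_cases hi : i ∈ F
    · rw [List.filter_cons_of_pos (by simpa using hi), List.cons.injEq] at h
      have hql : q ∉ l := fun hl => by simpa [hq] using List.filter_eq_nil_iff.1 h.2 q hl
      rw [fixedOrIntegrated_prod_of_filter_nil A d F h.2, fixedOrIntegrated, if_pos hi,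
        contr_list_prod_of_notMem A d hql hd, h.1, mul_zero, add_zero]
    · rw [List.filter_cons_of_neg (by simpa using hi)] at h
      have : i ≠ q := fun h => hi (h ▸ hq)
      rw [ih h, fixedOrIntegrated, if_neg hi, hd i q this, zero_mul, zero_add]

include hd in
-- Each dual vector sees only its own operator, so the two contractions replace exactly the
-- operators at `p` and `q`. All other factors are even, hence no sign arises.
theorem fixedOrIntegrated_prod_of_filter_pair {l : List ι} {p q : ι} (hl : l.Nodup)
    (h : l.filter (· ∈ F) = [p, q]) :
    (l.map (fixedOrIntegrated A d F)).prod =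
      contr (d p) (contr (d q) (evenVal (l.map A).prod)) := by
  induction l with
  | nil => simp at h
  | cons i l ih =>
    have hp : p ∈ F :=
      of_decide_eq_true (List.mem_filter.1 (by rw [h]; simp : p ∈ (i :: l).filter (· ∈ F))).2
    have hq : q ∈ F :=
      of_decide_eq_true (List.mem_filter.1 (by rw [h]; simp : q ∈ (i :: l).filter (· ∈ F))).2
    have hpq : p ≠ q := by
      have := hl.filter (· ∈ F)
      rw [h] at this
      simpa using this
    rw [List.map_cons, List.map_cons, List.prod_cons, List.prod_cons, map_mul, contr_even_mul,
      map_add, contr_even_mul]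
    by_cases hi : i ∈ F
    · rw [List.filter_cons_of_pos (by simpa using hi), List.cons.injEq] at h
      have hpl : p ∉ l := h.1 ▸ (List.nodup_cons.1 hl).1
      rw [fixedOrIntegrated_prod_of_filter_singleton A d F hd h.2, fixedOrIntegrated, if_pos hi,
        h.1, hd p q hpq, contr_comm (d p), contr_list_prod_of_notMem A d hpl hd]
      simp
    · rw [List.filter_cons_of_neg (by simpa using hi)] at h
      have hip : i ≠ p := fun h => hi (h ▸ hp)
      have hiq : i ≠ q := fun h => hi (h ▸ hq)
      rw [ih (List.nodup_cons.1 hl).2 h, fixedOrIntegrated, if_neg hi, hd i q hiq, hd i p hip]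
      simp

end Fixed

section Rows

variable {V 𝔤 : Type*} [AddCommGroup V] [Module ℂ V] {n : ℕ}

/-- The particle of a row. -/
def rowLabel : Row n → Fin n
  | .mom i => i
  | .pol a => a

/-- The momentum or polarization of a row. -/
def rowVector (D : ExternalData V 𝔤 n) : Row n → V
  | .mom i => D.mom i
  | .pol a => if a ∈ D.gluons then 0 else D.pol a

/-- The array of the contractions of `Ψ` at different punctures. -/
def propagator (η : LinearMap.BilinForm ℂ V) (D : ExternalData V 𝔤 n) (r s : Row n) : ℂ :=
  (D.pos (rowLabel r) - D.pos (rowLabel s))⁻¹ * η (rowVector D r) (rowVector D s)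

/-- The basis vector of the row `mom i`. -/
def momVec (i : Fin n) : Row n →₀ ℂ := Finsupp.single (.mom i) 1

/-- The basis vector of the row `pol a`. -/
def polVec (a : Fin n) : Row n →₀ ℂ := Finsupp.single (.pol a) 1

/-- The coordinate of the row `mom i`. -/
def momDual (i : Fin n) : Module.Dual ℂ (Row n →₀ ℂ) := Finsupp.lapply (.mom i)

theorem momDual_momVec (i : Fin n) : momDual i (momVec i) = 1 := by simp [momDual, momVec]

theorem momDual_momVec_of_ne {i j : Fin n} (h : i ≠ j) : momDual i (momVec j) = 0 := by
  have : Row.mom j ≠ Row.mom i := fun h' => h (Row.mom.inj h').symm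
  simp [momDual, momVec, this]

theorem momDual_polVec (i a : Fin n) : momDual i (polVec a) = 0 := by
  simp [momDual, polVec]

/-- A combination of rows as a field at the punctures. -/
def rowField (D : ExternalData V 𝔤 n) : (Row n →₀ ℂ) →ₗ[ℂ] (Fin n → V) :=
  Finsupp.linearCombination ℂ fun r => Pi.single (rowLabel r) (rowVector D r)

variable (η : LinearMap.BilinForm ℂ V) (hη : ∀ x y, η x y = η y x) (D : ExternalData V 𝔤 n)

theorem rowField_single (r : Row n) :
    rowField D (Finsupp.single r 1) = Pi.single (rowLabel r) (rowVector D r) := by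
  simp [rowField]

theorem arrayForm_propagator (m m' : Row n →₀ ℂ) :
    arrayForm (propagator η D) m m' =
      ∑ i, ∑ j, (D.pos i - D.pos j)⁻¹ * η (rowField D m i) (rowField D m' j) := by
  have h : arrayForm (propagator η D) = ∑ i, ∑ j, (D.pos i - D.pos j)⁻¹ •
      η.compl₁₂ (LinearMap.proj i ∘ₗ rowField D) (LinearMap.proj j ∘ₗ rowField D) := by
    refine Finsupp.lhom_ext' fun r => LinearMap.ext_ring (Finsupp.lhom_ext' fun s =>
      LinearMap.ext_ring ?_)
    change arrayForm _ (Finsupp.single r 1) (Finsupp.single s 1) = (∑ i, ∑ j, _ :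
      LinearMap.BilinForm ℂ (Row n →₀ ℂ)) (Finsupp.single r 1) (Finsupp.single s 1)
    simp only [LinearMap.sum_apply, LinearMap.smul_apply, LinearMap.compl₁₂_apply,
      LinearMap.comp_apply, LinearMap.proj_apply, rowField_single, arrayForm_single]
    rw [Finset.sum_eq_single (rowLabel r), Finset.sum_eq_single (rowLabel s)]
    · simp [propagator]
    · intro j _ hj
      simp [Pi.single_eq_of_ne hj]
    · simp
    · intro j _ hj
      simp [Pi.single_eq_of_ne hj]
    · simp
  rw [h]
  simp [LinearMap.sum_apply]

include hη in
theorem propagator_skew (r s : Row n) : propagator η D r s = -propagator η D s r := by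
  rw [propagator, propagator, hη, ← neg_sub (D.pos (rowLabel r)), inv_neg, neg_mul, neg_neg]

variable [LieRing 𝔤] [LieAlgebra ℂ 𝔤]

/-- Combinations of rows and of the fermions `ρ` as fermions at the punctures. -/
def fermionMap :
    FermionSpace (Row n →₀ ℂ) 𝔤 n →ₗ[ℂ] (Fin n → Fermion V 𝔤) :=
  LinearMap.pi fun i => (LinearMap.proj i ∘ₗ rowField D ∘ₗ base _ 𝔤 n).prod (slot _ i)

theorem fermionMap_apply (w : FermionSpace (Row n →₀ ℂ) 𝔤 n) (i : Fin n) :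
    fermionMap D w i = (rowField D (base _ 𝔤 n w) i, slot _ i w) := rfl

theorem fermionMap_psiV (r : Row n) :
    fermionMap D (psiV _ 𝔤 n (Finsupp.single r 1)) =
      fermionAt (rowLabel r, psi (rowVector D r)) := by
  funext i
  rw [fermionMap_apply, base_psiV, slot_psiV, rowField_single, fermionAt]
  by_cases h : i = rowLabel r
  · subst h; simp [psi]
  · simp [Pi.single_eq_of_ne h]

theorem fermionMap_rhoV (i : Fin n) (s : 𝔤) :
    fermionMap D (rhoV _ i s) = fermionAt (i, rho s) := by
  funext j
  rw [fermionMap_apply, base_rhoV, map_zero, fermionAt]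
  by_cases h : j = i
  · subst h; simp [rho, slot_rhoV]
  · simp [Pi.single_eq_of_ne h, slot_rhoV_of_ne h]

variable (κ : LinearMap.BilinForm ℂ 𝔤) (hs : ∀ x y, κ x y = κ y x)

/-- Contract first `ρ`, then `Ψ`. The composite satisfies Wick's recursion for the sum of the two
propagators, so uniqueness identifies it with the full expectation value. -/
theorem wick_fermionMap (x : ExteriorAlgebra ℂ (FermionSpace (Row n →₀ ℂ) 𝔤 n)) :
    wick (fermionForm_isAlt η hη κ hs D.pos) (ExteriorAlgebra.map (fermionMap D) x) =
      wick (arrayForm_isAlt (propagator_skew η hη D)) (rhoWick κ hs D.pos x) := by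
  have hB : ((fermionForm η κ D.pos).compl₁₂ (fermionMap D) (fermionMap D)).IsAlt :=
    fun w => fermionForm_isAlt η hη κ hs D.pos _
  rw [wick_map _ (fermionMap D) hB fun _ _ => rfl]
  refine (eq_wick hB (wick (arrayForm_isAlt (propagator_skew η hη D)) ∘ₗ
    rhoWick κ hs D.pos) ?_ (fun w y => ?_) x).symm
  · rw [LinearMap.comp_apply, rhoWick_one, wick_one]
  · have : (fermionForm η κ D.pos).compl₁₂ (fermionMap D) (fermionMap D) w =
        arrayForm (propagator η D) (base _ 𝔤 n w) ∘ₗ base _ 𝔤 n + rhoForm _ κ D.pos w := by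
      refine LinearMap.ext fun w' => ?_
      rw [LinearMap.compl₁₂_apply, fermionForm_apply, LinearMap.add_apply, LinearMap.comp_apply,
        arrayForm_propagator, rhoForm_apply]
      simp only [fermionMap_apply, mul_add, Finset.sum_add_distrib]
    rw [LinearMap.comp_apply, LinearMap.comp_apply, rhoWick_vec_mul, map_add, wick_vec_mul,
      contr_rhoWick, this, map_add, LinearMap.add_apply, map_add, map_add]

end Rows
end EYM
end

noncomputable section
namespace EYM

/-! ### Vertex operators as even elements -/

section Vertex

theorem sum_flatMap {α A : Type*} [AddCommMonoid A] (f : α → List A) (l : List α) :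
    (l.flatMap f).sum = (l.map fun a => (f a).sum).sum := by
  induction l with
  | nil => rfl
  | cons a l ih => rw [List.flatMap_cons, List.sum_append, ih, List.map_cons, List.sum_cons]

variable {V 𝔤 : Type*} [AddCommGroup V] [Module ℂ V] {N n : ℕ}
  (η : LinearMap.BilinForm ℂ V) (hη : ∀ x y, η x y = η y x) (D : ExternalData V 𝔤 n)

/-- The graviton operator `ε·P + k·Ψ ε·Ψ`. -/
def gravitonTerm (a : Fin n) : evenPart (Row n →₀ ℂ) :=
  algebraMap ℂ _ (η (D.pol a) (D.momentumField a)) + vec₂ (momVec a) (polVec a)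

theorem evenVal_gravitonTerm (a : Fin n) : evenVal (gravitonTerm η D a) =
    algebraMap ℂ _ (η (D.pol a) (D.momentumField a)) + vec (momVec a) * vec (polVec a) := by
  rw [gravitonTerm, evenVal_add, evenVal_vec₂, AlgHom.commutes]

variable [LieRing 𝔤] [LieAlgebra ℂ 𝔤] (κ : LinearMap.BilinForm ℂ 𝔤) (hs : ∀ x y, κ x y = κ y x)
  (b : Module.Basis (Fin N) ℂ 𝔤)

/-- The graviton operator `ε·P + k·Ψ ε·Ψ` in the presence of the fermions `ρ`. -/
def gravitonOp (a : Fin n) : evenPart (FermionSpace (Row n →₀ ℂ) 𝔤 n) :=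
  algebraMap ℂ _ (η (D.pol a) (D.momentumField a)) +
    vec₂ (psiV _ 𝔤 n (momVec a)) (psiV _ 𝔤 n (polVec a))

theorem evenVal_gravitonOp (a : Fin n) : evenVal (gravitonOp η D a) =
    algebraMap ℂ _ (η (D.pol a) (D.momentumField a)) +
      vec (psiV _ 𝔤 n (momVec a)) * vec (psiV _ 𝔤 n (polVec a)) := by
  rw [gravitonOp, evenVal_add, evenVal_vec₂, AlgHom.commutes]

theorem rhoWick_prod_gravitonOp_mul (h : Finset (Fin n))
    (x : ExteriorAlgebra ℂ (FermionSpace (Row n →₀ ℂ) 𝔤 n)) :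
    rhoWick κ hs D.pos (evenVal (∏ a ∈ h, gravitonOp η D a) * x) =
      evenVal (∏ a ∈ h, gravitonTerm η D a) * rhoWick κ hs D.pos x := by
  induction h using Finset.induction_on with
  | empty => simp only [Finset.prod_empty, map_one, one_mul]
  | insert a h ha ih =>
    rw [Finset.prod_insert ha, Finset.prod_insert ha, map_mul evenVal, map_mul evenVal,
      mul_assoc, mul_assoc, ← ih, evenVal_gravitonOp, evenVal_gravitonTerm, add_mul, add_mul, map_add, mul_assoc, mul_assoc,
      rhoWick_psiV_mul, rhoWick_psiV_mul, ← Algebra.smul_def, ← Algebra.smul_def, map_smul]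

/-- The fermion part of the integrated operator of a particle. -/
def integratedOp (i : Fin n) : evenPart (FermionSpace (Row n →₀ ℂ) 𝔤 n) :=
  if i ∈ D.gluons then gluonOp κ b i (D.col i) (momVec i) else gravitonOp η D i

variable (𝔤) in
/-- The dual vector that turns the integrated operator of `i` into the fixed one. -/
def fixDual (i : Fin n) : Module.Dual ℂ (FermionSpace (Row n →₀ ℂ) 𝔤 n) :=
  momDual i ∘ₗ base _ 𝔤 n

theorem fixDual_psiV (i : Fin n) (m : Row n →₀ ℂ) :
    fixDual 𝔤 i (psiV _ 𝔤 n m) = momDual i m := rfl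

theorem fixDual_rhoV (i j : Fin n) (s : 𝔤) : fixDual 𝔤 i (rhoV _ j s) = 0 := by
  rw [fixDual, LinearMap.comp_apply, base_rhoV, map_zero]

theorem contr_fixDual_rhoCurrent (i j : Fin n) (s : 𝔤) :
    contr (fixDual 𝔤 i) (evenVal (rhoCurrent (Row n →₀ ℂ) κ b j s)) = 0 := by
  rw [rhoCurrent, map_sum, map_sum]
  refine Finset.sum_eq_zero fun x _ => ?_
  rw [map_sum, map_sum]
  refine Finset.sum_eq_zero fun y _ => ?_
  rw [map_smul, map_smul, contr_vec₂, fixDual_rhoV, fixDual_rhoV]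
  simp

/-- Stripping `k·Ψ` from the integrated operator leaves the fixed one, for gluons and gravitons
alike. -/
theorem contr_fixDual_integratedOp (i : Fin n) :
    contr (fixDual 𝔤 i) (evenVal (integratedOp η D κ b i)) =
      if i ∈ D.gluons then vec (rhoV _ i (D.col i)) else vec (psiV _ 𝔤 n (polVec i)) := by
  rw [integratedOp]
  split_ifs
  · rw [evenVal_gluonOp, map_add, contr_fixDual_rhoCurrent, contr_vec_mul_vec, fixDual_rhoV,
      fixDual_psiV, momDual_momVec]
    simp
  · rw [evenVal_gravitonOp, map_add, contr_algebraMap, contr_vec_mul_vec, fixDual_psiV,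
      fixDual_psiV, momDual_momVec, momDual_polVec]
    simp

theorem contr_fixDual_integratedOp_of_ne {i j : Fin n} (h : i ≠ j) :
    contr (fixDual 𝔤 j) (evenVal (integratedOp η D κ b i)) = 0 := by
  rw [integratedOp]
  split_ifs
  · rw [evenVal_gluonOp, map_add, contr_fixDual_rhoCurrent, contr_vec_mul_vec, fixDual_rhoV,
      fixDual_psiV, momDual_momVec_of_ne h.symm]
    simp
  · rw [evenVal_gravitonOp, map_add, contr_algebraMap, contr_vec_mul_vec, fixDual_psiV,
      fixDual_psiV, momDual_momVec_of_ne h.symm, momDual_polVec]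
    simp

/-- The terms of a vertex operator that do not contain `j`. -/
def currentFree (F : Finset (Fin n)) (i : Fin n) : LocalOperator V 𝔤 :=
  if i ∈ D.gluons then
    if i ∈ F then uGluon (D.col i) else
      ⟨1, [psi (D.mom i), rho (D.col i)], []⟩ ::
        (List.finRange N).flatMap fun x => (List.finRange N).map fun y =>
          ⟨-(1 / 2) * κ ⁅D.col i, b x⁆ (b y), [rho (b x), rho (b y)], []⟩
  else
    if i ∈ F then uGraviton (D.pol i) else vGraviton η (D.momentumField i) (D.mom i) (D.pol i)

theorem currents_currentFree (F : Finset (Fin n)) (i : Fin n) :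
    ∀ m ∈ currentFree η D κ b F i, m.currents = [] := by
  intro m hm
  rw [currentFree] at hm
  split_ifs at hm
  · simp only [uGluon, List.mem_singleton] at hm
    rw [hm]
  · simp only [List.mem_cons, List.mem_flatMap, List.mem_map] at hm
    rcases hm with rfl | ⟨x, -, y, -, rfl⟩ <;> rfl
  · simp only [uGraviton, List.mem_singleton] at hm
    rw [hm]
  · simp only [vGraviton, List.mem_cons, List.not_mem_nil, or_false] at hm
    rcases hm with rfl | rfl <;> rfl

theorem vertexOperator_perm (F : Finset (Fin n)) (i : Fin n) :
    (vertexOperator η κ b D F i).Perm (if i ∈ D.gluons \ F then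
      ⟨1, [], [D.col i]⟩ :: currentFree η D κ b F i else currentFree η D κ b F i) := by
  by_cases hg : i ∈ D.gluons <;> by_cases hF : i ∈ F <;>
    simp only [vertexOperator, currentFree, Finset.mem_sdiff, hg, hF, if_true, if_false, not_true,
      not_false_eq_true, and_true, and_false, List.Perm.refl]
  exact List.Perm.swap _ _ _

theorem operatorVal_currentFree (F : Finset (Fin n)) (i : Fin n) :
    operatorVal i (currentFree η D κ b F i) = ExteriorAlgebra.map (fermionMap D)
      (fixedOrIntegrated (integratedOp η D κ b) (fixDual 𝔤) F i) := by
  have hm : fermionMap D (psiV _ 𝔤 n (momVec i)) = fermionAt (i, psi (D.mom i)) :=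
    fermionMap_psiV D (Row.mom i)
  -- Only for gravitons: the polarization row of a gluon carries the zero vector.
  have hp : i ∉ D.gluons → fermionMap D (psiV _ 𝔤 n (polVec i)) = fermionAt (i, psi (D.pol i)) :=
    fun h => by
      have := fermionMap_psiV (𝔤 := 𝔤) D (Row.pol i)
      rwa [rowVector, if_neg h] at this
  rw [currentFree, fixedOrIntegrated, contr_fixDual_integratedOp, integratedOp, operatorVal]
  split_ifs with hg hF hF
  · simp [uGluon, ExteriorAlgebra.map_apply_ι, fermionMap_rhoV]
  · rw [evenVal_gluonOp, rhoCurrent]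
    simp only [map_sum, map_smul, evenVal_vec₂, map_add, map_mul, ExteriorAlgebra.map_apply_ι, hm,
      fermionMap_rhoV, List.map_cons, List.sum_cons, List.prod_cons, List.map_nil, List.prod_nil,
      mul_one, one_smul, List.map_flatMap, sum_flatMap, List.map_map, Function.comp_def]
    simp only [Fin.sum_univ_def]
  · simp [uGraviton, ExteriorAlgebra.map_apply_ι, hp hg]
  · rw [evenVal_gravitonOp]
    simp [vGraviton, ExteriorAlgebra.map_apply_ι, hp hg, hm, Algebra.algebraMap_eq_smul_one]

theorem list_prod_filter_notMem {A : Type*} [CommMonoid A] (f : Fin n → A) (U : Finset (Fin n)) :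
    (((List.finRange n).filter (· ∉ U)).map f).prod = ∏ i ∈ Uᶜ, f i := by
  rw [← List.prod_toFinset f ((List.nodup_finRange n).filter _)]
  congr 1
  ext
  simp

theorem filter_finRange (U : Finset (Fin n)) : (List.finRange n).filter (· ∈ U) = U.sort := by
  have h : ((List.finRange n).filter (· ∈ U)).toFinset = U := by
    ext
    simp
  conv_rhs => rw [← h]
  refine ((List.toFinset_sort (· ≤ ·) ((List.nodup_finRange n).filter _)).2 ?_).symm
  exact (List.pairwise_le_finRange n).sublist List.filter_sublist

theorem sort_pair {p q : Fin n} (h : p < q) : ({p, q} : Finset (Fin n)).sort = [p, q] := by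
  rw [Finset.sort_insert _ (by simpa using h.le) (by simpa using h.ne), Finset.sort_singleton]

variable (hκ : ∀ x y z, κ ⁅x, y⁆ z = κ x ⁅y, z⁆)
  (hb : ∀ x y, κ (b x) (b y) = if x = y then 1 else 0)

theorem integratedOp_prod {U : Finset (Fin n)} (hU : U ⊆ D.gluons) :
    ∏ i ∈ Uᶜ, integratedOp η D κ b i = (∏ a ∈ D.gravitons, gravitonOp η D a) *
      ∏ j ∈ D.gluons \ U, gluonOp κ b j (D.col j) (momVec j) := by
  have h1 : Uᶜ = D.gravitons ∪ D.gluons \ U := by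
    ext i
    simp only [Finset.mem_compl, Finset.mem_union, ExternalData.gravitons, Finset.mem_sdiff]
    have := @hU i
    tauto
  have h2 : Disjoint D.gravitons (D.gluons \ U) := by
    rw [Finset.disjoint_left]
    intro i hi hi'
    exact Finset.mem_compl.1 hi (Finset.sdiff_subset hi')
  rw [h1, Finset.prod_union h2]
  congr 1
  · exact Finset.prod_congr rfl fun i hi => if_neg (Finset.mem_compl.1 hi)
  · exact Finset.prod_congr rfl fun i hi => if_pos (Finset.sdiff_subset hi)

include hκ hb in
-- Both fixed operators are traded for contractions of the fully integrated correlator, so the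
-- partition formula applies to all gluons at once, whichever particles are fixed.
theorem matterCorrelator_eq_wick (hpos : Function.Injective D.pos) {p q : Fin n} (hpq : p < q) :
    matterCorrelator η κ b D.pos
      ((List.finRange n).map fun i => (i, vertexOperator η κ b D {p, q} i)) [] [] =
      wick (arrayForm_isAlt (propagator_skew η hη D)) (contr (momDual p) (contr (momDual q)
        (evenVal ((∏ a ∈ D.gravitons, gravitonTerm η D a) *
          partitionSum (traceTerm κ D D.col momVec) D.gluons)))) := by
  have hs := symmetric_of_orthonormal κ b hb
  have h1 : ∀ U ⊆ D.gluons \ {p, q}, (((List.finRange n).filter (· ∉ U)).map fun i =>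
      operatorVal i (currentFree η D κ b {p, q} i)).prod = ExteriorAlgebra.map (fermionMap D)
        (contr (fixDual 𝔤 p) (contr (fixDual 𝔤 q)
          (evenVal (∏ i ∈ Uᶜ, integratedOp η D κ b i)))) := by
    intro U hU
    have h2 : ((List.finRange n).filter (· ∉ U)).filter (· ∈ ({p, q} : Finset (Fin n))) =
        [p, q] := by
      rw [List.filter_filter, ← sort_pair hpq, ← filter_finRange]
      refine List.filter_congr fun i _ => ?_
      have : i ∈ ({p, q} : Finset (Fin n)) → i ∉ U := fun h h' =>
        (Finset.mem_sdiff.1 (hU h')).2 h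
      simpa using this
    rw [← list_prod_filter_notMem, ← fixedOrIntegrated_prod_of_filter_pair _ _ {p, q}
      (fun i j h => contr_fixDual_integratedOp_of_ne η D κ b h) ((List.nodup_finRange n).filter _) h2,
      map_list_prod, List.map_map]
    congr 1
    exact List.map_congr_left fun i _ => operatorVal_currentFree η D κ b _ i
  have h2 : ∀ U ⊆ D.gluons, wick (arrayForm_isAlt (propagator_skew η hη D)) (rhoWick κ hs D.pos
      (contr (fixDual 𝔤 p) (contr (fixDual 𝔤 q)
          (evenVal (∏ i ∈ Uᶜ, integratedOp η D κ b i))))) =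
      wick (arrayForm_isAlt (propagator_skew η hη D)) (contr (momDual p) (contr (momDual q)
        (evenVal (∏ a ∈ D.gravitons, gravitonTerm η D a) *
          rhoOn κ hs D.pos b D.col momVec (D.gluons \ U)))) := by
    intro U hU
    rw [fixDual, fixDual, ← contr_rhoWick, ← contr_rhoWick, integratedOp_prod η D κ b hU, map_mul,
      rhoWick_prod_gravitonOp_mul]
    rfl
  -- A fixed operator has no current. Sets `U` containing `p` or `q` can nevertheless be included,
  -- because the product then lacks the operator on which the dual vector acts.
  have h3 : ∀ U ⊆ D.gluons, U ∉ (D.gluons \ {p, q}).powerset →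
      contr (fixDual 𝔤 p) (contr (fixDual 𝔤 q)
          (evenVal (∏ i ∈ Uᶜ, integratedOp η D κ b i))) = 0 := by
    intro U hU hU'
    have h4 : ∀ i ∈ U, contr (fixDual 𝔤 i) (evenVal (∏ i ∈ Uᶜ, integratedOp η D κ b i)) = 0 := by
      intro i hi
      rw [← list_prod_filter_notMem]
      exact contr_list_prod_of_notMem _ _ (by simpa using hi)
        fun i j h => contr_fixDual_integratedOp_of_ne η D κ b h
    have h5 : p ∈ U ∨ q ∈ U := by
      by_contra h
      rw [not_or] at h
      refine hU' (Finset.mem_powerset.2 (Finset.subset_sdiff.2 ⟨hU, ?_⟩))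
      rw [Finset.disjoint_insert_right, Finset.disjoint_singleton_right]
      exact h
    rcases h5 with h5 | h5
    · rw [contr_comm, h4 p h5, map_zero, neg_zero]
    · rw [h4 q h5, map_zero]
  rw [matterCorrelator_eq η hη κ hs D.pos b (D.gluons \ {p, q}) D.col _ _
    (currents_currentFree η D κ b {p, q}) (vertexOperator_perm η D κ b {p, q}) _
    (List.nodup_finRange n), List.toFinset_finRange, Finset.univ_inter, map_mul,
    ← gluonCorrelator_eq κ hs hκ b hb D hpos, gluonCorrelator, Finset.mul_sum, map_sum, map_sum,
    map_sum, ← Finset.sum_subset (Finset.powerset_mono.2 (Finset.sdiff_subset (s := D.gluons) (t := {p, q})))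
      fun U hU hU' => ?_]
  · refine Finset.sum_congr rfl fun U hU => ?_
    rw [Finset.mem_powerset] at hU
    rw [h1 U hU, List.nil_append, List.map_nil, List.prod_nil, one_mul,
      wick_fermionMap η hη D κ hs, h2 U (hU.trans Finset.sdiff_subset), filter_finRange, mul_smul_comm,
      map_smul, map_smul, map_smul, smul_eq_mul]
    rfl
  · rw [Finset.mem_powerset] at hU
    rw [mul_smul_comm, map_smul, map_smul, map_smul, ← h2 U hU, h3 U hU hU', map_zero, map_zero,
      smul_zero]

end Vertex
end EYM
end

noncomputable section
namespace EYM

/-! ### The matrix with its diagonal, and its null vectors -/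

section RowProduct

theorem dual_ext {R : Type*} {d d' : Module.Dual ℂ (R →₀ ℂ)}
    (h : ∀ r, d (Finsupp.single r 1) = d' (Finsupp.single r 1)) : d = d' :=
  Finsupp.lhom_ext' fun r => LinearMap.ext_ring (h r)

variable {V 𝔤 : Type*} {n : ℕ} (D : ExternalData V 𝔤 n)

/-- The coordinate of the row `pol a`. -/
def polDual (a : Fin n) : Module.Dual ℂ (Row n →₀ ℂ) := Finsupp.lapply (.pol a)

theorem polDual_polVec (i : Fin n) : polDual i (polVec i) = 1 := by simp [polDual, polVec]

theorem polDual_polVec_of_ne {i j : Fin n} (h : i ≠ j) : polDual i (polVec j) = 0 := by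
  have : Row.pol j ≠ Row.pol i := fun h' => h (Row.pol.inj h').symm
  simp [polDual, polVec, this]

theorem polDual_momVec (i a : Fin n) : polDual i (momVec a) = 0 := by
  simp [polDual, momVec]

/-- `∏ μ_a π_a` over the gravitons in `h` times `∏ m_T m'_T` over the traces `T` in `Ts`. -/
def rowProduct (h : Finset (Fin n)) (Ts : Finset (Finset (Fin n))) : evenPart (Row n →₀ ℂ) :=
  (∏ a ∈ h, vec₂ (momVec a) (polVec a)) * ∏ T ∈ Ts, tracePair D.pos momVec T

theorem evenVal_tracePair (T : Finset (Fin n)) :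
    evenVal (tracePair D.pos momVec T) =
      vec (rowSum momVec T) * vec (weightedRowSum D.pos momVec T) := rfl

theorem map_rowSum_eq_zero {A : Type*} [AddCommMonoid A] [Module ℂ A] (f : (Row n →₀ ℂ) →ₗ[ℂ] A)
    {T : Finset (Fin n)} (h : ∀ c ∈ T, f (momVec c) = 0) : f (rowSum momVec T) = 0 := by
  rw [rowSum, map_sum]
  exact Finset.sum_eq_zero h

theorem map_weightedRowSum_eq_zero {A : Type*} [AddCommMonoid A] [Module ℂ A]
    (f : (Row n →₀ ℂ) →ₗ[ℂ] A) {T : Finset (Fin n)} (h : ∀ c ∈ T, f (momVec c) = 0) :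
    f (weightedRowSum D.pos momVec T) = 0 := by
  rw [weightedRowSum, map_sum]
  exact Finset.sum_eq_zero fun c hc => by rw [map_smul, h c hc, smul_zero]

theorem contr_rowProduct (d : Module.Dual ℂ (Row n →₀ ℂ)) {h : Finset (Fin n)}
    {Ts : Finset (Finset (Fin n))} (h1 : ∀ a ∈ h, d (momVec a) = 0)
    (h2 : ∀ a ∈ h, d (polVec a) = 0) (h3 : ∀ T ∈ Ts, ∀ c ∈ T, d (momVec c) = 0) :
    contr d (evenVal (rowProduct D h Ts)) = 0 := by
  rw [rowProduct, map_mul, contr_even_mul, contr_prod, contr_prod, Finset.sum_eq_zero,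
    Finset.sum_eq_zero, zero_mul, mul_zero, add_zero]
  · intro T hT
    rw [tracePair, contr_vec₂, map_rowSum_eq_zero _ (h3 T hT),
      map_weightedRowSum_eq_zero D _ (h3 T hT)]
    simp
  · intro a ha
    rw [contr_vec₂, h1 a ha, h2 a ha]
    simp

theorem wickExp_vec_mul_of_eq_zero {M : Type*} [AddCommGroup M] [Module ℂ M]
    {B : LinearMap.BilinForm ℂ M} (hB : B.IsAlt) {v : M} (hv : B v = 0) (x : ExteriorAlgebra ℂ M) :
    wickExp hB (vec v * x) = vec v * wickExp hB x := by
  rw [wickExp_vec_mul, hv, map_zero, LinearMap.zero_apply, add_zero]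

end RowProduct

section Diagonal

variable {V 𝔤 : Type*} [AddCommGroup V] [Module ℂ V] {n : ℕ}
  (η : LinearMap.BilinForm ℂ V) (hη : ∀ x y, η x y = η y x) (D : ExternalData V 𝔤 n)

/-- `-C_{aa}` for a graviton `a`, and `0` for a gluon. -/
def diagonal (a : Fin n) : ℂ := if a ∈ D.gluons then 0 else η (D.pol a) (D.momentumField a)

/-- The contribution of the diagonal elements of `C`. -/
def diagonalArray : Row n → Row n → ℂ
  | .mom a, .pol b => if a = b then diagonal η D a else 0
  | .pol a, .mom b => if a = b then -diagonal η D a else 0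
  | .mom _, .mom _ => 0
  | .pol _, .pol _ => 0

theorem diagonalArray_skew (r s : Row n) : diagonalArray η D r s = -diagonalArray η D s r := by
  rcases r with i | i <;> rcases s with j | j <;> simp only [diagonalArray, neg_zero]
  all_goals
    by_cases h : i = j
    · subst h; simp
    · simp [h, Ne.symm h]

/-- The matrix `M`, with the polarizations of the gluons set to zero. -/
def rowArray (r s : Row n) : ℂ := propagator η D r s + diagonalArray η D r s

include hη in
theorem rowArray_skew (r s : Row n) : rowArray η D r s = -rowArray η D s r := by
  rw [rowArray, rowArray, propagator_skew η hη, diagonalArray_skew, neg_add]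

/-- The momenta, and the polarizations of the gravitons. -/
def IsPhysicalRow : Row n → Prop
  | .mom _ => True
  | .pol a => a ∈ D.gravitons

include hη in
-- The propagator vanishes at equal punctures by `0⁻¹ = 0`, so the diagonal of `C` must come from
-- the second array.
theorem matM_eq_rowArray {r s : Row n} (hr : IsPhysicalRow D r) (hs : IsPhysicalRow D s) :
    matM η D r s = rowArray η D r s := by
  have h : ∀ a ∈ D.gravitons, a ∉ D.gluons := fun a ha => Finset.mem_compl.1 ha
  rcases r with i | i <;> rcases s with j | j
  · simp only [matM, matA, rowArray, propagator, diagonalArray, rowLabel, rowVector,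
      ExternalData.diff]
    split_ifs with hij
    · simp [hij]
    · rw [div_eq_inv_mul, add_zero]
  · have hd : diagonal η D j = η (D.pol j) (D.momentumField j) := if_neg (h j hs)
    by_cases hij : i = j
    · subst hij
      simp [matM, matC, rowArray, propagator, diagonalArray, rowLabel, hd]
    · simp only [matM, matC, rowArray, propagator, diagonalArray, rowLabel, rowVector,
        ExternalData.diff, if_neg (h j hs), if_neg hij, if_neg (Ne.symm hij)]
      rw [div_eq_inv_mul, add_zero, hη, ← neg_sub (D.pos i), inv_neg, neg_mul, neg_neg]
  · have hd : diagonal η D i = η (D.pol i) (D.momentumField i) := if_neg (h i hr)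
    by_cases hij : i = j
    · subst hij
      simp [matM, matC, rowArray, propagator, diagonalArray, rowLabel, hd]
    · simp only [matM, matC, rowArray, propagator, diagonalArray, rowLabel, rowVector,
        ExternalData.diff, if_neg (h i hr), if_neg hij]
      rw [div_eq_inv_mul, add_zero]
  · simp only [matM, matB, rowArray, propagator, diagonalArray, rowLabel, rowVector,
      ExternalData.diff, if_neg (h i hr), if_neg (h j hs)]
    split_ifs with hij
    · simp [hij]
    · rw [div_eq_inv_mul, add_zero]

theorem diagonal_momVec (a : Fin n) :
    arrayForm (diagonalArray η D) (momVec a) = diagonal η D a • polDual a := by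
  refine dual_ext fun s => ?_
  rw [momVec, arrayForm_single]
  rcases s with j | j
  · change _ = diagonal η D a * polDual a (momVec j)
    rw [polDual_momVec, mul_zero, diagonalArray]
  · change _ = diagonal η D a * polDual a (polVec j)
    rw [diagonalArray]
    split_ifs with h
    · rw [← h, polDual_polVec, mul_one]
    · rw [polDual_polVec_of_ne h, mul_zero]

theorem diagonal_polVec (a : Fin n) :
    arrayForm (diagonalArray η D) (polVec a) = -diagonal η D a • momDual a := by
  refine dual_ext fun s => ?_
  rw [polVec, arrayForm_single]
  rcases s with j | j
  · change _ = -diagonal η D a * momDual a (momVec j)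
    rw [diagonalArray]
    split_ifs with h
    · rw [← h, momDual_momVec, mul_one]
    · rw [momDual_momVec_of_ne h, mul_zero]
  · change _ = -diagonal η D a * momDual a (polVec j)
    rw [momDual_polVec, mul_zero, diagonalArray]

/-- The diagonal form pairs `μ_a` only with `π_a` of the same graviton, so each factor `μ_a π_a`
gains its own contraction `ε_a·P(σ_a)`. The trace factors consist of gluon momenta and are
untouched. -/
theorem wickExp_rowProduct {h : Finset (Fin n)} {Ts : Finset (Finset (Fin n))}
    (hh : h ⊆ D.gravitons) (hTs : ∀ T ∈ Ts, T ⊆ D.gluons) :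
    wickExp (arrayForm_isAlt (diagonalArray_skew η D)) (evenVal (rowProduct D h Ts)) =
      evenVal ((∏ a ∈ h, gravitonTerm η D a) * ∏ T ∈ Ts, tracePair D.pos momVec T) := by
  have h0 : ∀ c ∈ D.gluons, arrayForm (diagonalArray η D) (momVec c) = 0 := fun c hc => by
    rw [diagonal_momVec, diagonal, if_pos hc, zero_smul]
  induction h using Finset.induction_on with
  | empty =>
    rw [rowProduct, Finset.prod_empty, Finset.prod_empty, one_mul]
    induction Ts using Finset.induction_on with
    | empty => rw [Finset.prod_empty, map_one, wickExp_one]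
    | insert T Ts hT ih =>
      have hT' := hTs T (Finset.mem_insert_self T Ts)
      rw [Finset.prod_insert hT, map_mul, evenVal_tracePair, mul_assoc,
        wickExp_vec_mul_of_eq_zero _ (map_rowSum_eq_zero _ fun c hc => h0 c (hT' hc)),
        wickExp_vec_mul_of_eq_zero _ (map_weightedRowSum_eq_zero D _ fun c hc => h0 c (hT' hc)),
        ih fun S hS => hTs S (Finset.mem_insert_of_mem hS)]
  | insert a h ha ih =>
    have hag : a ∉ D.gluons := Finset.mem_compl.1 (hh (Finset.mem_insert_self a h))
    have e1 : rowProduct D (insert a h) Ts = vec₂ (momVec a) (polVec a) * rowProduct D h Ts := by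
      rw [rowProduct, rowProduct, Finset.prod_insert ha, mul_assoc]
    have e2 : contr (momDual a) (evenVal (rowProduct D h Ts)) = 0 :=
      contr_rowProduct D _ (fun c hc => momDual_momVec_of_ne fun e => ha (e ▸ hc))
        (fun c _ => momDual_polVec a c)
        fun T hT c hc => momDual_momVec_of_ne fun e => hag (e ▸ hTs T hT hc)
    have e3 : contr (polDual a) (evenVal (rowProduct D h Ts)) = 0 :=
      contr_rowProduct D _ (fun c _ => polDual_momVec a c)
        (fun c hc => polDual_polVec_of_ne fun e => ha (e ▸ hc)) fun T _ c _ => polDual_momVec a c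
    have e4 : evenVal (gravitonTerm η D a) = algebraMap ℂ _ (diagonal η D a) +
        vec (momVec a) * vec (polVec a) := by
      rw [evenVal_gravitonTerm, diagonal, if_neg hag]
    rw [e1, map_mul, evenVal_vec₂, mul_assoc, wickExp_vec_mul, wickExp_vec_mul, diagonal_momVec,
      diagonal_polVec, map_smul, map_smul, LinearMap.smul_apply, LinearMap.smul_apply,
      ← wickExp_contr _ (momDual a), e2, map_zero, smul_zero, add_zero, contr_vec_mul,
      ← wickExp_contr _ (polDual a), e3, map_zero, mul_zero, sub_zero, polDual_polVec, one_smul,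
      ih fun c hc => hh (Finset.mem_insert_of_mem hc), Finset.prod_insert ha, mul_assoc,
      map_mul (evenVal) (gravitonTerm η D a), e4, add_mul, Algebra.smul_def, mul_assoc, add_comm]

end Diagonal
end EYM
end

noncomputable section
namespace EYM

/-! ### Null vectors and double contractions -/

section NullVectors

variable {M : Type*} [AddCommGroup M] [Module ℂ M] {B : LinearMap.BilinForm ℂ M} (hB : B.IsAlt)

/-- Expand the triple contraction of `v ∧ y = 0`. The part in which `v` stays in front has no
expectation value, since `v` is in the kernel of `B`. -/
theorem wick_contr_contr_null {v : M} (hv : B v = 0) {y : ExteriorAlgebra ℂ M}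
    (hy : vec v * y = 0) (α β γ : Module.Dual ℂ M) :
    γ v * wick hB (contr α (contr β y)) - β v * wick hB (contr α (contr γ y)) +
      α v * wick hB (contr β (contr γ y)) = 0 := by
  have h : wick hB (contr α (contr β (contr γ (vec v * y)))) = 0 := by
    rw [hy, map_zero, map_zero, map_zero, map_zero]
  rw [contr_vec_mul, map_sub, contr_vec_mul, map_sub, map_sub, map_sub, contr_vec_mul] at h
  simp only [map_sub, map_smul, wick_vec_mul, hv, map_zero, LinearMap.zero_apply, smul_eq_mul,
    sub_zero] at h
  linear_combination h

/-- As a function of `α`, `β` the double contraction is an alternating form. The three-term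
relations for `v` and `w` make it a multiple of `α(v)β(w) - β(v)α(w)`, and `p`, `q` fix the
constant. -/
theorem wick_contr_contr_eq {v w : M} (hv : B v = 0) (hw : B w = 0) {y : ExteriorAlgebra ℂ M}
    (hvy : vec v * y = 0) (hwy : vec w * y = 0) {p q : Module.Dual ℂ M} {a b : ℂ} (hab : b ≠ a)
    (hpv : p v = 1) (hqv : q v = 1) (hpw : p w = a) (hqw : q w = b) (α β : Module.Dual ℂ M) :
    wick hB (contr α (contr β y)) =
      (α v * β w - β v * α w) * ((b - a)⁻¹ * wick hB (contr p (contr q y))) := by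
  have h1 := wick_contr_contr_null hB hv hvy
  have h2 := wick_contr_contr_null hB hw hwy
  have e1 := h1 α p q
  have e2 := h2 α p q
  have e3 := h1 β p q
  have e4 := h2 β p q
  have e5 := h1 α β p
  rw [hpv, hqv] at e1 e3
  rw [hpw, hqw] at e2 e4
  rw [hpv] at e5
  have hab' : b - a ≠ 0 := sub_ne_zero.2 hab
  field_simp
  -- `e2 - a * e1` and `e4 - a * e3` express the pairings of `α` and `β` with `p` through the
  -- pairing of `p` with `q`; `e5` then gives that of `α` with `β`.
  linear_combination (b - a) * e5 + β v * (e2 - a * e1) - α v * (e4 - a * e3)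

theorem wick_of_eq_add {B' B'' : LinearMap.BilinForm ℂ M} (hB' : B'.IsAlt) (hB'' : B''.IsAlt)
    (h : B'' = B + B') (x : ExteriorAlgebra ℂ M) : wick hB'' x = wick hB (wickExp hB' x) := by
  subst h
  exact wick_add hB hB' hB'' x

end NullVectors

section OnShell

variable {V 𝔤 : Type*} [AddCommGroup V] [Module ℂ V] {n : ℕ}
  (η : LinearMap.BilinForm ℂ V) (hη : ∀ x y, η x y = η y x) (D : ExternalData V 𝔤 n)

theorem arrayForm_sum_momVec (c : Fin n → ℂ) (s : Row n) :
    arrayForm (rowArray η D) (∑ i, c i • momVec i) (Finsupp.single s 1) =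
      ∑ i, c i * ((D.pos i - D.pos (rowLabel s))⁻¹ * η (D.mom i) (rowVector D s)) +
        c (rowLabel s) * diagonalArray η D (.mom (rowLabel s)) s := by
  have h : ∑ i, c i * diagonalArray η D (.mom i) s =
      c (rowLabel s) * diagonalArray η D (.mom (rowLabel s)) s := by
    refine Finset.sum_eq_single _ (fun i _ hi => ?_) (by simp)
    rcases s with j | j
    · exact mul_zero _
    · have hi' : i ≠ j := hi
      rw [diagonalArray, if_neg hi', mul_zero]
  rw [← h, ← Finset.sum_add_distrib, map_sum, LinearMap.sum_apply]
  refine Finset.sum_congr rfl fun i _ => ?_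
  rw [map_smul, LinearMap.smul_apply, momVec, arrayForm_single, rowArray, smul_eq_mul, mul_add]
  rfl

theorem form_momentumField (x : V) (j : Fin n) :
    η x (D.momentumField j) = ∑ i, (D.pos j - D.pos i)⁻¹ * η x (D.mom i) := by
  rw [ExternalData.momentumField, map_sum, ← Finset.sum_erase_add _ _ (Finset.mem_univ j), sub_self,
    inv_zero, zero_mul, add_zero]
  exact Finset.sum_congr rfl fun i _ => by rw [map_smul, smul_eq_mul, ExternalData.diff]

variable {η D} (hD : OnShell η D)

include hD in
-- On momentum rows this is the scattering equation; on polarization rows it is the choice of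
-- diagonal entry, zero for gluons.
theorem OnShell.diagonal_eq (s : Row n) : diagonalArray η D (.mom (rowLabel s)) s =
    η (rowVector D s) (D.momentumField (rowLabel s)) := by
  rcases s with j | j
  · exact (hD.scattering j).symm
  · change (if j = j then diagonal η D j else 0) = η (if j ∈ D.gluons then 0 else D.pol j) _
    rw [if_pos rfl, diagonal]
    split_ifs
    · simp
    · rfl

include hη hD in
theorem OnShell.mom_form (s : Row n) : η (D.mom (rowLabel s)) (rowVector D s) = 0 := by
  rcases s with j | j
  · exact hD.null j
  · simp only [rowLabel, rowVector]
    split_ifs with h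
    · simp
    · rw [hη, hD.transverse j (Finset.mem_compl.2 h)]

include hη hD in
theorem OnShell.sum_mom (s : Row n) :
    ∑ i, ((D.pos i - D.pos (rowLabel s))⁻¹ * η (D.mom i) (rowVector D s)) =
      -diagonalArray η D (.mom (rowLabel s)) s := by
  rw [hD.diagonal_eq, form_momentumField, ← Finset.sum_neg_distrib]
  refine Finset.sum_congr rfl fun i _ => ?_
  rw [hη, ← neg_sub (D.pos i), inv_neg, neg_mul, neg_neg]

include hη hD in
-- The `A`-columns sum to zero by the scattering equations, the others because `C_aa` is minus the
-- sum of the off-diagonal entries.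
theorem OnShell.rowArray_mom : arrayForm (rowArray η D) (∑ i, momVec i) = 0 := by
  refine dual_ext fun s => ?_
  have := arrayForm_sum_momVec η D (fun _ => 1) s
  simp only [one_smul, one_mul] at this
  rw [this, hD.sum_mom hη, neg_add_cancel, LinearMap.zero_apply]

include hη hD in
-- Writing `σ_i/σ_is = 1 + σ_s/σ_is` splits the sum into one that vanishes by momentum conservation
-- and `σ_s` times the previous null relation.
theorem OnShell.rowArray_pos_mom (hpos : Function.Injective D.pos) :
    arrayForm (rowArray η D) (∑ i, D.pos i • momVec i) = 0 := by
  refine dual_ext fun s => ?_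
  -- At `i = s` the inverse is zero and the identity needs `k_s · v_s = 0`: null momenta and
  -- transverse polarizations.
  have h : ∀ i, D.pos i * ((D.pos i - D.pos (rowLabel s))⁻¹ * η (D.mom i) (rowVector D s)) =
      η (D.mom i) (rowVector D s) + D.pos (rowLabel s) *
        ((D.pos i - D.pos (rowLabel s))⁻¹ * η (D.mom i) (rowVector D s)) := by
    intro i
    by_cases hi : i = rowLabel s
    · rw [hi, hD.mom_form hη]
      simp
    · have := sub_ne_zero.2 (hpos.ne hi)
      field_simp
      ring
  have h0 : ∑ i, η (D.mom i) (rowVector D s) = 0 := by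
    rw [← LinearMap.sum_apply, ← map_sum, hD.conservation, map_zero, LinearMap.zero_apply]
  rw [arrayForm_sum_momVec, Finset.sum_congr rfl fun i _ => h i, Finset.sum_add_distrib, h0,
    ← Finset.mul_sum, hD.sum_mom hη, LinearMap.zero_apply]
  ring

end OnShell

section Reduced

variable {V 𝔤 : Type*} {n : ℕ}

theorem sum_univ_eq_sum_traces {A : Type*} [AddCommMonoid A] (D : ExternalData V 𝔤 n)
    (P : Finpartition D.gluons) (f : Fin n → A) :
    ∑ i, f i = ∑ a ∈ D.gravitons, f a + ∑ T ∈ P.parts, ∑ c ∈ T, f c := by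
  have h : ∑ T ∈ P.parts, ∑ c ∈ T, f c = ∑ c ∈ D.gluons, f c := by
    conv_rhs => rw [← P.biUnion_parts]
    exact (Finset.sum_biUnion P.supIndep.pairwiseDisjoint).symm
  rw [h, ExternalData.gravitons, Finset.sum_compl_add_sum]

theorem vec_mul_rowProduct_of_mem_gravitons (D : ExternalData V 𝔤 n) {h : Finset (Fin n)}
    {Ts : Finset (Finset (Fin n))} {a : Fin n} (ha : a ∈ h) :
    vec (momVec a) * evenVal (rowProduct D h Ts) = 0 := by
  rw [rowProduct, ← Finset.mul_prod_erase h _ ha, mul_assoc, map_mul, evenVal_vec₂, ← mul_assoc,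
    ← mul_assoc, vec_mul_vec_self, zero_mul, zero_mul]

theorem vec_rowSum_mul_rowProduct (D : ExternalData V 𝔤 n) {h : Finset (Fin n)}
    {Ts : Finset (Finset (Fin n))} {T : Finset (Fin n)} (hT : T ∈ Ts) :
    vec (rowSum momVec T) * evenVal (rowProduct D h Ts) = 0 := by
  rw [rowProduct, ← Finset.mul_prod_erase Ts _ hT, mul_left_comm, map_mul, evenVal_tracePair,
    ← mul_assoc, ← mul_assoc, vec_mul_vec_self, zero_mul, zero_mul]

theorem vec_weightedRowSum_mul_rowProduct (D : ExternalData V 𝔤 n) {h : Finset (Fin n)}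
    {Ts : Finset (Finset (Fin n))} {T : Finset (Fin n)} (hT : T ∈ Ts) :
    vec (weightedRowSum D.pos momVec T) * evenVal (rowProduct D h Ts) = 0 := by
  rw [rowProduct, ← Finset.mul_prod_erase Ts _ hT, mul_left_comm, map_mul, evenVal_tracePair,
    vec_mul_vec_comm, neg_mul, mul_neg, ← mul_assoc, ← mul_assoc, vec_mul_vec_self, zero_mul,
    zero_mul, neg_zero]

/-- The total is the sum of the graviton rows and the trace rows, each of which already occurs as a
factor of the product. -/
theorem vec_sum_mom_mul_rowProduct (D : ExternalData V 𝔤 n) (P : Finpartition D.gluons) :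
    vec (∑ i, momVec i) * evenVal (rowProduct D D.gravitons P.parts) = 0 := by
  rw [sum_univ_eq_sum_traces D P, vec, map_add, map_sum, map_sum, add_mul, Finset.sum_mul,
    Finset.sum_mul, Finset.sum_eq_zero fun a ha => vec_mul_rowProduct_of_mem_gravitons D ha,
    zero_add]
  exact Finset.sum_eq_zero fun T hT => vec_rowSum_mul_rowProduct D hT

theorem vec_sum_pos_mom_mul_rowProduct (D : ExternalData V 𝔤 n) (P : Finpartition D.gluons) :
    vec (∑ i, D.pos i • momVec i) * evenVal (rowProduct D D.gravitons P.parts) = 0 := by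
  rw [sum_univ_eq_sum_traces D P, vec, map_add, map_sum, map_sum, add_mul, Finset.sum_mul,
    Finset.sum_mul, Finset.sum_eq_zero fun a ha => ?_,
    zero_add]
  · exact Finset.sum_eq_zero fun T hT => vec_weightedRowSum_mul_rowProduct D hT
  · rw [map_smul, smul_mul_assoc, vec_mul_rowProduct_of_mem_gravitons D ha, smul_zero]

theorem dual_sum_momVec (p : Fin n) : momDual p (∑ i, momVec i) = 1 := by
  rw [map_sum, Finset.sum_eq_single p (fun i _ h => momDual_momVec_of_ne h.symm) (by simp),
    momDual_momVec]

theorem dual_sum_pos_momVec (D : ExternalData V 𝔤 n) (p : Fin n) : momDual p (∑ i, D.pos i • momVec i) = D.pos p := by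
  rw [map_sum, Finset.sum_eq_single p (fun i _ h => ?_) (by simp), map_smul, momDual_momVec,
    smul_eq_mul, mul_one]
  rw [map_smul, momDual_momVec_of_ne h.symm, smul_zero]

variable [AddCommGroup V] [Module ℂ V] (η : LinearMap.BilinForm ℂ V)
  (hη : ∀ x y, η x y = η y x) (D : ExternalData V 𝔤 n)

/-- The expectation value of the product of all rows, contracted with two dual vectors. -/
def contractedProduct (Ts : Finset (Finset (Fin n))) (α β : Module.Dual ℂ (Row n →₀ ℂ)) : ℂ :=
  wick (arrayForm_isAlt (rowArray_skew η hη D))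
    (contr α (contr β (evenVal (rowProduct D D.gravitons Ts))))

/-- The common constant depends neither on the fixed labels nor on the rows removed; only a 2×2
determinant varies. -/
theorem contractedProduct_eq (hD : OnShell η D) (hpos : Function.Injective D.pos)
    (P : Finpartition D.gluons) {p q : Fin n} (hpq : p ≠ q)
    (α β : Module.Dual ℂ (Row n →₀ ℂ)) :
    contractedProduct η hη D P.parts α β =
      (α (∑ i, momVec i) * β (∑ i, D.pos i • momVec i) -
        β (∑ i, momVec i) * α (∑ i, D.pos i • momVec i)) *
      ((D.pos q - D.pos p)⁻¹ * contractedProduct η hη D P.parts (momDual p) (momDual q)) :=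
  wick_contr_contr_eq _ (hD.rowArray_mom hη) (hD.rowArray_pos_mom hη hpos)
    (vec_sum_mom_mul_rowProduct D P) (vec_sum_pos_mom_mul_rowProduct D P) (hpos.ne hpq.symm)
    (dual_sum_momVec p) (dual_sum_momVec q) (dual_sum_pos_momVec D p) (dual_sum_pos_momVec D q) α β

end Reduced

/-! ### The correlator as a sum over partitions -/

section Correlator

variable {V 𝔤 : Type*} [AddCommGroup V] [Module ℂ V] [LieRing 𝔤] [LieAlgebra ℂ 𝔤] {N n : ℕ}
  (η : LinearMap.BilinForm ℂ V) (hη : ∀ x y, η x y = η y x)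
  (κ : LinearMap.BilinForm ℂ 𝔤) (hκ : ∀ x y z, κ ⁅x, y⁆ z = κ x ⁅y, z⁆)
  (b : Module.Basis (Fin N) ℂ 𝔤) (hb : ∀ x y, κ (b x) (b y) = if x = y then 1 else 0)
  (D : ExternalData V 𝔤 n)

theorem ghostCorrelator_of_card_ne (σ : Fin n → ℂ) {F : Finset (Fin n)} (hF : F.card ≠ 2) :
    ghostCorrelator σ (fun i => if i ∈ F then -1 else 0) = 0 := by
  rw [ghostCorrelator, if_neg]
  rw [Finset.sum_ite_mem, Finset.univ_inter, Finset.sum_const, nsmul_eq_mul]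
  intro h
  exact hF (by omega)

theorem ghostCorrelator_pair (σ : Fin n → ℂ) {p q : Fin n} (hpq : p < q) :
    ghostCorrelator σ (fun i => if i ∈ ({p, q} : Finset (Fin n)) then -1 else 0) =
      (σ p - σ q)⁻¹ := by
  rw [ghostCorrelator, if_pos, Finset.prod_eq_single p, Finset.prod_eq_single q]
  · simp
  · intro j hj hjq
    have : j ≠ p := (Finset.mem_Ioi.1 hj).ne'
    simp [hjq, this]
  · intro h
    exact absurd (Finset.mem_Ioi.2 hpq) h
  · intro i _ hip
    refine Finset.prod_eq_one fun j hj => ?_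
    by_cases hiq : i = q
    · have hij := Finset.mem_Ioi.1 hj
      have h1 : j ≠ q := by rw [← hiq]; exact hij.ne'
      have h2 : j ≠ p := fun h => lt_asymm hpq (by rw [← hiq, ← h]; exact hij)
      simp [h1, h2]
    · simp [hip, hiq]
  · simp
  · rw [Finset.sum_ite_mem, Finset.univ_inter, Finset.sum_pair hpq.ne]
    rfl

include hκ hb in
-- The terms `ε·P` are traded for the diagonal contraction, which merges with the propagator into
-- the full matrix. The factor `-1` for each trace comes from `traceTerm`.
theorem correlator_eq (hpos : Function.Injective D.pos) {p q : Fin n} (hpq : p < q) :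
    correlator η κ b D {p, q} = ∑ P : Finpartition D.gluons, (∏ T ∈ P.parts, -comb κ D T) *
      ((D.pos p - D.pos q)⁻¹ *
        contractedProduct η hη D P.parts (momDual p) (momDual q)) := by
  rw [correlator, ghostCorrelator_pair _ hpq, matterCorrelator_eq_wick η hη D κ b hκ hb hpos hpq,
    partitionSum, Finset.mul_sum, map_sum, map_sum, map_sum, map_sum, Finset.mul_sum]
  refine Finset.sum_congr rfl fun P _ => ?_
  have h : ∏ T ∈ P.parts, traceTerm κ D D.col momVec T =
      (∏ T ∈ P.parts, -comb κ D T) • ∏ T ∈ P.parts, tracePair D.pos momVec T :=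
    Finset.prod_smul _ _ _
  rw [h, mul_smul_comm, map_smul, map_smul, map_smul, map_smul,
    ← wickExp_rowProduct η D subset_rfl fun T hT => P.subset hT, ← wickExp_contr, ← wickExp_contr,
    ← wick_of_eq_add _ _ (arrayForm_isAlt (rowArray_skew η hη D)) (arrayForm_add _ _), smul_eq_mul,
    mul_left_comm]
  rfl

end Correlator
end EYM
end

noncomputable section
namespace EYM

/-! ### Reduced Pfaffians -/

section Lists

variable {M R : Type*} [AddCommGroup M] [Module ℂ M] (u : R → M)

theorem contr_list_prod_eq_zero {d : Module.Dual ℂ M} {L : List R} (h : ∀ x ∈ L, d (u x) = 0) :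
    contr d (L.map fun x => vec (u x)).prod = 0 := by
  induction L with
  | nil => exact contr_one d
  | cons x L ih =>
    rw [List.map_cons, List.prod_cons, contr_vec_mul, h x List.mem_cons_self,
      ih fun y hy => h y (List.mem_cons_of_mem x hy), zero_smul, mul_zero, sub_zero]

theorem contr_list_prod_append_cons {d : Module.Dual ℂ M} {A B : List R} {x : R}
    (hx : d (u x) = 1) (hA : ∀ y ∈ A, d (u y) = 0) (hB : ∀ y ∈ B, d (u y) = 0) :
    contr d ((A ++ x :: B).map fun x => vec (u x)).prod =
      (-1 : ℂ) ^ A.length • ((A ++ B).map fun x => vec (u x)).prod := by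
  induction A with
  | nil =>
    rw [List.nil_append, List.map_cons, List.prod_cons, contr_vec_mul, hx,
      contr_list_prod_eq_zero u hB, mul_zero, sub_zero, List.length_nil, pow_zero, List.nil_append]
  | cons y A ih =>
    rw [List.cons_append, List.map_cons, List.prod_cons, contr_vec_mul, hA y List.mem_cons_self,
      ih fun z hz => hA z (List.mem_cons_of_mem y hz), List.cons_append, List.map_cons,
      List.prod_cons, List.length_cons, pow_succ, mul_smul_comm]
    module

/-- The later row `y` goes first, so the position of `x` is unchanged and the sign is given by the
two original positions. -/
theorem contr_contr_list_prod {α β : Module.Dual ℂ M} {A B C : List R} {x y : R}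
    (hL : (A ++ x :: B ++ y :: C).Nodup) (hαx : α (u x) = 1)
    (hα : ∀ z ∈ A ++ x :: B ++ y :: C, z ≠ x → α (u z) = 0) (hβy : β (u y) = 1)
    (hβ : ∀ z ∈ A ++ x :: B ++ y :: C, z ≠ y → β (u z) = 0) :
    contr α (contr β ((A ++ x :: B ++ y :: C).map fun x => vec (u x)).prod) =
      (-1 : ℂ) ^ (A.length + (A ++ x :: B).length) •
        ((A ++ B ++ C).map fun x => vec (u x)).prod := by
  have hy1 : ∀ z ∈ A ++ x :: B, z ≠ y := by
    rintro z hz rfl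
    exact (List.nodup_append.1 hL).2.2 z hz z List.mem_cons_self rfl
  have hy2 : ∀ z ∈ C, z ≠ y := by
    rintro z hz rfl
    exact (List.nodup_cons.1 (List.nodup_append.1 hL).2.1).1 hz
  have hL' : (A ++ x :: (B ++ y :: C)).Nodup := by simpa using hL
  have hx1 : ∀ z ∈ A, z ≠ x := by
    rintro z hz rfl
    exact (List.nodup_append.1 hL').2.2 z hz z List.mem_cons_self rfl
  have hx2 : ∀ z ∈ B ++ y :: C, z ≠ x := by
    rintro z hz rfl
    exact (List.nodup_cons.1 (List.nodup_append.1 hL').2.1).1 hz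
  rw [contr_list_prod_append_cons u hβy (fun z hz => hβ z (by simp at hz ⊢; tauto) (hy1 z hz))
      (fun z hz => hβ z (by simp [hz]) (hy2 z hz)), map_smul, List.append_assoc, List.cons_append,
    contr_list_prod_append_cons u hαx (fun z hz => hα z (by simp [hz]) (hx1 z hz))
      (fun z hz => hα z (by simp at hz ⊢; tauto) (hx2 z (by simp at hz ⊢; tauto))), smul_smul,
    ← pow_add, add_comm A.length, List.append_assoc]

theorem list_prod_mul_vec (L : List R) (v : M) :
    vec v * (L.map fun x => vec (u x)).prod =
      (-1 : ℂ) ^ L.length • ((L.map fun x => vec (u x)).prod * vec v) := by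
  induction L with
  | nil => simp
  | cons x L ih =>
    rw [List.map_cons, List.prod_cons, ← mul_assoc, vec_mul_vec_comm, neg_mul, mul_assoc, ih,
      List.length_cons, pow_succ, mul_smul_comm, mul_assoc]
    module

/-- The sign of reordering `k` pairs into two blocks. -/
def pairSign (k : ℕ) : ℂ := (-1) ^ (k * (k - 1) / 2)

theorem pairSign_succ (k : ℕ) : pairSign (k + 1) = pairSign k * (-1) ^ k := by
  rw [pairSign, pairSign, ← pow_add, ← Nat.choose_two_right, ← Nat.choose_two_right,
    Nat.choose_succ_succ' k 1, Nat.choose_one_right, add_comm]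

theorem pairSign_mul_self (k : ℕ) : pairSign k * pairSign k = 1 := by
  rw [pairSign, ← mul_pow, neg_mul_neg, one_mul, one_pow]

/-- Gathering all first members in front moves the pair at place `i` past `i` second members,
`k(k-1)/2` transpositions in all. -/
theorem evenVal_list_prod_vec₂ (f g : R → M) (L : List R) :
    evenVal (L.map fun x => vec₂ (f x) (g x)).prod = pairSign L.length •
      ((L.map fun x => vec (f x)).prod * (L.map fun x => vec (g x)).prod) := by
  induction L with
  | nil => simp [pairSign]
  | cons x L ih =>
    have h := list_prod_mul_vec f L (g x)
    rw [List.map_cons, List.prod_cons, map_mul, ih, evenVal_vec₂, List.length_cons, pairSign_succ,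
      List.map_cons, List.prod_cons, List.map_cons, List.prod_cons, mul_smul_comm, mul_assoc,
      ← mul_assoc (vec (g x)), h, smul_mul_assoc, mul_smul_comm, smul_smul, mul_assoc, mul_assoc]

end Lists

section Rows

variable {V 𝔤 : Type*} {n : ℕ} (D : ExternalData V 𝔤 n)

/-- The combination of rows of `M` for a row of `Π`. -/
def piVec : PiRow n → Row n →₀ ℂ
  | .mom a => momVec a
  | .trace p T => ∑ c ∈ T, weight D p c • momVec c
  | .pol a => polVec a

theorem piVec_trace_false (T : Finset (Fin n)) : piVec D (.trace false T) = rowSum momVec T := by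
  simp [piVec, rowSum, weight]

theorem piVec_trace_true (T : Finset (Fin n)) :
    piVec D (.trace true T) = weightedRowSum D.pos momVec T := by
  simp [piVec, weightedRowSum, weight]

/-- The rows of `Π`. -/
def rowList (h : Finset (Fin n)) (Us Us' : List (Finset (Fin n))) : List (PiRow n) :=
  h.sort.map PiRow.mom ++ Us.map (PiRow.trace false) ++ Us'.map (PiRow.trace true) ++
    D.gravitons.sort.map PiRow.pol

theorem rowList_nodup (h : Finset (Fin n)) {Us Us' : List (Finset (Fin n))} (hU : Us.Nodup)
    (hU' : Us'.Nodup) : (rowList D h Us Us').Nodup := by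
  have h1 : (h.sort.map (PiRow.mom (n := n))).Nodup :=
    (h.sort_nodup (· ≤ ·)).map fun _ _ h => PiRow.mom.inj h
  have h2 : (Us.map (PiRow.trace (n := n) false)).Nodup := hU.map fun _ _ h => (PiRow.trace.inj h).2
  have h3 : (Us'.map (PiRow.trace (n := n) true)).Nodup :=
    hU'.map fun _ _ h => (PiRow.trace.inj h).2
  have h4 : (D.gravitons.sort.map (PiRow.pol (n := n))).Nodup :=
    (D.gravitons.sort_nodup (· ≤ ·)).map fun _ _ h => PiRow.pol.inj h
  rw [rowList, List.nodup_append', List.nodup_append', List.nodup_append']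
  refine ⟨⟨⟨h1, h2, ?_⟩, h3, ?_⟩, h4, ?_⟩ <;> intro x hx hx' <;> simp at hx hx' <;> aesop

theorem prod_sort {A : Type*} [CommMonoid A] (s : Finset (Fin n)) (f : Fin n → A) :
    ∏ a ∈ s, f a = (s.sort.map f).prod := by
  rw [← List.prod_toFinset f (s.sort_nodup (· ≤ ·)), Finset.sort_toFinset]

theorem evenVal_rowProduct (Ts : Finset (Finset (Fin n))) :
    evenVal (rowProduct D D.gravitons Ts) =
      (pairSign D.gravitons.card * pairSign Ts.card) •
        ((rowList D D.gravitons Ts.toList Ts.toList).map fun x => vec (piVec D x)).prod := by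
  have h1 : ∏ T ∈ Ts, tracePair D.pos momVec T = (Ts.toList.map fun T =>
      vec₂ (piVec D (.trace false T)) (piVec D (.trace true T))).prod := by
    rw [Finset.prod_map_toList]
    simp only [piVec_trace_false, piVec_trace_true, tracePair]
  rw [rowProduct, map_mul, prod_sort, h1]
  -- The trace factors are even and slide without sign between the graviton momenta and the
  -- polarizations.
  have h2 := even_comm (Ts.toList.map fun T =>
    vec₂ (piVec D (.trace false T)) (piVec D (.trace true T))).prod
      (D.gravitons.sort.map fun a => vec (polVec a)).prod
  rw [evenVal_list_prod_vec₂, smul_mul_assoc, mul_assoc, ← h2, evenVal_list_prod_vec₂,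
    smul_mul_assoc, mul_smul_comm, smul_smul, Finset.length_sort, Finset.length_toList]
  simp only [rowList, List.map_append, List.prod_append, List.map_map, Function.comp_def, mul_assoc,
    piVec]

theorem rank_eq_length {a : Fin n} {S T : List (Fin n)} (h : D.gravitons.sort = S ++ a :: T) :
    D.rank a = S.length := by
  have h1 := D.gravitons.sortedLT_sort.pairwise
  rw [h, List.pairwise_append, List.pairwise_cons] at h1
  have h2 := D.gravitons.sort_nodup (· ≤ ·)
  rw [h] at h2
  rw [← List.toFinset_card_of_nodup (List.nodup_append.1 h2).1, ExternalData.rank]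
  congr 1
  ext x
  rw [Finset.mem_filter, ← Finset.mem_sort (· ≤ ·), h, List.mem_append, List.mem_cons,
    List.mem_toFinset]
  constructor
  · rintro ⟨h3 | rfl | h3, h4⟩
    · exact h3
    · exact absurd h4 (lt_irrefl _)
    · exact absurd h4 (lt_asymm (h1.2.1.1 x h3))
  · exact fun h3 => ⟨Or.inl h3, h1.2.2 x h3 a List.mem_cons_self⟩

theorem exists_sort_eq {h : Finset (Fin n)} {a : Fin n} (ha : a ∈ h) :
    ∃ S T, h.sort = S ++ a :: T ∧ (h.erase a).sort = S ++ T := by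
  obtain ⟨S, T, h1⟩ := List.append_of_mem ((Finset.mem_sort (· ≤ ·)).2 ha)
  have h2 := h.sort_nodup (· ≤ ·)
  rw [h1] at h2
  have h3 : a ∉ S := fun h' => (List.nodup_append.1 h2).2.2 a h' a List.mem_cons_self rfl
  exact ⟨S, T, h1, by rw [sort_erase, h1, List.erase_append_right _ h3, List.erase_cons_head]⟩

theorem exists_sort_eq_pair {h : Finset (Fin n)} {a b : Fin n} (ha : a ∈ h) (hb : b ∈ h)
    (hab : a < b) : ∃ S T U, h.sort = S ++ a :: T ++ b :: U ∧
      ((h.erase a).erase b).sort = S ++ T ++ U := by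
  obtain ⟨S, U, h1, h2⟩ := exists_sort_eq hb
  have h3 : a ∈ S := by
    have h4 := h.sortedLT_sort.pairwise
    rw [h1, List.pairwise_append, List.pairwise_cons] at h4
    have h5 := (Finset.mem_sort (· ≤ ·)).2 ha
    rw [h1, List.mem_append, List.mem_cons] at h5
    rcases h5 with h5 | rfl | h5
    · exact h5
    · exact absurd hab (lt_irrefl _)
    · exact absurd hab (lt_asymm (h4.2.1.1 a h5))
  obtain ⟨S, T, rfl⟩ := List.append_of_mem h3
  have h6 := h.sort_nodup (· ≤ ·)
  rw [h1, List.append_assoc] at h6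
  have h7 : a ∉ S := fun h' => (List.nodup_append.1 h6).2.2 a h' a List.mem_cons_self rfl
  exact ⟨S, T, U, h1, by rw [Finset.erase_right_comm, sort_erase, h2, List.append_assoc,
    List.erase_append_right _ h7, List.cons_append, List.erase_cons_head, List.append_assoc]⟩

theorem list_split {α : Type*} (L : List α) (i : Fin L.length) :
    ∃ S T, L = S ++ L[i] :: T ∧ L.eraseIdx i = S ++ T ∧ S.length = i := by
  refine ⟨L.take i, L.drop (i + 1), ?_, List.eraseIdx_eq_take_drop_succ .., ?_⟩
  · simp
  · simp

end Rows

section Pfaffian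

variable {V 𝔤 : Type*} [AddCommGroup V] [Module ℂ V] {n : ℕ}
  (η : LinearMap.BilinForm ℂ V) (hη : ∀ x y, η x y = η y x) (D : ExternalData V 𝔤 n)

/-- The rows of `Π` are linear combinations of rows of `M`, and `wick` is multilinear in the vectors
of a product. -/
theorem piPfaffian_eq_wick (h : Finset (Fin n)) (Us Us' : List (Finset (Fin n))) :
    piPfaffian η D h Us Us' = wick (arrayForm_isAlt (rowArray_skew η hη D))
      ((rowList D h Us Us').map fun x => vec (piVec D x)).prod := by
  have hA : ∀ c d, arrayForm (rowArray η D) (momVec c) (momVec d) = matA η D c d := fun c d =>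
    (arrayForm_single _ _ _).trans
      (matM_eq_rowArray η hη D (r := .mom c) (s := .mom d) trivial trivial).symm
  have hC : ∀ c, ∀ d ∈ D.gravitons, arrayForm (rowArray η D) (momVec c) (polVec d) =
      -matC η D d c := fun c d hd => (arrayForm_single _ _ _).trans
        (matM_eq_rowArray η hη D (r := .mom c) (s := .pol d) trivial hd).symm
  have hC' : ∀ c, ∀ d ∈ D.gravitons, arrayForm (rowArray η D) (polVec d) (momVec c) =
      matC η D d c := fun c d hd => (arrayForm_single _ _ _).trans
        (matM_eq_rowArray η hη D (r := .pol d) (s := .mom c) hd trivial).symm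
  have hB : ∀ c ∈ D.gravitons, ∀ d ∈ D.gravitons,
      arrayForm (rowArray η D) (polVec c) (polVec d) = matB η D c d := fun c hc d hd =>
    (arrayForm_single _ _ _).trans
      (matM_eq_rowArray η hη D (r := .pol c) (s := .pol d) hc hd).symm
  have hp : ∀ a, PiRow.pol a ∈ rowList D h Us Us' → a ∈ D.gravitons := fun a ha => by
    simpa [rowList] using ha
  refine pfaffian_eq_wick _ (piVec D) _ (rowList D h Us Us') fun x hx y hy => ?_
  rcases x with a | ⟨p, T⟩ | a <;> rcases y with c | ⟨q, S⟩ | c <;>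
    simp only [matPi, piVec, map_sum, map_smul, LinearMap.sum_apply, LinearMap.smul_apply,
      smul_eq_mul, Finset.mul_sum, mul_assoc]
  · exact (hA a c).symm
  · simp only [hA]
  · exact (hC a c (hp c hy)).symm
  · simp only [hA]
  · simp only [hA]
    rw [Finset.sum_comm]
    refine Finset.sum_congr rfl fun i _ => Finset.sum_congr rfl fun j _ => ?_
    ring
  · simp only [hC _ c (hp c hy), mul_neg, Finset.sum_neg_distrib]
  · exact (hC' c a (hp a hx)).symm
  · simp only [hC' _ a (hp a hx)]
  · exact (hB a (hp a hx) c (hp c hy)).symm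

end Pfaffian
end EYM
end

noncomputable section
namespace EYM

/-! ### Dual vectors of the rows, and equality of all reductions -/

section Duals

variable {V 𝔤 : Type*} {n : ℕ} (D : ExternalData V 𝔤 n)

/-- `α` takes the value `1` at the row `x` and `0` at the other rows in `L`. -/
def IsRowDual (L : List (PiRow n)) (x : PiRow n) (α : Module.Dual ℂ (Row n →₀ ℂ)) : Prop :=
  α (piVec D x) = 1 ∧ ∀ z ∈ L, z ≠ x → α (piVec D z) = 0

theorem momDual_trace (c : Fin n) (p : Bool) (T : Finset (Fin n)) :
    momDual c (piVec D (.trace p T)) = if c ∈ T then weight D p c else 0 := by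
  rw [piVec, map_sum]
  split_ifs with h
  · rw [Finset.sum_eq_single_of_mem c h fun d _ hd => ?_, map_smul, momDual_momVec, smul_eq_mul,
      mul_one]
    rw [map_smul, momDual_momVec_of_ne hd.symm, smul_zero]
  · refine Finset.sum_eq_zero fun d hd => ?_
    rw [map_smul, momDual_momVec_of_ne fun e : c = d => h (e ▸ hd), smul_zero]

/-- The dual vector of the row `i` of a trace containing `c` and `d`. -/
def traceDual (c d : Fin n) : Module.Dual ℂ (Row n →₀ ℂ) :=
  (D.pos d - D.pos c)⁻¹ • (D.pos d • momDual c - D.pos c • momDual d)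

/-- The dual vector of the row `i'` of a trace containing `c` and `d`. -/
def traceDualPrimed (c d : Fin n) : Module.Dual ℂ (Row n →₀ ℂ) :=
  (D.pos d - D.pos c)⁻¹ • (momDual d - momDual c)

theorem traceDual_apply (c d : Fin n) (x : Row n →₀ ℂ) : traceDual D c d x =
    (D.pos d - D.pos c)⁻¹ * (D.pos d * momDual c x - D.pos c * momDual d x) := rfl

theorem traceDualPrimed_apply (c d : Fin n) (x : Row n →₀ ℂ) : traceDualPrimed D c d x =
    (D.pos d - D.pos c)⁻¹ * (momDual d x - momDual c x) := rfl

variable {D}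

theorem isRowDual_momDual (P : Finpartition D.gluons) {a : Fin n} (ha : a ∈ D.gravitons) :
    IsRowDual D (rowList D D.gravitons P.parts.toList P.parts.toList) (.mom a) (momDual a) := by
  refine ⟨momDual_momVec a, fun z hz hza => ?_⟩
  rcases z with b | ⟨p, T⟩ | b
  · exact momDual_momVec_of_ne fun h => hza (h ▸ rfl)
  · have hT : T ∈ P.parts := by cases p <;> simpa [rowList] using hz
    rw [momDual_trace, if_neg fun h => Finset.mem_compl.1 ha (P.subset hT h)]
  · exact momDual_polVec a b

theorem momDual_eq_zero_of_ne {P : Finpartition D.gluons} {T : Finset (Fin n)} (hT : T ∈ P.parts)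
    {c : Fin n} (hc : c ∈ T) {z : PiRow n}
    (hz : z ∈ rowList D D.gravitons P.parts.toList P.parts.toList)
    (hzT : ∀ p, z ≠ .trace p T) : momDual c (piVec D z) = 0 := by
  rcases z with b | ⟨p, S⟩ | b
  · have hb : b ∈ D.gravitons := by simpa [rowList] using hz
    exact momDual_momVec_of_ne fun h => Finset.mem_compl.1 hb (P.subset hT (h ▸ hc))
  · have hS : S ∈ P.parts := by cases p <;> simpa [rowList] using hz
    rw [momDual_trace, if_neg fun h => hzT p (by rw [P.eq_of_mem_parts hS hT h hc])]
  · exact momDual_polVec c b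

/-- On the two rows of `T` the coordinates at `c` and `d` are the values at `σ_c`, `σ_d` of an
affine function. This dual vector reads off its constant term, the primed one its slope; hence a
trace needs two labels. -/
theorem isRowDual_traceDual (hpos : Function.Injective D.pos) {P : Finpartition D.gluons}
    {T : Finset (Fin n)} (hT : T ∈ P.parts) {c d : Fin n} (hc : c ∈ T) (hd : d ∈ T) (hcd : c ≠ d) :
    IsRowDual D (rowList D D.gravitons P.parts.toList P.parts.toList) (.trace false T)
      (traceDual D c d) := by
  have h0 : D.pos d - D.pos c ≠ 0 := sub_ne_zero.2 (hpos.ne hcd.symm)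
  refine ⟨?_, fun z hz hzT => ?_⟩
  · rw [traceDual_apply, momDual_trace, momDual_trace, if_pos hc, if_pos hd]
    simp [weight, h0]
  · rw [traceDual_apply]
    by_cases h : z = .trace true T
    · rw [h, momDual_trace, momDual_trace, if_pos hc, if_pos hd]
      simp [weight, mul_comm]
    · have h1 : ∀ p, z ≠ .trace p T := by rintro (_ | _) <;> assumption
      rw [momDual_eq_zero_of_ne hT hc hz h1, momDual_eq_zero_of_ne hT hd hz h1]
      simp

theorem isRowDual_traceDualPrimed (hpos : Function.Injective D.pos) {P : Finpartition D.gluons}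
    {T : Finset (Fin n)} (hT : T ∈ P.parts) {c d : Fin n} (hc : c ∈ T) (hd : d ∈ T) (hcd : c ≠ d) :
    IsRowDual D (rowList D D.gravitons P.parts.toList P.parts.toList) (.trace true T)
      (traceDualPrimed D c d) := by
  have h0 : D.pos d - D.pos c ≠ 0 := sub_ne_zero.2 (hpos.ne hcd.symm)
  refine ⟨?_, fun z hz hzT => ?_⟩
  · rw [traceDualPrimed_apply, momDual_trace, momDual_trace, if_pos hc, if_pos hd]
    simp [weight, h0]
  · rw [traceDualPrimed_apply]
    by_cases h : z = .trace false T
    · rw [h, momDual_trace, momDual_trace, if_pos hc, if_pos hd]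
      simp [weight]
    · have h1 : ∀ p, z ≠ .trace p T := by rintro (_ | _) <;> assumption
      rw [momDual_eq_zero_of_ne hT hc hz h1, momDual_eq_zero_of_ne hT hd hz h1]
      simp

/-- The values on the two null vectors are `(1, 0)` for a trace row, `(0, 1)` for a primed one and
`(1, σ_a)` for a graviton. Their determinants are the normalizations of the reduced Pfaffians. -/
theorem traceDual_sum_momVec (hpos : Function.Injective D.pos) {c d : Fin n} (hcd : c ≠ d) :
    traceDual D c d (∑ i, momVec i) = 1 := by
  rw [traceDual_apply, dual_sum_momVec, dual_sum_momVec, mul_one, mul_one,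
    inv_mul_cancel₀ (sub_ne_zero.2 (hpos.ne hcd.symm))]

theorem traceDual_sum_pos_momVec (c d : Fin n) :
    traceDual D c d (∑ i, D.pos i • momVec i) = 0 := by
  rw [traceDual_apply, dual_sum_pos_momVec, dual_sum_pos_momVec]
  ring

theorem traceDualPrimed_sum_momVec (c d : Fin n) :
    traceDualPrimed D c d (∑ i, momVec i) = 0 := by
  rw [traceDualPrimed_apply, dual_sum_momVec, dual_sum_momVec, sub_self, mul_zero]

theorem traceDualPrimed_sum_pos_momVec (hpos : Function.Injective D.pos) {c d : Fin n}
    (hcd : c ≠ d) : traceDualPrimed D c d (∑ i, D.pos i • momVec i) = 1 := by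
  rw [traceDualPrimed_apply, dual_sum_pos_momVec, dual_sum_pos_momVec,
    inv_mul_cancel₀ (sub_ne_zero.2 (hpos.ne hcd.symm))]

end Duals

section Reduction

variable {V 𝔤 : Type*} {n : ℕ}

/-- The sign between the products of the rows in the order of the particles and in blocks. -/
def blockSign (D : ExternalData V 𝔤 n) (P : Finpartition D.gluons) : ℂ :=
  pairSign D.gravitons.card * pairSign P.parts.card

theorem exists_pair_of_mem_tracePartitions {D : ExternalData V 𝔤 n} {P : Finpartition D.gluons}
    (hP : P ∈ tracePartitions D) {T : Finset (Fin n)} (hT : T ∈ P.parts) :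
    ∃ c ∈ T, ∃ d ∈ T, c ≠ d :=
  Finset.one_lt_card.1 ((Finset.mem_filter.1 hP).2 T hT)

variable [AddCommGroup V] [Module ℂ V]
  (η : LinearMap.BilinForm ℂ V) (hη : ∀ x y, η x y = η y x) (D : ExternalData V 𝔤 n)

/-- Contracting with the coordinates of two rows deletes these rows; `k` need only have the parity
of the sum of their positions. -/
theorem contractedProduct_eq_piPfaffian (P : Finpartition D.gluons)
    {A B C : List (PiRow n)} {x y : PiRow n} {α β : Module.Dual ℂ (Row n →₀ ℂ)}
    {h : Finset (Fin n)} {Us Us' : List (Finset (Fin n))} {k : ℕ}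
    (hα : IsRowDual D (rowList D D.gravitons P.parts.toList P.parts.toList) x α)
    (hβ : IsRowDual D (rowList D D.gravitons P.parts.toList P.parts.toList) y β)
    (hL : rowList D D.gravitons P.parts.toList P.parts.toList = A ++ x :: B ++ y :: C)
    (hU : rowList D h Us Us' = A ++ B ++ C) (hk : Even (A.length + (A ++ x :: B).length) ↔ Even k) :
    blockSign D P * ((-1) ^ k * piPfaffian η D h Us Us') =
      contractedProduct η hη D P.parts α β := by
  have hN := rowList_nodup D D.gravitons P.parts.nodup_toList P.parts.nodup_toList
  rw [IsRowDual, hL] at hα hβ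
  rw [hL] at hN
  rw [contractedProduct, evenVal_rowProduct, map_smul, map_smul, map_smul, hL,
    contr_contr_list_prod (piVec D) hN hα.1 hα.2 hβ.1 hβ.2, map_smul, ← hU,
    ← piPfaffian_eq_wick η hη D, neg_one_pow_congr hk]
  rfl

variable {η D} (hD : OnShell η D) (hpos : Function.Injective D.pos) {P : Finpartition D.gluons}
  (hP : P ∈ tracePartitions D)

include hη hD hpos hP in
/-- All reduced Pfaffians are equal. -/
theorem blockSign_mul_reducedPfaffian {p q : Fin n} (hpq : p ≠ q) (r : Reduction D (traces P)) :
    blockSign D P * reducedPfaffian η D (traces P) r =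
      (D.pos p - D.pos q)⁻¹ * contractedProduct η hη D P.parts (momDual p) (momDual q) := by
  have key := contractedProduct_eq η hη D hD hpos P hpq
  have hlen : P.parts.toList.length = P.parts.card := Finset.length_toList _
  have hmem : ∀ i : Fin (traces P).length, (traces P)[i] ∈ P.parts := fun i =>
    Finset.mem_toList.1 (List.getElem_mem i.2)
  have hinv : (D.pos p - D.pos q)⁻¹ = -(D.pos q - D.pos p)⁻¹ := by rw [← inv_neg, neg_sub]
  rcases r with ⟨a, b, ha, hb, hab⟩ | ⟨i, j⟩ | ⟨a, ha, ha0, i⟩ | ⟨a, ha, j⟩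
  · obtain ⟨S, T, U, h1, h2⟩ := exists_sort_eq_pair ha hb hab
    have h3 := contractedProduct_eq_piPfaffian η hη D P (isRowDual_momDual P ha)
      (isRowDual_momDual P hb) (A := S.map PiRow.mom) (B := T.map PiRow.mom)
      (C := U.map PiRow.mom ++ P.parts.toList.map (PiRow.trace false) ++
        P.parts.toList.map (PiRow.trace true) ++ D.gravitons.sort.map PiRow.pol)
      (h := (D.gravitons.erase a).erase b) (Us := P.parts.toList) (Us' := P.parts.toList)
      (k := D.rank a + D.rank b) (by simp [rowList, h1]) (by simp [rowList, h2])
      (by rw [rank_eq_length D h1, rank_eq_length D (by simpa using h1 :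
        D.gravitons.sort = S ++ a :: (T ++ b :: U))]; simp)
    -- The determinant is `σ_b - σ_a`; its sign is that of `hinv`.
    rw [key, dual_sum_momVec, dual_sum_momVec, dual_sum_pos_momVec, dual_sum_pos_momVec] at h3
    have h4 : D.pos a - D.pos b ≠ 0 := sub_ne_zero.2 (hpos.ne hab.ne)
    simp only [reducedPfaffian, ExternalData.diff, traces]
    rw [hinv, div_mul_eq_mul_div, mul_div_assoc', h3, div_eq_iff h4]
    ring
  · obtain ⟨T1, T2, h1, h2, h3⟩ := list_split (traces P) i
    obtain ⟨U1, U2, h4, h5, h6⟩ := list_split (traces P) j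
    obtain ⟨c, hc, d, hd, hcd⟩ := exists_pair_of_mem_tracePartitions hP (hmem i)
    obtain ⟨e, he, f, hf, hef⟩ := exists_pair_of_mem_tracePartitions hP (hmem j)
    have h7 := contractedProduct_eq_piPfaffian η hη D P
      (isRowDual_traceDual hpos (hmem i) hc hd hcd)
      (isRowDual_traceDualPrimed hpos (hmem j) he hf hef)
      (A := D.gravitons.sort.map PiRow.mom ++ T1.map (PiRow.trace false))
      (B := T2.map (PiRow.trace false) ++ U1.map (PiRow.trace true))
      (C := U2.map (PiRow.trace true) ++ D.gravitons.sort.map PiRow.pol)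
      (h := D.gravitons) (Us := (traces P).eraseIdx i) (Us' := (traces P).eraseIdx j)
      (k := i + j + (traces P).length) ?_ (by simp [rowList, h2, h5]) ?_
    -- The determinant is `1`; the sign of `hinv` becomes the extra `+ 1` in the exponent.
    · rw [key, traceDual_sum_momVec hpos hcd, traceDual_sum_pos_momVec,
        traceDualPrimed_sum_momVec, traceDualPrimed_sum_pos_momVec hpos hef] at h7
      simp only [reducedPfaffian]
      rw [hinv, pow_succ]
      linear_combination -h7
    · have h8 := congrArg (List.map (PiRow.trace false)) h1
      have h9 := congrArg (List.map (PiRow.trace true)) h4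
      rw [List.map_append, List.map_cons] at h8 h9
      change D.gravitons.sort.map PiRow.mom ++ (traces P).map (PiRow.trace false) ++
        (traces P).map (PiRow.trace true) ++ _ = _
      rw [h8, h9]
      simp
    -- The rows sit at `|h| + i` and `|h| + m + j`, so `|h|` drops out of the parity.
    · have h8 := congrArg List.length h1
      simp only [List.length_append, List.length_map, List.length_cons, Finset.length_sort] at h8 ⊢
      rw [Nat.even_iff, Nat.even_iff]
      omega
  · obtain ⟨S, T, h1, h2⟩ := exists_sort_eq ha
    obtain ⟨T1, T2, h3, h4, h5⟩ := list_split (traces P) i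
    obtain ⟨c, hc, d, hd, hcd⟩ := exists_pair_of_mem_tracePartitions hP (hmem i)
    have h6 := contractedProduct_eq_piPfaffian η hη D P (isRowDual_momDual P ha)
      (isRowDual_traceDual hpos (hmem i) hc hd hcd)
      (A := S.map PiRow.mom) (B := T.map PiRow.mom ++ T1.map (PiRow.trace false))
      (C := T2.map (PiRow.trace false) ++ (traces P).map (PiRow.trace true) ++
        D.gravitons.sort.map PiRow.pol)
      (h := D.gravitons.erase a) (Us := (traces P).eraseIdx i) (Us' := traces P)
      (k := D.rank a + D.gravitons.card + i) ?_ (by simp [rowList, h2, h4]) ?_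
    -- The determinant is `-σ_a`; dividing it out is where `σ_a ≠ 0` enters.
    · rw [key, traceDual_sum_momVec hpos hcd, traceDual_sum_pos_momVec, dual_sum_momVec,
        dual_sum_pos_momVec] at h6
      simp only [reducedPfaffian]
      rw [hinv, div_mul_eq_mul_div, mul_div_assoc', h6, div_eq_iff ha0]
      ring
    · have h8 := congrArg (List.map (PiRow.trace false)) h3
      rw [List.map_append, List.map_cons] at h8
      change D.gravitons.sort.map PiRow.mom ++ (traces P).map (PiRow.trace false) ++
        (traces P).map (PiRow.trace true) ++ _ = _
      rw [h8, h1]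
      simp
    · have h8 := congrArg List.length h1
      rw [rank_eq_length D h1]
      simp only [List.length_append, List.length_map, List.length_cons, Finset.length_sort] at h8 ⊢
      rw [Nat.even_iff, Nat.even_iff]
      omega
  · obtain ⟨S, T, h1, h2⟩ := exists_sort_eq ha
    obtain ⟨T1, T2, h3, h4, h5⟩ := list_split (traces P) j
    obtain ⟨c, hc, d, hd, hcd⟩ := exists_pair_of_mem_tracePartitions hP (hmem j)
    have h6 := contractedProduct_eq_piPfaffian η hη D P (isRowDual_momDual P ha)
      (isRowDual_traceDualPrimed hpos (hmem j) hc hd hcd)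
      (A := S.map PiRow.mom) (B := T.map PiRow.mom ++ (traces P).map (PiRow.trace false) ++
        T1.map (PiRow.trace true))
      (C := T2.map (PiRow.trace true) ++ D.gravitons.sort.map PiRow.pol)
      (h := D.gravitons.erase a) (Us := traces P) (Us' := (traces P).eraseIdx j)
      (k := D.rank a + D.gravitons.card + (traces P).length + j) ?_ (by simp [rowList, h2, h4]) ?_
    · rw [key, traceDualPrimed_sum_momVec, traceDualPrimed_sum_pos_momVec hpos hcd,
        dual_sum_momVec, dual_sum_pos_momVec] at h6
      simp only [reducedPfaffian]
      rw [hinv, pow_succ]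
      linear_combination -h6
    · have h8 := congrArg (List.map (PiRow.trace true)) h3
      rw [List.map_append, List.map_cons] at h8
      change D.gravitons.sort.map PiRow.mom ++ (traces P).map (PiRow.trace false) ++
        (traces P).map (PiRow.trace true) ++ _ = _
      rw [h8, h1]
      simp
    · have h8 := congrArg List.length h1
      rw [rank_eq_length D h1]
      simp only [List.length_append, List.length_map, List.length_cons, Finset.length_sort] at h8 ⊢
      rw [Nat.even_iff, Nat.even_iff]
      omega

end Reduction
end EYM
end

noncomputable section
namespace EYM

/-! ### Comb structures and reduced Pfaffians -/

theorem prod_ofFn_vec₂ {M : Type*} [AddCommGroup M] [Module ℂ M] {m : ℕ} (f g : Fin m → M) :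
    evenVal (∏ i, vec₂ (f i) (g i)) = pairSign m •
      ((List.ofFn fun i => vec (f i)).prod * (List.ofFn fun i => vec (g i)).prod) := by
  have h := evenVal_list_prod_vec₂ f g (List.finRange m)
  rw [List.length_finRange, ← List.ofFn_eq_map, ← List.ofFn_eq_map, ← List.ofFn_eq_map] at h
  rw [← h, List.prod_ofFn]

section

variable {V 𝔤 : Type*} [LieRing 𝔤] [LieAlgebra ℂ 𝔤] {n : ℕ} (κ : LinearMap.BilinForm ℂ 𝔤)
  (D : ExternalData V 𝔤 n)

/-- Antisymmetrizing `(∑ μ_c) ∧ (∑ σ_d μ_d)` leaves the coefficient `σ_d - σ_c` for each pair `c <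
d`, which is the factor in `𝒦(c,d|T)`. -/
theorem sum_combK_smul_vec₂ (T : Finset (Fin n)) :
    ∑ cd ∈ (T ×ˢ T).filter (fun cd => cd.1 < cd.2),
      combK κ D cd.1 cd.2 T • vec₂ (momVec cd.1) (momVec cd.2) =
        comb κ D T • tracePair D.pos momVec T := by
  have h1 : tracePair D.pos momVec T =
      ∑ cd ∈ T ×ˢ T, D.pos cd.2 • vec₂ (momVec cd.1) (momVec cd.2) := by
    refine even_ext ?_
    simp only [evenVal_tracePair, rowSum, weightedRowSum, map_sum, map_smul, evenVal_vec₂,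
      Finset.sum_mul_sum, mul_smul_comm]
    rw [Finset.sum_product]
  have h2 : ∑ cd ∈ T ×ˢ T, D.pos cd.2 • vec₂ (momVec cd.1) (momVec cd.2) =
      ∑ cd ∈ (T ×ˢ T).filter (fun cd => cd.1 < cd.2),
        (D.pos cd.2 - D.pos cd.1) • vec₂ (momVec cd.1) (momVec cd.2) := by
    have h3 : ∑ cd ∈ (T ×ˢ T).filter (fun cd => ¬cd.1 < cd.2),
        D.pos cd.2 • vec₂ (momVec cd.1) (momVec cd.2) =
          ∑ cd ∈ (T ×ˢ T).filter (fun cd => cd.1 < cd.2),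
            -(D.pos cd.1 • vec₂ (momVec cd.1) (momVec cd.2)) := by
      symm
      -- The complement of `c < d` also contains the diagonal, whose terms vanish; hence a bijection
      -- of nonzero terms only.
      refine Finset.sum_bij_ne_zero (fun cd _ _ => cd.swap) ?_ ?_ ?_ ?_
      · intro cd h _
        simp only [Finset.mem_filter, Finset.mem_product, Prod.fst_swap, Prod.snd_swap] at h ⊢
        exact ⟨h.1.symm, h.2.not_gt⟩
      · intro cd _ _ cd' _ _ h
        exact Prod.swap_injective h
      · intro cd h h0
        simp only [Finset.mem_filter, Finset.mem_product] at h
        have hne : cd.1 ≠ cd.2 := fun e => h0 (by rw [e, vec₂_self, smul_zero])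
        have hlt : cd.2 < cd.1 := lt_of_le_of_ne (not_lt.1 h.2) hne.symm
        refine ⟨cd.swap, by simpa [hlt] using h.1.symm, ?_, Prod.swap_swap cd⟩
        rw [Prod.fst_swap, Prod.snd_swap, vec₂_swap, smul_neg, neg_neg]
        exact h0
      · intro cd _ _
        rw [Prod.fst_swap, Prod.snd_swap, vec₂_swap (momVec cd.2), smul_neg]
    rw [← Finset.sum_filter_add_sum_filter_not (T ×ˢ T) (fun cd => cd.1 < cd.2), h3,
      ← Finset.sum_add_distrib]
    exact Finset.sum_congr rfl fun cd _ => by rw [sub_smul, sub_eq_add_neg]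
  rw [h1, h2, Finset.smul_sum]
  refine Finset.sum_congr rfl fun cd _ => ?_
  rw [combK, ExternalData.diff, smul_smul, mul_comm]

end

section

variable {V 𝔤 : Type*} {n : ℕ} (D : ExternalData V 𝔤 n)

/-- `m(m+1)/2 = m + m(m-1)/2`: the `m` extra signs are those of the trace terms `-𝒞(T)`. -/
theorem orderSign_eq (P : Finpartition D.gluons) :
    orderSign D P = (-1) ^ P.parts.card * blockSign D P := by
  have h : P.parts.card * (P.parts.card + 1) / 2 =
      P.parts.card + P.parts.card * (P.parts.card - 1) / 2 := by
    generalize P.parts.card = c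
    have h := Nat.choose_two_right (c + 1)
    rw [Nat.add_sub_cancel, mul_comm, Nat.choose_succ_succ' c 1, Nat.choose_one_right,
      Nat.choose_two_right] at h
    exact h.symm
  rw [orderSign, h, blockSign, pairSign, pairSign, pow_add, pow_add]
  ring

end

section

variable {V 𝔤 : Type*} [AddCommGroup V] [Module ℂ V] {n : ℕ}
  (η : LinearMap.BilinForm ℂ V) (hη : ∀ x y, η x y = η y x) (D : ExternalData V 𝔤 n)

include hη in
theorem pfaffian_matM_eq (h : Finset (Fin n)) {m : ℕ} (c d : Fin m → Fin n) :
    pfaffian (matM η D) (h.sort.map Row.mom ++ (List.ofFn fun i => Row.mom (c i)) ++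
      (List.ofFn fun i => Row.mom (d i)) ++ D.gravitons.sort.map Row.pol) =
      pairSign m * wick (arrayForm_isAlt (rowArray_skew η hη D))
        ((h.sort.map fun a => vec (momVec a)).prod *
          (evenVal (∏ i, vec₂ (momVec (c i)) (momVec (d i))) *
            (D.gravitons.sort.map fun a => vec (polVec a)).prod)) := by
  rw [pfaffian_eq_wick (arrayForm_isAlt (rowArray_skew η hη D)) (fun r => Finsupp.single r 1) _ _
    fun x hx y hy => ?_, prod_ofFn_vec₂, smul_mul_assoc, mul_smul_comm, map_smul, smul_eq_mul,
    ← mul_assoc, pairSign_mul_self, one_mul]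
  · simp only [List.map_append, List.prod_append, List.map_map, List.map_ofFn, Function.comp_def,
      mul_assoc, momVec, polVec]
  · rw [arrayForm_single]
    have h0 : ∀ z ∈ h.sort.map Row.mom ++ (List.ofFn fun i => Row.mom (c i)) ++
        (List.ofFn fun i => Row.mom (d i)) ++ D.gravitons.sort.map Row.pol,
        IsPhysicalRow D z := by
      intro z hz
      rcases z with i | i
      · trivial
      · simpa [IsPhysicalRow, List.mem_ofFn] using hz
    exact matM_eq_rowArray η hη D (h0 x hx) (h0 y hy)

/-- In a one-element block the two trace rows are proportional, so the product of rows is already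
zero. -/
theorem contractedProduct_eq_zero {P : Finpartition D.gluons} (hP : P ∉ tracePartitions D)
    (α β : Module.Dual ℂ (Row n →₀ ℂ)) : contractedProduct η hη D P.parts α β = 0 := by
  simp only [tracePartitions, Finset.mem_filter, Finset.mem_univ, true_and, not_forall, not_le] at hP
  obtain ⟨T, hT, h⟩ := hP
  have h1 : T.card = 1 := by
    have := (P.nonempty_of_mem_parts hT).card_pos
    omega
  obtain ⟨c, rfl⟩ := Finset.card_eq_one.1 h1
  have h2 : tracePair D.pos momVec {c} = (0 : evenPart (Row n →₀ ℂ)) := by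
    rw [tracePair, rowSum, weightedRowSum, Finset.sum_singleton, Finset.sum_singleton,
      vec₂_smul_right, vec₂_self, smul_zero]
  rw [contractedProduct, rowProduct, Finset.prod_eq_zero hT h2, mul_zero, map_zero, map_zero,
    map_zero, map_zero]

end

section CombPfaffian

variable {V 𝔤 : Type*} [AddCommGroup V] [Module ℂ V] [LieRing 𝔤] [LieAlgebra ℂ 𝔤] {n : ℕ}
  (η : LinearMap.BilinForm ℂ V) (hη : ∀ x y, η x y = η y x) (κ : LinearMap.BilinForm ℂ 𝔤)
  (D : ExternalData V 𝔤 n)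

include hη in
-- Multilinear expansion of the Pfaffian of `Π` in its trace pairs. Both Pfaffians need the same
-- reordering of pairs into blocks, so no sign is left.
theorem combPfaffianSum_eq (h : Finset (Fin n)) (Ts : List (Finset (Fin n))) :
    combPfaffianSum η κ D h Ts = (Ts.map (comb κ D)).prod * piPfaffian η D h Ts Ts := by
  have h1 : piPfaffian η D h Ts Ts = pairSign Ts.length *
      wick (arrayForm_isAlt (rowArray_skew η hη D)) ((h.sort.map fun a => vec (momVec a)).prod *
        (evenVal (∏ i : Fin Ts.length, tracePair D.pos momVec Ts[i]) *
          (D.gravitons.sort.map fun a => vec (polVec a)).prod)) := by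
    have h2 : ∀ f : Finset (Fin n) → ExteriorAlgebra ℂ (Row n →₀ ℂ),
        (List.ofFn fun i : Fin Ts.length => f Ts[i]) = Ts.map f := fun f =>
      List.ext_getElem (by simp) fun _ _ _ => by simp
    simp only [tracePair]
    rw [piPfaffian_eq_wick η hη, prod_ofFn_vec₂, h2 fun T => vec (rowSum momVec T),
      h2 fun T => vec (weightedRowSum D.pos momVec T), smul_mul_assoc, mul_smul_comm, map_smul,
      smul_eq_mul, ← mul_assoc, pairSign_mul_self, one_mul]
    simp only [rowList, List.map_append, List.prod_append, List.map_map, Function.comp_def,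
      mul_assoc, piVec_trace_false, piVec_trace_true]
    rfl
  have h2 : (∏ i : Fin Ts.length, comb κ D Ts[i]) • ∏ i : Fin Ts.length,
      tracePair D.pos momVec Ts[i] = ∑ p ∈ Fintype.piFinset
        (fun i : Fin Ts.length => (Ts[i] ×ˢ Ts[i]).filter fun cd => cd.1 < cd.2),
          (∏ i : Fin Ts.length, combK κ D (p i).1 (p i).2 Ts[i]) •
            ∏ i : Fin Ts.length, vec₂ (momVec (p i).1) (momVec (p i).2) := by
    rw [← Finset.prod_smul]
    simp only [← sum_combK_smul_vec₂]
    rw [Finset.prod_univ_sum]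
    exact Finset.sum_congr rfl fun p _ => Finset.prod_smul _ _ _
  have h3 : (Ts.map (comb κ D)).prod = ∏ i : Fin Ts.length, comb κ D Ts[i] := by
    simp
  rw [combPfaffianSum, h1, h3, mul_left_comm, ← smul_eq_mul (∏ i : Fin Ts.length, comb κ D Ts[i]),
    ← map_smul, ← mul_smul_comm, ← smul_mul_assoc, ← map_smul, h2, map_sum, Finset.sum_mul,
    Finset.mul_sum, map_sum, Finset.mul_sum]
  refine Finset.sum_congr rfl fun p _ => ?_
  rw [pfaffian_matM_eq η hη D, map_smul, smul_mul_assoc, mul_smul_comm, map_smul, smul_eq_mul,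
    mul_left_comm]

variable {D} in
/-- The reduction of `Π` for a reduction of the sum over the comb structures. -/
def CombReduction.toReduction {Ts : List (Finset (Fin n))} :
    CombReduction D Ts → Reduction D Ts
  | .gravitons a b ha hb hab => .gravitons a b ha hb hab
  | .trace i => .traces i i

include hη in
-- Dropping a whole trace removes its rows `i` and `i'`, and the sign `(-1)^(i+i+m+1)` no longer
-- depends on `i`.
theorem combReduced_eq {Ts : List (Finset (Fin n))} (r : CombReduction D Ts) :
    combReduced η κ D Ts r =
      (Ts.map (comb κ D)).prod * reducedPfaffian η D Ts r.toReduction := by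
  rcases r with ⟨a, b, ha, hb, hab⟩ | i
  · simp only [combReduced, CombReduction.toReduction, reducedPfaffian]
    rw [combPfaffianSum_eq η hη, mul_left_comm]
  · obtain ⟨S, T, h1, h2, -⟩ := list_split Ts i
    have h3 : (Ts.map (comb κ D)).prod = comb κ D Ts[i] * ((Ts.eraseIdx i).map (comb κ D)).prod := by
      have := congrArg (fun L => (List.map (comb κ D) L).prod) h1
      simp only [List.map_append, List.map_cons, List.prod_append, List.prod_cons] at this
      rw [this, h2, List.map_append, List.prod_append, mul_left_comm]
    simp only [combReduced, CombReduction.toReduction, reducedPfaffian]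
    rw [combPfaffianSum_eq η hη, h3, pow_succ, pow_succ, pow_add _ ((i : ℕ) + i),
      Even.neg_one_pow ⟨_, rfl⟩]
    ring

end CombPfaffian

/-! ### The correlator as a sum of reduced Pfaffians -/

section Theorem

variable {V 𝔤 : Type*} [AddCommGroup V] [Module ℂ V] [LieRing 𝔤] [LieAlgebra ℂ 𝔤] {N n : ℕ}
  (η : LinearMap.BilinForm ℂ V) (hη : ∀ x y, η x y = η y x)
  (κ : LinearMap.BilinForm ℂ 𝔤) (hκ : ∀ x y z, κ ⁅x, y⁆ z = κ x ⁅y, z⁆)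
  (b : Module.Basis (Fin N) ℂ 𝔤) (hb : ∀ x y, κ (b x) (b y) = if x = y then 1 else 0)
  (D : ExternalData V 𝔤 n)

include hη hκ hb in
theorem correlator_eq_sum_reducedPfaffian (hD : OnShell η D) (hpos : Function.Injective D.pos)
    {F : Finset (Fin n)} (hF : F.card = 2)
    (r : (P : Finpartition D.gluons) → Reduction D (traces P)) :
    correlator η κ b D F = ∑ P ∈ tracePartitions D,
      orderSign D P * (∏ T ∈ P.parts, comb κ D T) * reducedPfaffian η D (traces P) (r P) := by
  obtain ⟨p, q, hpq, rfl⟩ : ∃ p q, p < q ∧ F = {p, q} := by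
    obtain ⟨p, q, hpq, rfl⟩ := Finset.card_eq_two.1 hF
    rcases hpq.lt_or_gt with h | h
    · exact ⟨p, q, h, rfl⟩
    · exact ⟨q, p, h, Finset.pair_comm p q⟩
  rw [correlator_eq η hη κ hκ b hb D hpos hpq,
    ← Finset.sum_subset (Finset.subset_univ (tracePartitions D)) fun P _ hP => by
      rw [contractedProduct_eq_zero η hη D hP, mul_zero, mul_zero]]
  refine Finset.sum_congr rfl fun P hP => ?_
  rw [← blockSign_mul_reducedPfaffian hη hD hpos hP hpq.ne (r P), orderSign_eq, Finset.prod_neg]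
  ring

end Theorem
end EYM
end

theorem mainTheorem1 {V 𝔤 : Type*} [AddCommGroup V] [Module ℂ V] [LieRing 𝔤] [LieAlgebra ℂ 𝔤]
    {N n : ℕ} (η : LinearMap.BilinForm ℂ V) (hη : ∀ x y, η x y = η y x)
    (κ : LinearMap.BilinForm ℂ 𝔤) (hκ : ∀ x y z, κ ⁅x, y⁆ z = κ x ⁅y, z⁆)
    (b : Module.Basis (Fin N) ℂ 𝔤) (hb : ∀ x y, κ (b x) (b y) = if x = y then 1 else 0)
    (D : EYM.ExternalData V 𝔤 n) (hpos : Function.Injective D.pos) (F : Finset (Fin n)) :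
    (EYM.correlator η κ b D F ≠ 0 → F.card = 2) ∧
    (EYM.OnShell η D → F.card = 2 →
      (∀ r : (P : Finpartition D.gluons) → EYM.CombReduction D (EYM.traces P),
        EYM.correlator η κ b D F =
          ∑ P ∈ EYM.tracePartitions D,
            EYM.orderSign D P * EYM.combReduced η κ D (EYM.traces P) (r P)) ∧
      (∀ r : (P : Finpartition D.gluons) → EYM.Reduction D (EYM.traces P),
        EYM.correlator η κ b D F =
          ∑ P ∈ EYM.tracePartitions D,
            EYM.orderSign D P * (∏ T ∈ P.parts, EYM.comb κ D T) *
              EYM.reducedPfaffian η D (EYM.traces P) (r P))) := by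
  refine ⟨fun h => ?_, fun hD hF => ⟨fun r => ?_, fun r =>
    EYM.correlator_eq_sum_reducedPfaffian η hη κ hκ b hb D hD hpos hF r⟩⟩
  · by_contra hF
    exact h (by rw [EYM.correlator, EYM.ghostCorrelator_of_card_ne _ hF, zero_mul])
  · refine (EYM.correlator_eq_sum_reducedPfaffian η hη κ hκ b hb D hD hpos hF
      fun P => (r P).toReduction).trans (Finset.sum_congr rfl fun P _ => ?_)
    have h : ∏ T ∈ P.parts, EYM.comb κ D T = ((EYM.traces P).map (EYM.comb κ D)).prod :=
      (Finset.prod_map_toList _ _).symm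
    rw [EYM.combReduced_eq η hη κ D, h, mul_assoc]
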